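/- Let $\mathbb{C}P^2$ carry the Fubini--Study metric of constant holomorphic sectional curvature $4$, and let $f:\mathbb{C}\to\mathbb{C}P^2$ be a conformally parametrized minimal Lagrangian immersion, $z=x+iy$, with induced metric $2e^{u}\,dz\,d\bar z$, which is translationally equivariant: $f(z+t)=R(t)f(z)$ for all $t\in\mathbb{R}$, $z\in\mathbb{C}$, with a one-parameter subgroup $R$ of $SU(3)$. Then $u$ depends only on $y$ and the Hopf differential $F_{zz}\cdot\overline{F_{\bar z}}\,dz^3$ ($F$ a horizontal lift of $f$ to $S^5\subset\mathbb{C}^3$) has a constant coefficient; write this coefficient as $-i\lambda^{-3}\psi$ with $|\lambda|=1$. Put $$a_1=e^{u(0)},\quad \beta=2a_1+\frac{|\psi|^2}{a_1^2},\quad a_{2,3}=\tfrac12\Big(\pm(\tfrac\beta2-a_1)+\sqrt{(\tfrac\beta2-a_1)^2+4a_1(\tfrac\beta2-a_1)}\Big),$$ and assume that the origin is chosen so that $u'(0)=0$ and $a_2<a_1$ (for a non-flat surface with $\psi\ne0$ this can always be achieved by a translation in $y$). Let $$T=\frac{K}{r},\qquad r=\sqrt{2(a_1+a_3)},\qquad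 K=\int_0^{\pi/2}\frac{d\theta}{\sqrt{1-k^2\sin^2\theta}},\qquad k^2=\frac{a_1-a_2}{a_1+a_3},$$ so that $2T$ is the smallest positive period of $u(y)$. A frame of $f$ is a smooth map $\mathbb{F}:\mathbb{C}\to SU(3)$ with $f=[\mathbb{F}e_3]$ and $$\mathbb{F}^{-1}\mathbb{F}_z=\begin{pmatrix}\frac{u_z}{2}&0&i\lambda^{-1}e^{u/2}\\-i\lambda^{-1}\psi e^{-u}&-\frac{u_z}{2}&0\\0&i\lambda^{-1}e^{u/2}&0\end{pmatrix},\qquad \mathbb{F}^{-1}\mathbb{F}_{\bar z}=\begin{pmatrix}-\frac{u_{\bar z}}{2}&-i\lambda\bar\psi e^{-u}&0\\0&\frac{u_{\bar z}}{2}&i\lambda e^{u/2}\\i\lambda e^{u/2}&0&0\end{pmatrix};$$ then $F=\mathbb{F}e_3$ is the canonical horizontal lift of $f$. Let $id_1,id_2,id_3$ ($d_j\in\mathbb{R}$), in any order, be the eigenvalues of $$D=\mathbb{F}(0)^{-1}\partial_x\mathbb{F}(0)=\begin{pmatrix}0&-i\lambda\bar\psi e^{-u(0)}&i\lambda^{-1}e^{u(0)/2}\\-i\lambda^{-1}\psi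 e^{-u(0)}&0&i\lambda e^{u(0)/2}\\i\lambda e^{u(0)/2}&i\lambda^{-1}e^{u(0)/2}&0\end{pmatrix}.$$ **Theorem.** Assume that $\lambda^{-3}\psi$ is neither real nor purely imaginary. Then $f$ has a frame; for all $j$ and $y$ one has $d_je^{u(y)}-\mathrm{Re}(\lambda^{-3}\psi)\neq0$, and $$h_j(y)=\left(\frac{d_je^{u(y)}-\mathrm{Re}(\lambda^{-3}\psi)}{d_j^3-\mathrm{Re}(\lambda^{-3}\psi)}\right)^{1/2},\qquad G_j(y)=\int_0^y\frac{d_j\,\mathrm{Im}(\lambda^{-3}\psi)}{d_je^{u(s)}-\mathrm{Re}(\lambda^{-3}\psi)}\,ds$$ are well defined, with a positive radicand. For every frame $\mathbb{F}$ of $f$ there is an orthonormal basis $l_1,l_2,l_3$ of $\mathbb{C}^3$ with $Dl_j=id_jl_j$ such that $$F(x+iy)=\mathbb{F}(0)\sum_{j=1}^3h_j(y)\,e^{id_jx+iG_j(y)}\,l_j\qquad(x,y\in\mathbb{R});$$ in particular $F=\sum_jh_je^{id_jx+iG_j}l_j$ if $\mathbb{F}(0)=I$, which can be achieved by an isometry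 of $\mathbb{C}P^2$. Moreover, $f$ descends to a torus (that is, $f$ has two periods in $\mathbb{C}$ that are linearly independent over $\mathbb{R}$) if and only if both $$\frac{d_1}{d_2}\qquad\text{and}\qquad\frac1{2\pi}\Big(\frac{d_2}{d_1}G_1(2T)-G_2(2T)\Big)$$ are rational. -/

import Mathlib

/-!
A horizontal lift `F` of `f` spans, together with `F_z` and `F_z̄`, a moving unitary frame, whose
structure equations hold because `f` is conformal, Lagrangian and minimal. The Hopf coefficient is
holomorphic and invariant under real translations, hence constant, and the Gauss equation becomes
an ordinary differential equation for `w = e^u` with first integral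
`w'² = 4 β w² - 8 w³ - 4 |ψ|²`. Its solution is `w = a₁ - (a₁ - a₂) sn² (r y)`, of period `2 T`.

Translational equivariance makes `D` generate the motion in `x`. The coordinates of `F` with respect
to an orthonormal eigenbasis of `D` are therefore `e^{i d_j x}` times functions of `y`; the lengths
and products of `F`, `F_x` and `F_y` give a Vandermonde system for their squared moduli `h_j²`, and
the imaginary parts of their logarithmic derivatives are the integrands of the phases `G_j`.

A period of `f` must preserve every `h_j`, which forces its imaginary part into `2 T ℤ`, and must
change all three phases by the same angle. As `d₁ + d₂ + d₃ = 0` and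
`G₁(2T) + G₂(2T) + G₃(2T) = 0`, that angle is a multiple of `2π / 3`, and two independent periods
exist exactly when the two stated quantities are rational.
-/

open scoped ContDiff LinearAlgebra.Projectivization

noncomputable section

namespace MinLag

/-! ### Differential operators and the Hermitian product -/

/-- The Hermitian product `Z · W̄ = ∑ₖ zₖ * conj wₖ` on `ℂ³`. -/
def hdot (Z W : Fin 3 → ℂ) : ℂ := ∑ k, Z k * (starRingEnd ℂ) (W k)

section Operators

variable {E : Type} [NormedAddCommGroup E] [NormedSpace ℝ E]

/-- `∂g/∂x` for a function of `z = x + i y`. -/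
def dX (g : ℂ → E) (z : ℂ) : E := fderiv ℝ g z 1

/-- `∂g/∂y` for a function of `z = x + i y`. -/
def dY (g : ℂ → E) (z : ℂ) : E := fderiv ℝ g z Complex.I

/-- `∂g/∂z = (∂g/∂x - i ∂g/∂y) / 2`. -/
def dZ [Module ℂ E] (g : ℂ → E) (z : ℂ) : E :=
  (1 / 2 : ℂ) • (dX g z - Complex.I • dY g z)

/-- `∂g/∂z̄ = (∂g/∂x + i ∂g/∂y) / 2`. -/
def dZbar [Module ℂ E] (g : ℂ → E) (z : ℂ) : E :=
  (1 / 2 : ℂ) • (dX g z + Complex.I • dY g z)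

end Operators

/-! ### Minimal Lagrangian immersions of `ℂ` into `ℂP²`

`ℂP² = ℙ ℂ (Fin 3 → ℂ)` carries the Fubini-Study metric of holomorphic sectional curvature 4,
that is, the Hopf map `S⁵(1) → ℂP²` is a Riemannian submersion: at `p ∈ S⁵` the tangent space of
`ℂP²` at `[p]` is identified with the Hermitian orthogonal complement of `p`, with
metric `Re (v · w̄)` and Kähler form `Im (v · w̄)` (up to sign). -/

/-- The horizontal part of `v` at the point `p` of the unit sphere. -/
def hor (p v : Fin 3 → ℂ) : Fin 3 → ℂ := v - hdot v p • p

/-- `F` is a smooth lift of `f` to the unit sphere `S⁵`. -/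
def IsSphereLift (f : ℂ → ℙ ℂ (Fin 3 → ℂ)) (F : ℂ → Fin 3 → ℂ) : Prop :=
  ContDiff ℝ ∞ F ∧ ∀ z, hdot (F z) (F z) = 1 ∧ F z ∈ (f z).submodule

/-- `F` is a smooth horizontal lift of `f` to the unit sphere `S⁵`. -/
def IsHorizontalLift (f : ℂ → ℙ ℂ (Fin 3 → ℂ)) (F : ℂ → Fin 3 → ℂ) : Prop :=
  IsSphereLift f F ∧ ∀ z, hdot (dX F z) (F z) = 0 ∧ hdot (dY F z) (F z) = 0

/-- `f` is a smooth conformal Lagrangian immersion with induced metric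
`2 e^u dz dz̄ = 2 e^u (dx² + dy²)`. (A smooth map from the contractible surface `ℂ` to
`ℂP²` is the same as a map that has a smooth lift to `S⁵`. The two vectors
`hor F F_x`, `hor F F_y` represent `∂f/∂x` and `∂f/∂y`.) -/
def IsConformalLagrangian (f : ℂ → ℙ ℂ (Fin 3 → ℂ)) (u : ℂ → ℝ) : Prop :=
  ∃ F : ℂ → Fin 3 → ℂ, IsSphereLift f F ∧ ∀ z,
    (hdot (hor (F z) (dX F z)) (hor (F z) (dX F z))).re = 2 * Real.exp (u z) ∧
    (hdot (hor (F z) (dY F z)) (hor (F z) (dY F z))).re = 2 * Real.exp (u z) ∧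
    (hdot (hor (F z) (dX F z)) (hor (F z) (dY F z))).re = 0 ∧
    (hdot (hor (F z) (dX F z)) (hor (F z) (dY F z))).im = 0

/-- The mean curvature vector of the conformal Lagrangian immersion `f` vanishes: for a horizontal
lift `F` (it exists, since `f` is Lagrangian and `ℂ` is simply connected, and it is unique up
to a constant phase) the trace `F_xx + F_yy` has no component along the normal vectors of `f`,
i.e. along the horizontal vectors that are real orthogonal to `F_x` and `F_y`. -/
def HasZeroMeanCurvature (f : ℂ → ℙ ℂ (Fin 3 → ℂ)) : Prop :=
  ∀ F : ℂ → Fin 3 → ℂ, IsHorizontalLift f F → ∀ (z : ℂ) (N : Fin 3 → ℂ),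
    hdot N (F z) = 0 → (hdot N (dX F z)).re = 0 → (hdot N (dY F z)).re = 0 →
      (hdot (dX (dX F) z + dY (dY F) z) N).re = 0

/-- `f` is a conformally parametrized minimal Lagrangian immersion of `ℂ` with metric
`2 e^u dz dz̄`. -/
def IsMinimalLagrangian (f : ℂ → ℙ ℂ (Fin 3 → ℂ)) (u : ℂ → ℝ) : Prop :=
  IsConformalLagrangian f u ∧ HasZeroMeanCurvature f

/-- The Hopf differential of `f` is `φ dz³`: `φ = F_zz · conj F_z̄` for the horizontal lifts
`F` of `f` (it does not depend on the horizontal lift). -/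
def HasHopfDifferential (f : ℂ → ℙ ℂ (Fin 3 → ℂ)) (φ : ℂ → ℂ) : Prop :=
  ∀ F : ℂ → Fin 3 → ℂ, IsHorizontalLift f F → ∀ z, hdot (dZ (dZ F) z) (dZbar F z) = φ z

/-- `f` is translationally equivariant: `f (z + t) = R(t) f(z)` for all real `t`, with a (continuous)
one-parameter subgroup `R` of `SU(3)`. -/
def IsTranslationallyEquivariant (f : ℂ → ℙ ℂ (Fin 3 → ℂ)) : Prop :=
  ∃ R : ℝ → Matrix.SpecialLinearGroup (Fin 3) ℂ,
    (∀ t, (R t : Matrix (Fin 3) (Fin 3) ℂ) ∈ Matrix.unitaryGroup (Fin 3) ℂ) ∧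
    Continuous (fun t => (R t : Matrix (Fin 3) (Fin 3) ℂ)) ∧
    (∀ s t, R (s + t) = R s * R t) ∧
    ∀ (z : ℂ) (t : ℝ), f (z + t) = R t • f z

/-- `f` descends to a torus: it has two periods that are linearly independent over `ℝ`. -/
def DescendsToTorus (f : ℂ → ℙ ℂ (Fin 3 → ℂ)) : Prop :=
  ∃ ω₁ ω₂ : ℂ, LinearIndependent ℝ ![ω₁, ω₂] ∧
    (∀ z, f (z + ω₁) = f z) ∧ (∀ z, f (z + ω₂) = f z)

/-! ### The extended frame -/

/-- The matrix `λ⁻¹ U₋₁ + U₀`, where `e = e^{u/2}`, `p = ψ e^{-u}` and `uz = ∂u/∂z`. -/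
def matU (lam e p uz : ℂ) : Matrix (Fin 3) (Fin 3) ℂ :=
  !![uz / 2, 0, lam⁻¹ * (Complex.I * e);
     -(lam⁻¹ * (Complex.I * p)), -(uz / 2), 0;
     0, lam⁻¹ * (Complex.I * e), 0]

/-- The matrix `λ V₁ + V₀`, where `e = e^{u/2}`, `pbar = conj ψ e^{-u}` and `uzbar = ∂u/∂z̄`. -/
def matV (lam e pbar uzbar : ℂ) : Matrix (Fin 3) (Fin 3) ℂ :=
  !![-(uzbar / 2), -(lam * (Complex.I * pbar)), 0;
     0, uzbar / 2, lam * (Complex.I * e);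
     lam * (Complex.I * e), 0, 0]

/-- The third column of a frame. -/
def canonicalLift (Fr : ℂ → Matrix (Fin 3) (Fin 3) ℂ) (z : ℂ) : Fin 3 → ℂ := fun i => Fr z i 2

/-- `Fr : ℂ → SU(3)` is the frame of `f` at the loop parameter `λ`:
`Fr⁻¹ Fr_z = λ⁻¹ U₋₁ + U₀`, `Fr⁻¹ Fr_z̄ = λ V₁ + V₀` and `[Fr e₃] = f`. -/
structure IsFrame (f : ℂ → ℙ ℂ (Fin 3 → ℂ)) (u : ℂ → ℝ) (ψ : ℂ → ℂ) (lam : ℂ)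
    (Fr : ℂ → Matrix (Fin 3) (Fin 3) ℂ) : Prop where
  smooth : ∀ i j, ContDiff ℝ ∞ (fun z => Fr z i j)
  special_unitary : ∀ z, Fr z ∈ Matrix.specialUnitaryGroup (Fin 3) ℂ
  deriv_z : ∀ z i j, dZ (fun w => Fr w i j) z =
    (Fr z * matU lam (Real.exp (u z / 2)) (ψ z * Real.exp (-u z))
      (dZ (fun w => (u w : ℂ)) z)) i j
  deriv_zbar : ∀ z i j, dZbar (fun w => Fr w i j) z =
    (Fr z * matV lam (Real.exp (u z / 2)) ((starRingEnd ℂ) (ψ z) * Real.exp (-u z))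
      (dZbar (fun w => (u w : ℂ)) z)) i j
  lifts : ∀ z, canonicalLift Fr z ∈ (f z).submodule

/-- The generating matrix `D(λ) = Fr(0)⁻¹ (∂Fr/∂x)(0)` for `u₀ = u(0)`, `u'(0) = 0`,
written out explicitly. -/
def matD (lam : ℂ) (u₀ : ℝ) (ψ₀ : ℂ) : Matrix (Fin 3) (Fin 3) ℂ :=
  let e : ℂ := Real.exp (u₀ / 2)
  let q : ℂ := Real.exp (-u₀)
  !![0, -(Complex.I * lam * (starRingEnd ℂ) ψ₀ * q), Complex.I * lam⁻¹ * e;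
     -(Complex.I * lam⁻¹ * ψ₀ * q), 0, Complex.I * lam * e;
     Complex.I * lam * e, Complex.I * lam⁻¹ * e, 0]

/-! ### The half period of the metric

All constants are functions of `a₁ = e^{u(0)}` and of `c = |ψ|`. -/

/-- `β = 2 a₁ + |ψ|² / a₁²`. -/
def betaConst (a₁ c : ℝ) : ℝ := 2 * a₁ + c ^ 2 / a₁ ^ 2

/-- `a₂`, the smaller positive root of `w³ - (β / 2) w² + |ψ|² / 2` if `a₁` is the larger one. -/
def a2Const (a₁ c : ℝ) : ℝ :=
  (betaConst a₁ c / 2 - a₁ +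
    √((betaConst a₁ c / 2 - a₁) ^ 2 + 4 * a₁ * (betaConst a₁ c / 2 - a₁))) / 2

/-- `a₃`, where `-a₃` is the negative root of the same cubic polynomial. -/
def a3Const (a₁ c : ℝ) : ℝ :=
  (-(betaConst a₁ c / 2 - a₁) +
    √((betaConst a₁ c / 2 - a₁) ^ 2 + 4 * a₁ * (betaConst a₁ c / 2 - a₁))) / 2

/-- `k²`, the square of the modulus. -/
def modulusSq (a₁ c : ℝ) : ℝ := (a₁ - a2Const a₁ c) / (a₁ + a3Const a₁ c)

/-- The complete elliptic integral of the first kind, as a function of `k²`. -/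
def ellipticK (ksq : ℝ) : ℝ := ∫ θ in (0 : ℝ)..(Real.pi / 2), 1 / √(1 - ksq * Real.sin θ ^ 2)

/-- `T = K / r` with `r = √(2 (a₁ + a₃))`; the smallest period of the metric in `y` is `2 T`. -/
def halfPeriod (a₁ c : ℝ) : ℝ := ellipticK (modulusSq a₁ c) / √(2 * (a₁ + a3Const a₁ c))

/-! ### The functions `h_j` and `G_j` -/

/-- `h(y) = ((d w(y) - Re c) / (d³ - Re c))^{1/2}`. -/
def hFun (w : ℝ → ℝ) (c : ℂ) (d y : ℝ) : ℝ := √((d * w y - c.re) / (d ^ 3 - c.re))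

/-- `G(y) = ∫₀^y d Im c / (d w(s) - Re c) ds`. -/
def gFun (w : ℝ → ℝ) (c : ℂ) (d y : ℝ) : ℝ := ∫ s in (0 : ℝ)..y, d * c.im / (d * w s - c.re)

end MinLag

end

noncomputable section

namespace MinLag

open Complex (I)
open scoped ComplexConjugate Matrix

section Calculus

variable {E : Type} [NormedAddCommGroup E] [NormedSpace ℝ E] {g h : ℂ → E} {z : ℂ}

lemma differentiable_of_smooth (hg : ContDiff ℝ ∞ g) : Differentiable ℝ g :=
  hg.differentiable (by simp)

lemma contDiff_fderiv_apply (hg : ContDiff ℝ ∞ g) (v : ℂ) :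
    ContDiff ℝ ∞ fun z => fderiv ℝ g z v :=
  (hg.fderiv_right (m := ∞) (by simp)).clm_apply contDiff_const

lemma contDiff_dX (hg : ContDiff ℝ ∞ g) : ContDiff ℝ ∞ (dX g) :=
  contDiff_fderiv_apply hg 1

lemma contDiff_dY (hg : ContDiff ℝ ∞ g) : ContDiff ℝ ∞ (dY g) :=
  contDiff_fderiv_apply hg I

lemma fderiv_apply_eq_re_smul_dX_add_im_smul_dY (g : ℂ → E) (z v : ℂ) :
    fderiv ℝ g z v = v.re • dX g z + v.im • dY g z := by
  have hv : v = v.re • (1 : ℂ) + v.im • I := by simp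
  conv_lhs => rw [hv, map_add, map_smul, map_smul]
  rfl

lemma dY_dX (hg : ContDiff ℝ ∞ g) (z : ℂ) : dY (dX g) z = dX (dY g) z := by
  have hg' : Differentiable ℝ (fderiv ℝ g) :=
    (hg.fderiv_right (m := ∞) (by simp)).differentiable (by simp)
  have hsymm : IsSymmSndFDerivAt ℝ g z :=
    hg.contDiffAt.isSymmSndFDerivAt (by simpa using ENat.LEInfty.out (m := 2))
  have hsecond (v t : ℂ) :
      fderiv ℝ (fun w => fderiv ℝ g w v) z t = fderiv ℝ (fderiv ℝ g) z t v := by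
    rw [fderiv_clm_apply (hg' z) (differentiableAt_const v)]
    simp
  exact (hsecond 1 I).trans ((hsymm.eq I 1).trans (hsecond I 1).symm)

lemma eq_of_dX_eq_zero_of_dY_eq_zero (hg : Differentiable ℝ g) (hX : ∀ z, dX g z = 0)
    (hY : ∀ z, dY g z = 0) (z z' : ℂ) : g z = g z' := by
  refine is_const_of_fderiv_eq_zero hg (fun w => ?_) z z'
  ext v
  simp [fderiv_apply_eq_re_smul_dX_add_im_smul_dY, hX, hY]

lemma hasDerivAt_add_ofReal {x : ℝ} (hg : DifferentiableAt ℝ g (z + x)) :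
    HasDerivAt (fun t : ℝ => g (z + t)) (dX g (z + x)) x :=
  hg.hasFDerivAt.comp_hasDerivAt x
    (by simpa using (Complex.ofRealCLM.hasDerivAt (x := x)).const_add z)

lemma hasDerivAt_ofReal_mul_I {y : ℝ} (hg : DifferentiableAt ℝ g (y * I)) :
    HasDerivAt (fun t : ℝ => g (t * I)) (dY g (y * I)) y :=
  hg.hasFDerivAt.comp_hasDerivAt y
    (by simpa using (Complex.ofRealCLM.hasDerivAt (x := y)).mul_const I)

lemma dX_eq_zero_of_translation_invariant (hg : Differentiable ℝ g)
    (h : ∀ (z : ℂ) (t : ℝ), g (z + t) = g z) (z : ℂ) : dX g z = 0 := by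
  have hline := hasDerivAt_add_ofReal (x := 0) (hg (z + (0 : ℝ)))
  rw [funext fun t : ℝ => h z t] at hline
  simpa using (hasDerivAt_const (0 : ℝ) (g z)).unique hline |>.symm

lemma dX_comp_add_const (g : ℂ → E) (a z : ℂ) : dX (fun w => g (w + a)) z = dX g (z + a) := by
  rw [dX, fderiv_comp_add_right, dX]

lemma dY_comp_add_const (g : ℂ → E) (a z : ℂ) : dY (fun w => g (w + a)) z = dY g (z + a) := by
  rw [dY, fderiv_comp_add_right, dY]

lemma dX_const (a : E) (z : ℂ) : dX (fun _ => a) z = 0 := by simp [dX]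

lemma dY_const (a : E) (z : ℂ) : dY (fun _ => a) z = 0 := by simp [dY]

section ContinuousLinearMap

variable {E' : Type} [NormedAddCommGroup E'] [NormedSpace ℝ E'] (L : E →L[ℝ] E')

lemma fderiv_clm_comp_apply (hg : DifferentiableAt ℝ g z) (v : ℂ) :
    fderiv ℝ (fun w => L (g w)) z v = L (fderiv ℝ g z v) :=
  DFunLike.congr_fun (L.hasFDerivAt.comp z hg.hasFDerivAt).fderiv v

lemma dX_clm_comp (hg : DifferentiableAt ℝ g z) : dX (fun w => L (g w)) z = L (dX g z) :=
  fderiv_clm_comp_apply L hg 1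

lemma dY_clm_comp (hg : DifferentiableAt ℝ g z) : dY (fun w => L (g w)) z = L (dY g z) :=
  fderiv_clm_comp_apply L hg I

end ContinuousLinearMap

section RealValued

variable {u : ℂ → ℝ}

lemma contDiff_ofReal_comp (hu : ContDiff ℝ ∞ u) : ContDiff ℝ ∞ fun w => (u w : ℂ) :=
  Complex.ofRealCLM.contDiff.comp hu

lemma dX_ofReal_comp (hu : DifferentiableAt ℝ u z) :
    dX (fun w => (u w : ℂ)) z = (dX u z : ℝ) :=
  dX_clm_comp Complex.ofRealCLM hu

lemma dY_ofReal_comp (hu : DifferentiableAt ℝ u z) :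
    dY (fun w => (u w : ℂ)) z = (dY u z : ℝ) :=
  dY_clm_comp Complex.ofRealCLM hu

lemma exists_primitive_of_dY_eq_dX {p q : ℂ → ℝ} (hp : ContDiff ℝ ∞ p) (hq : ContDiff ℝ ∞ q)
    (hclosed : ∀ z, dY p z = dX q z) :
    ∃ θ : ℂ → ℝ, ContDiff ℝ ∞ θ ∧ (∀ z, dX θ z = p z) ∧ ∀ z, dY θ z = q z := by
  let η : ℂ → ℂ →L[ℝ] ℝ := fun z => p z • Complex.reCLM + q z • Complex.imCLM
  have hη : ContDiff ℝ ∞ η := (hp.smul contDiff_const).add (hq.smul contDiff_const)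
  have hfderiv (a x y : ℂ) : fderiv ℝ η a x y = fderiv ℝ p a x * y.re + fderiv ℝ q a x * y.im := by
    have := ((differentiable_of_smooth hp a).hasFDerivAt.smul_const Complex.reCLM).add
      ((differentiable_of_smooth hq a).hasFDerivAt.smul_const Complex.imCLM)
    rw [show fderiv ℝ η a = _ from this.fderiv]
    simp
  have hsymm (a x y : ℂ) : fderiv ℝ η a x y = fderiv ℝ η a y x := by
    rw [hfderiv, hfderiv]
    simp only [fderiv_apply_eq_re_smul_dX_add_im_smul_dY, hclosed a, smul_eq_mul]
    ring
  obtain ⟨θ, hθ⟩ := (convex_univ (𝕜 := ℝ) (E := ℂ)).exists_forall_hasFDerivAt_of_fderiv_symmetric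
    isOpen_univ (differentiable_of_smooth hη).differentiableOn fun a _ => hsymm a
  have hθη (a : ℂ) : fderiv ℝ θ a = η a := (hθ a trivial).fderiv
  refine ⟨θ, contDiff_infty_iff_fderiv.mpr ⟨fun a => (hθ a trivial).differentiableAt, ?_⟩,
    fun z => ?_, fun z => ?_⟩
  · rwa [funext hθη]
  · simp [dX, hθη, η]
  · simp [dY, hθη, η]

end RealValued

end Calculus

section WirtingerCalculus

variable {E : Type} [NormedAddCommGroup E] [NormedSpace ℂ E] {g : ℂ → E} {a : ℂ → ℂ} {z : ℂ}

lemma contDiff_dZ (hg : ContDiff ℝ ∞ g) : ContDiff ℝ ∞ (dZ g) :=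
  ((contDiff_dX hg).sub ((contDiff_dY hg).const_smul I)).const_smul (1 / 2 : ℂ)

lemma contDiff_dZbar (hg : ContDiff ℝ ∞ g) : ContDiff ℝ ∞ (dZbar g) :=
  ((contDiff_dX hg).add ((contDiff_dY hg).const_smul I)).const_smul (1 / 2 : ℂ)

lemma dX_eq_dZ_add_dZbar (g : ℂ → E) (z : ℂ) : dX g z = dZ g z + dZbar g z := by
  simp only [dZ, dZbar]
  module

lemma dY_eq_I_smul_dZ_sub_dZbar (g : ℂ → E) (z : ℂ) : dY g z = I • (dZ g z - dZbar g z) := by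
  have hsub : dZ g z - dZbar g z = -(I • dY g z) := by
    simp only [dZ, dZbar]
    module
  rw [hsub, smul_neg, smul_smul, Complex.I_mul_I, neg_one_smul, neg_neg]

lemma dZ_comp_add_const (g : ℂ → E) (a z : ℂ) : dZ (fun w => g (w + a)) z = dZ g (z + a) := by
  simp only [dZ, dX_comp_add_const, dY_comp_add_const]

lemma dZbar_comp_add_const (g : ℂ → E) (a z : ℂ) :
    dZbar (fun w => g (w + a)) z = dZbar g (z + a) := by
  simp only [dZbar, dX_comp_add_const, dY_comp_add_const]

lemma dZ_const (a : E) (z : ℂ) : dZ (fun _ => a) z = 0 := by simp [dZ, dX_const, dY_const]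

lemma dZbar_const (a : E) (z : ℂ) : dZbar (fun _ => a) z = 0 := by simp [dZbar, dX_const, dY_const]

lemma fderiv_smul_apply (ha : DifferentiableAt ℝ a z) (hg : DifferentiableAt ℝ g z) (v : ℂ) :
    fderiv ℝ (fun w => a w • g w) z v = fderiv ℝ a z v • g z + a z • fderiv ℝ g z v := by
  rw [fderiv_fun_smul ha hg]
  simp [add_comm]

lemma dX_smul (ha : DifferentiableAt ℝ a z) (hg : DifferentiableAt ℝ g z) :
    dX (fun w => a w • g w) z = dX a z • g z + a z • dX g z :=
  fderiv_smul_apply ha hg 1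

lemma dY_smul (ha : DifferentiableAt ℝ a z) (hg : DifferentiableAt ℝ g z) :
    dY (fun w => a w • g w) z = dY a z • g z + a z • dY g z :=
  fderiv_smul_apply ha hg I

lemma dZ_smul (ha : DifferentiableAt ℝ a z) (hg : DifferentiableAt ℝ g z) :
    dZ (fun w => a w • g w) z = dZ a z • g z + a z • dZ g z := by
  simp only [dZ, dX_smul ha hg, dY_smul ha hg]
  module

lemma dZbar_smul (ha : DifferentiableAt ℝ a z) (hg : DifferentiableAt ℝ g z) :
    dZbar (fun w => a w • g w) z = dZbar a z • g z + a z • dZbar g z := by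
  simp only [dZbar, dX_smul ha hg, dY_smul ha hg]
  module

lemma dX_const_smul (b : ℂ) (hg : DifferentiableAt ℝ g z) :
    dX (fun w => b • g w) z = b • dX g z := by
  rw [dX_smul (differentiableAt_const b) hg, dX_const, zero_smul, zero_add]

lemma dY_const_smul (b : ℂ) (hg : DifferentiableAt ℝ g z) :
    dY (fun w => b • g w) z = b • dY g z := by
  rw [dY_smul (differentiableAt_const b) hg, dY_const, zero_smul, zero_add]

lemma dZ_const_smul (b : ℂ) (hg : DifferentiableAt ℝ g z) :
    dZ (fun w => b • g w) z = b • dZ g z := by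
  rw [dZ_smul (differentiableAt_const b) hg, dZ_const, zero_smul, zero_add]

lemma dZbar_const_smul (b : ℂ) (hg : DifferentiableAt ℝ g z) :
    dZbar (fun w => b • g w) z = b • dZbar g z := by
  rw [dZbar_smul (differentiableAt_const b) hg, dZbar_const, zero_smul, zero_add]

lemma fderiv_dZ_apply (hg : ContDiff ℝ ∞ g) (z v : ℂ) :
    fderiv ℝ (dZ g) z v =
      (1 / 2 : ℂ) • (fderiv ℝ (dX g) z v - I • fderiv ℝ (dY g) z v) := by
  have hX := (differentiable_of_smooth (contDiff_dX hg) z).hasFDerivAt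
  have hY := (differentiable_of_smooth (contDiff_dY hg) z).hasFDerivAt
  exact DFunLike.congr_fun ((hX.sub (hY.const_smul I)).const_smul (1 / 2 : ℂ)).fderiv v

lemma fderiv_dZbar_apply (hg : ContDiff ℝ ∞ g) (z v : ℂ) :
    fderiv ℝ (dZbar g) z v =
      (1 / 2 : ℂ) • (fderiv ℝ (dX g) z v + I • fderiv ℝ (dY g) z v) := by
  have hX := (differentiable_of_smooth (contDiff_dX hg) z).hasFDerivAt
  have hY := (differentiable_of_smooth (contDiff_dY hg) z).hasFDerivAt
  exact DFunLike.congr_fun ((hX.add (hY.const_smul I)).const_smul (1 / 2 : ℂ)).fderiv v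

lemma dZbar_dZ_eq_laplacian (hg : ContDiff ℝ ∞ g) (z : ℂ) :
    dZbar (dZ g) z = (1 / 4 : ℂ) • (dX (dX g) z + dY (dY g) z) := by
  have hX : dX (dZ g) z = (1 / 2 : ℂ) • (dX (dX g) z - I • dX (dY g) z) := fderiv_dZ_apply hg z 1
  have hY : dY (dZ g) z = (1 / 2 : ℂ) • (dY (dX g) z - I • dY (dY g) z) := fderiv_dZ_apply hg z I
  rw [dZbar, hX, hY, dY_dX hg]
  simp only [smul_sub, smul_add, smul_smul]
  match_scalars <;> first | ring1 | linear_combination (-1 / 4 : ℂ) * Complex.I_mul_I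

lemma dZ_dZbar (hg : ContDiff ℝ ∞ g) (z : ℂ) : dZ (dZbar g) z = dZbar (dZ g) z := by
  have hX : dX (dZbar g) z = (1 / 2 : ℂ) • (dX (dX g) z + I • dX (dY g) z) :=
    fderiv_dZbar_apply hg z 1
  have hY : dY (dZbar g) z = (1 / 2 : ℂ) • (dY (dX g) z + I • dY (dY g) z) :=
    fderiv_dZbar_apply hg z I
  rw [dZbar_dZ_eq_laplacian hg, dZ, hX, hY, dY_dX hg]
  simp only [smul_sub, smul_add, smul_smul]
  match_scalars <;> first | ring1 | linear_combination (-1 / 4 : ℂ) * Complex.I_mul_I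

end WirtingerCalculus

section HermitianProduct

variable (Z Z' W W' : Fin 3 → ℂ)

lemma hdot_eq_dotProduct_star : hdot Z W = Z ⬝ᵥ star W := rfl

lemma hdot_eq_inner : hdot Z W = inner ℂ (WithLp.toLp 2 W) (WithLp.toLp 2 Z) := by
  rw [EuclideanSpace.inner_eq_star_dotProduct, hdot_eq_dotProduct_star]

lemma hdot_add_left : hdot (Z + Z') W = hdot Z W + hdot Z' W := add_dotProduct ..

lemma hdot_sub_left : hdot (Z - Z') W = hdot Z W - hdot Z' W := sub_dotProduct ..

lemma hdot_neg_left : hdot (-Z) W = -hdot Z W := neg_dotProduct ..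

lemma hdot_smul_left (a : ℂ) : hdot (a • Z) W = a * hdot Z W := smul_dotProduct ..

lemma hdot_sum_left {ι : Type*} (s : Finset ι) (v : ι → Fin 3 → ℂ) :
    hdot (∑ j ∈ s, v j) W = ∑ j ∈ s, hdot (v j) W := sum_dotProduct ..

lemma hdot_add_right : hdot Z (W + W') = hdot Z W + hdot Z W' := by
  simp only [hdot_eq_dotProduct_star, star_add, dotProduct_add]

lemma hdot_sub_right : hdot Z (W - W') = hdot Z W - hdot Z W' := by
  simp only [hdot_eq_dotProduct_star, star_sub, dotProduct_sub]

lemma hdot_neg_right : hdot Z (-W) = -hdot Z W := by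
  simp only [hdot_eq_dotProduct_star, star_neg, dotProduct_neg]

lemma hdot_smul_right (a : ℂ) : hdot Z (a • W) = conj a * hdot Z W := by
  simp only [hdot_eq_dotProduct_star, star_smul, dotProduct_smul, smul_eq_mul, Complex.star_def]

lemma conj_hdot : conj (hdot Z W) = hdot W Z := by
  rw [hdot_eq_inner, inner_conj_symm, hdot_eq_inner]

lemma hdot_self_im : (hdot Z Z).im = 0 := Complex.conj_eq_iff_im.mp (conj_hdot Z Z)

lemma hdot_self_re_nonneg : 0 ≤ (hdot Z Z).re := by
  rw [hdot_eq_inner]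
  exact inner_self_nonneg (𝕜 := ℂ) (E := EuclideanSpace ℂ (Fin 3))

variable {Z Z' W W'}

lemma hdot_eq_zero_comm (h : hdot Z W = 0) : hdot W Z = 0 := by rw [← conj_hdot, h, map_zero]

lemma hdot_self_eq_zero (h : hdot Z Z = 0) : Z = 0 := by
  rw [hdot_eq_inner, inner_self_eq_zero] at h
  simpa using h

lemma hdot_smul_smul {κ : ℂ} (hκ : ‖κ‖ = 1) : hdot (κ • Z) (κ • W) = hdot Z W := by
  rw [hdot_smul_left, hdot_smul_right, ← mul_assoc, Complex.mul_conj', hκ]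
  norm_num

lemma ext_of_orthogonal {b : Fin 3 → Fin 3 → ℂ} (hb : ∀ j, b j ≠ 0)
    (horth : ∀ i j, i ≠ j → hdot (b i) (b j) = 0) (h : ∀ j, hdot Z (b j) = hdot W (b j)) :
    Z = W := by
  have hindep : LinearIndependent ℂ fun j => WithLp.toLp 2 (b j) :=
    linearIndependent_of_ne_zero_of_inner_eq_zero (fun j => by simpa using hb j) fun i j hij =>
      (hdot_eq_inner _ _).symm.trans (horth j i hij.symm)
  let B := basisOfLinearIndependentOfCardEqFinrank hindep (by simp)
  have hext : WithLp.toLp 2 Z = WithLp.toLp 2 W :=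
    InnerProductSpace.ext_inner_left_basis B fun j => by simpa [B, ← hdot_eq_inner] using h j
  simpa using hext

section Calculus

variable {F G : ℂ → Fin 3 → ℂ} {z : ℂ}

lemma contDiff_hdot (hF : ContDiff ℝ ∞ F) (hG : ContDiff ℝ ∞ G) :
    ContDiff ℝ ∞ fun z => hdot (F z) (G z) :=
  ContDiff.sum fun k _ =>
    (contDiff_pi.mp hF k).mul (Complex.conjCLE.contDiff.comp (contDiff_pi.mp hG k))

lemma fderiv_hdot (hF : DifferentiableAt ℝ F z) (hG : DifferentiableAt ℝ G z) (v : ℂ) :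
    fderiv ℝ (fun w => hdot (F w) (G w)) z v =
      hdot (fderiv ℝ F z v) (G z) + hdot (F z) (fderiv ℝ G z v) := by
  have hsum := HasFDerivAt.fun_sum (u := Finset.univ) fun k _ =>
    (hasFDerivAt_pi'.mp hF.hasFDerivAt k).mul
      (Complex.conjCLE.toContinuousLinearMap.hasFDerivAt.comp z
        (hasFDerivAt_pi'.mp hG.hasFDerivAt k))
  rw [show fderiv ℝ (fun w => hdot (F w) (G w)) z = _ from hsum.fderiv]
  simp [hdot, Finset.sum_add_distrib, mul_comm, add_comm]

lemma dX_hdot (hF : DifferentiableAt ℝ F z) (hG : DifferentiableAt ℝ G z) :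
    dX (fun w => hdot (F w) (G w)) z = hdot (dX F z) (G z) + hdot (F z) (dX G z) :=
  fderiv_hdot hF hG 1

lemma dY_hdot (hF : DifferentiableAt ℝ F z) (hG : DifferentiableAt ℝ G z) :
    dY (fun w => hdot (F w) (G w)) z = hdot (dY F z) (G z) + hdot (F z) (dY G z) :=
  fderiv_hdot hF hG I

lemma dZ_hdot (hF : DifferentiableAt ℝ F z) (hG : DifferentiableAt ℝ G z) :
    dZ (fun w => hdot (F w) (G w)) z = hdot (dZ F z) (G z) + hdot (F z) (dZbar G z) := by
  simp only [dZ, dZbar, hdot_smul_left, hdot_smul_right, hdot_sub_left, hdot_add_right,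
    dX_hdot hF hG, dY_hdot hF hG, smul_eq_mul, map_div₀, map_one, map_ofNat, Complex.conj_I]
  ring

lemma dZbar_hdot (hF : DifferentiableAt ℝ F z) (hG : DifferentiableAt ℝ G z) :
    dZbar (fun w => hdot (F w) (G w)) z = hdot (dZbar F z) (G z) + hdot (F z) (dZ G z) := by
  simp only [dZ, dZbar, hdot_smul_left, hdot_smul_right, hdot_sub_right, hdot_add_left,
    dX_hdot hF hG, dY_hdot hF hG, smul_eq_mul, map_div₀, map_one, map_ofNat, Complex.conj_I]
  ring

lemma re_hdot_fderiv_eq_zero (hF : Differentiable ℝ F) (hunit : ∀ z, hdot (F z) (F z) = 1)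
    (z v : ℂ) : (hdot (fderiv ℝ F z v) (F z)).re = 0 := by
  have h := fderiv_hdot (hF z) (hF z) v
  rw [funext hunit, fderiv_fun_const, ← conj_hdot (fderiv ℝ F z v) (F z)] at h
  have hre := congrArg Complex.re h
  simp only [Pi.zero_apply, zero_apply, Complex.zero_re, Complex.add_re,
    Complex.conj_re] at hre
  linarith

end Calculus

lemma hdot_hor_left {p : Fin 3 → ℂ} (hp : hdot p p = 1) (v : Fin 3 → ℂ) :
    hdot (hor p v) p = 0 := by
  rw [hor, hdot_sub_left, hdot_smul_left, hp, mul_one, sub_self]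

lemma hdot_hor_hor {p : Fin 3 → ℂ} (hp : hdot p p = 1) (v w : Fin 3 → ℂ) :
    hdot (hor p v) (hor p w) = hdot v w - hdot v p * conj (hdot w p) := by
  conv_lhs => rw [hor.eq_def p w]
  rw [hdot_sub_right, hdot_smul_right, hdot_hor_left hp, hor, hdot_sub_left, hdot_smul_left,
    conj_hdot w p]
  ring

lemma eq_hdot_smul_of_mem_submodule {p : ℙ ℂ (Fin 3 → ℂ)} {v w : Fin 3 → ℂ}
    (hv : v ∈ p.submodule) (hw : w ∈ p.submodule) (hw1 : hdot w w = 1) : v = hdot v w • w := by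
  rw [Projectivization.submodule_eq, Submodule.mem_span_singleton] at hv hw
  obtain ⟨a, rfl⟩ := hv
  obtain ⟨b, rfl⟩ := hw
  simp only [hdot_smul_left, hdot_smul_right, smul_smul] at hw1 ⊢
  congr 1
  linear_combination -a * hw1

lemma eq_of_mem_submodule {p q : ℙ ℂ (Fin 3 → ℂ)} {v : Fin 3 → ℂ} (hv : v ≠ 0)
    (hp : v ∈ p.submodule) (hq : v ∈ q.submodule) : p = q := by
  suffices h : ∀ r : ℙ ℂ (Fin 3 → ℂ), v ∈ r.submodule → r = Projectivization.mk ℂ v hv from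
    (h p hp).trans (h q hq).symm
  intro r hr
  rw [Projectivization.submodule_eq, Submodule.mem_span_singleton] at hr
  rw [← r.mk_rep, eq_comm, Projectivization.mk_eq_mk_iff']
  exact hr

end HermitianProduct

section HorizontalLift

variable {f : ℂ → ℙ ℂ (Fin 3 → ℂ)} {u : ℂ → ℝ} {F H G : ℂ → Fin 3 → ℂ}

lemma hdot_fderiv_eq_I_mul_im (hF : IsSphereLift f F) (z v : ℂ) :
    hdot (fderiv ℝ F z v) (F z) = I * (hdot (fderiv ℝ F z v) (F z)).im := by
  have hre := re_hdot_fderiv_eq_zero (differentiable_of_smooth hF.1) (fun w => (hF.2 w).1) z v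
  apply Complex.ext <;> simp [hre]

lemma im_hdot_hor_hor (hF : IsSphereLift f F) (z : ℂ) :
    (hdot (hor (F z) (dX F z)) (hor (F z) (dY F z))).im = (hdot (dX F z) (dY F z)).im := by
  have hx : hdot (dX F z) (F z) = _ := hdot_fderiv_eq_I_mul_im hF z 1
  have hy : hdot (dY F z) (F z) = _ := hdot_fderiv_eq_I_mul_im hF z I
  rw [hdot_hor_hor (hF.2 z).1, hx, hy]
  simp

/-- Rotating a lift by `e^{-iθ}` makes it horizontal when `dθ` is the imaginary part of the
connection form. -/
lemma fderiv_exp_smul_eq_smul_hor (hF : IsSphereLift f F) {θ : ℂ → ℝ} {z v : ℂ}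
    (hθ : DifferentiableAt ℝ θ z) (hθv : fderiv ℝ θ z v = (hdot (fderiv ℝ F z v) (F z)).im) :
    fderiv ℝ (fun w => Complex.exp ((-θ w : ℝ) * I) • F w) z v =
      Complex.exp ((-θ z : ℝ) * I) • hor (F z) (fderiv ℝ F z v) := by
  have hphase : HasFDerivAt (fun w => Complex.exp ((-θ w : ℝ) * I)) _ z :=
    ((Complex.ofRealCLM.hasFDerivAt.comp z hθ.hasFDerivAt.neg).mul_const I).cexp
  have hphase_apply : fderiv ℝ (fun w => Complex.exp ((-θ w : ℝ) * I)) z v =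
      -(I * (fderiv ℝ θ z v : ℝ)) * Complex.exp ((-θ z : ℝ) * I) := by
    rw [show fderiv ℝ (fun w => Complex.exp ((-θ w : ℝ) * I)) z = _ from hphase.fderiv]
    simp only [Function.comp_apply, Pi.neg_apply, Complex.ofRealCLM_apply, Complex.ofReal_neg,
      ContinuousLinearMap.comp_neg, ContinuousLinearMap.comp_apply, neg_apply, smul_apply,
      smul_neg, smul_eq_mul, neg_mul, neg_inj]
    ring
  rw [fderiv_smul_apply hphase.differentiableAt (differentiable_of_smooth hF.1 z), hphase_apply,
    hθv, hor, hdot_fderiv_eq_I_mul_im hF z v]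
  simp only [Complex.mul_im, Complex.I_re, Complex.I_im, Complex.ofReal_re, Complex.ofReal_im]
  module

lemma exists_horizontal_phase (hF : IsSphereLift f F)
    (hlag : ∀ z, (hdot (hor (F z) (dX F z)) (hor (F z) (dY F z))).im = 0) :
    ∃ χ : ℂ → ℂ, ContDiff ℝ ∞ χ ∧ (∀ z, ‖χ z‖ = 1) ∧
      (∀ z, dX (fun w => χ w • F w) z = χ z • hor (F z) (dX F z)) ∧
      ∀ z, dY (fun w => χ w • F w) z = χ z • hor (F z) (dY F z) := by
  have hpX := contDiff_hdot (contDiff_dX hF.1) hF.1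
  have hpY := contDiff_hdot (contDiff_dY hF.1) hF.1
  have hdiff {g : ℂ → Fin 3 → ℂ} (hg : ContDiff ℝ ∞ g) (z : ℂ) := differentiable_of_smooth hg z
  have hclosed (z : ℂ) : dY (fun w => (hdot (dX F w) (F w)).im) z =
      dX (fun w => (hdot (dY F w) (F w)).im) z := by
    have hXY := im_hdot_hor_hor hF z ▸ hlag z
    have hl := dY_clm_comp Complex.imCLM (differentiable_of_smooth hpX z)
    have hr := dX_clm_comp Complex.imCLM (differentiable_of_smooth hpY z)
    simp only [Complex.imCLM_apply] at hl hr
    rw [hl, hr, dY_hdot (hdiff (contDiff_dX hF.1) z) (hdiff hF.1 z),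
      dX_hdot (hdiff (contDiff_dY hF.1) z) (hdiff hF.1 z), dY_dX hF.1,
      ← conj_hdot (dX F z) (dY F z)]
    simp [hXY]
  obtain ⟨θ, hθ, hθX, hθY⟩ := exists_primitive_of_dY_eq_dX
    (Complex.imCLM.contDiff.comp hpX) (Complex.imCLM.contDiff.comp hpY) hclosed
  refine ⟨fun w => Complex.exp ((-θ w : ℝ) * I), ?_, fun z => Complex.norm_exp_ofReal_mul_I _,
    fun z => fderiv_exp_smul_eq_smul_hor hF (differentiable_of_smooth hθ z) (hθX z),
    fun z => fderiv_exp_smul_eq_smul_hor hF (differentiable_of_smooth hθ z) (hθY z)⟩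
  exact ((contDiff_ofReal_comp hθ.neg).mul contDiff_const).cexp

/-- A horizontal lift `H` of a conformal Lagrangian immersion with metric `2 e^u dz dz̄`. For a
horizontal lift the projections in `IsConformalLagrangian` are trivial, and the real and imaginary
parts of the metric relations are joined in one complex identity. -/
structure IsConformalLift (f : ℂ → ℙ ℂ (Fin 3 → ℂ)) (u : ℂ → ℝ) (H : ℂ → Fin 3 → ℂ) : Prop where
  lift : IsHorizontalLift f H
  xx : ∀ z, hdot (dX H z) (dX H z) = 2 * (Real.exp (u z) : ℂ)
  yy : ∀ z, hdot (dY H z) (dY H z) = 2 * (Real.exp (u z) : ℂ)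
  xy : ∀ z, hdot (dX H z) (dY H z) = 0

lemma exists_isConformalLift (hf : IsConformalLagrangian f u) : ∃ H, IsConformalLift f u H := by
  obtain ⟨F, hF, hmetric⟩ := hf
  obtain ⟨χ, hχ, hχ1, hX, hY⟩ := exists_horizontal_phase hF fun z => (hmetric z).2.2.2
  have hself {v : Fin 3 → ℂ} {r : ℝ} (h : (hdot v v).re = 2 * r) : hdot v v = 2 * (r : ℂ) := by
    apply Complex.ext <;> simp [h, hdot_self_im]
  refine ⟨fun z => χ z • F z, ⟨⟨hχ.smul hF.1, fun z => ⟨?_, ?_⟩⟩, fun z => ⟨?_, ?_⟩⟩, fun z => ?_,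
    fun z => ?_, fun z => ?_⟩
  · rw [hdot_smul_smul (hχ1 z), (hF.2 z).1]
  · exact Submodule.smul_mem _ _ (hF.2 z).2
  · rw [hX, hdot_smul_smul (hχ1 z), hdot_hor_left (hF.2 z).1]
  · rw [hY, hdot_smul_smul (hχ1 z), hdot_hor_left (hF.2 z).1]
  · rw [hX, hdot_smul_smul (hχ1 z), hself (hmetric z).1]
  · rw [hY, hdot_smul_smul (hχ1 z), hself (hmetric z).2.1]
  · rw [hX, hY, hdot_smul_smul (hχ1 z)]
    exact Complex.ext (hmetric z).2.2.1 (hmetric z).2.2.2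

lemma IsHorizontalLift.hdot_fderiv (hH : IsHorizontalLift f H) (z v : ℂ) :
    hdot (fderiv ℝ H z v) (H z) = 0 := by
  rw [fderiv_apply_eq_re_smul_dX_add_im_smul_dY, hdot_add_left, ← Complex.coe_smul,
    ← Complex.coe_smul, hdot_smul_left, hdot_smul_left, (hH.2 z).1, (hH.2 z).2]
  simp

lemma IsHorizontalLift.exists_eq_const_smul (hH : IsHorizontalLift f H)
    (hG : IsHorizontalLift f G) : ∃ κ : ℂ, ‖κ‖ = 1 ∧ ∀ z, G z = κ • H z := by
  have hGH (z : ℂ) : G z = hdot (G z) (H z) • H z :=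
    eq_hdot_smul_of_mem_submodule (hG.1.2 z).2 (hH.1.2 z).2 (hH.1.2 z).1
  have hHG (z : ℂ) : H z = hdot (H z) (G z) • G z :=
    eq_hdot_smul_of_mem_submodule (hH.1.2 z).2 (hG.1.2 z).2 (hG.1.2 z).1
  have hHd := differentiable_of_smooth hH.1.1
  have hGd := differentiable_of_smooth hG.1.1
  have hderiv (z v : ℂ) : fderiv ℝ (fun w => hdot (G w) (H w)) z v = 0 := by
    have h₁ : hdot (fderiv ℝ G z v) (H z) = 0 := by
      rw [hHG z, hdot_smul_right, hG.hdot_fderiv, mul_zero]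
    have h₂ : hdot (G z) (fderiv ℝ H z v) = 0 := by
      rw [hGH z, hdot_smul_left, hdot_eq_zero_comm (hH.hdot_fderiv z v), mul_zero]
    rw [fderiv_hdot (hGd z) (hHd z), h₁, h₂, add_zero]
  refine ⟨hdot (G 0) (H 0), ?_, fun z => ?_⟩
  · have h := (hG.1.2 0).1
    rw [hGH 0, hdot_smul_left, hdot_smul_right, (hH.1.2 0).1, mul_one, Complex.mul_conj'] at h
    exact (pow_eq_one_iff_of_nonneg (norm_nonneg _) two_ne_zero).mp (mod_cast h)
  · rw [← eq_of_dX_eq_zero_of_dY_eq_zero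
      (differentiable_of_smooth (contDiff_hdot hG.1.1 hH.1.1))
      (fun w => hderiv w 1) (fun w => hderiv w I) z 0, ← hGH z]

namespace IsConformalLift

lemma contDiff (hH : IsConformalLift f u H) : ContDiff ℝ ∞ H := hH.lift.1.1

lemma hdot_self (hH : IsConformalLift f u H) (z : ℂ) : hdot (H z) (H z) = 1 := (hH.lift.1.2 z).1

lemma contDiff_u (hH : IsConformalLift f u H) : ContDiff ℝ ∞ u := by
  have hnorm (z : ℂ) : (hdot (dX H z) (dX H z)).re / 2 = Real.exp (u z) := by
    simp [hH.xx, Complex.exp_ofReal_re]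
  have hlog : u = fun z => Real.log ((hdot (dX H z) (dX H z)).re / 2) := by
    simp_rw [hnorm, Real.log_exp]
  have hdX := contDiff_dX hH.contDiff
  rw [hlog]
  refine ContDiff.log ((Complex.reCLM.contDiff.comp (contDiff_hdot hdX hdX)).div_const 2)
    fun z => ?_
  exact (hnorm z).trans_ne (Real.exp_ne_zero _)

lemma const_smul (hH : IsConformalLift f u H) {κ : ℂ} (hκ : ‖κ‖ = 1) :
    IsConformalLift f u fun z => κ • H z := by
  have hX (z : ℂ) := dX_const_smul κ (differentiable_of_smooth hH.contDiff z)
  have hY (z : ℂ) := dY_const_smul κ (differentiable_of_smooth hH.contDiff z)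
  refine ⟨⟨⟨hH.contDiff.const_smul κ, fun z => ⟨?_, Submodule.smul_mem _ _ (hH.lift.1.2 z).2⟩⟩,
    fun z => ⟨?_, ?_⟩⟩, fun z => ?_, fun z => ?_, fun z => ?_⟩
  · rw [hdot_smul_smul hκ, hH.hdot_self]
  · rw [hX, hdot_smul_smul hκ, (hH.lift.2 z).1]
  · rw [hY, hdot_smul_smul hκ, (hH.lift.2 z).2]
  · rw [hX, hdot_smul_smul hκ, hH.xx]
  · rw [hY, hdot_smul_smul hκ, hH.yy]
  · rw [hX, hY, hdot_smul_smul hκ, hH.xy]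

end IsConformalLift

end HorizontalLift

section ChainRule

variable {u : ℂ → ℝ} {φ : ℝ → ℝ} {φ' : ℝ} {z : ℂ}

lemma fderiv_comp_apply_of_hasDerivAt (hφ : HasDerivAt φ φ' (u z)) (hu : DifferentiableAt ℝ u z)
    (v : ℂ) : fderiv ℝ (fun w => φ (u w)) z v = φ' * fderiv ℝ u z v :=
  DFunLike.congr_fun (hφ.comp_hasFDerivAt z hu.hasFDerivAt).fderiv v

lemma dX_comp_of_hasDerivAt (hφ : HasDerivAt φ φ' (u z)) (hu : DifferentiableAt ℝ u z) :
    dX (fun w => φ (u w)) z = φ' * dX u z :=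
  fderiv_comp_apply_of_hasDerivAt hφ hu 1

lemma dY_comp_of_hasDerivAt (hφ : HasDerivAt φ φ' (u z)) (hu : DifferentiableAt ℝ u z) :
    dY (fun w => φ (u w)) z = φ' * dY u z :=
  fderiv_comp_apply_of_hasDerivAt hφ hu I

lemma dZ_ofReal_comp (hu : DifferentiableAt ℝ u z) :
    dZ (fun w => (u w : ℂ)) z = (dX u z - I * dY u z) / 2 := by
  rw [dZ, dX_ofReal_comp hu, dY_ofReal_comp hu, smul_eq_mul, smul_eq_mul]
  ring

lemma dZbar_ofReal_comp (hu : DifferentiableAt ℝ u z) :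
    dZbar (fun w => (u w : ℂ)) z = (dX u z + I * dY u z) / 2 := by
  rw [dZbar, dX_ofReal_comp hu, dY_ofReal_comp hu, smul_eq_mul, smul_eq_mul]
  ring

lemma conj_dZ_ofReal_comp (hu : DifferentiableAt ℝ u z) :
    conj (dZ (fun w => (u w : ℂ)) z) = dZbar (fun w => (u w : ℂ)) z := by
  simp only [dZ_ofReal_comp hu, dZbar_ofReal_comp hu, map_div₀, map_sub, map_mul, map_ofNat,
    Complex.conj_ofReal, Complex.conj_I]
  ring

lemma dZ_ofReal_comp_of_hasDerivAt (hφ : HasDerivAt φ φ' (u z)) (hu : DifferentiableAt ℝ u z) :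
    dZ (fun w => (φ (u w) : ℂ)) z = φ' * dZ (fun w => (u w : ℂ)) z := by
  have hφu : DifferentiableAt ℝ (fun w => φ (u w)) z := hφ.differentiableAt.comp z hu
  rw [dZ_ofReal_comp hφu, dX_comp_of_hasDerivAt hφ hu, dY_comp_of_hasDerivAt hφ hu,
    dZ_ofReal_comp hu]
  push_cast
  ring

lemma dZbar_ofReal_comp_of_hasDerivAt (hφ : HasDerivAt φ φ' (u z)) (hu : DifferentiableAt ℝ u z) :
    dZbar (fun w => (φ (u w) : ℂ)) z = φ' * dZbar (fun w => (u w : ℂ)) z := by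
  have hφu : DifferentiableAt ℝ (fun w => φ (u w)) z := hφ.differentiableAt.comp z hu
  rw [dZbar_ofReal_comp hφu, dX_comp_of_hasDerivAt hφ hu, dY_comp_of_hasDerivAt hφ hu,
    dZbar_ofReal_comp hu]
  push_cast
  ring

lemma ofReal_exp_ne_zero (x : ℝ) : (Real.exp x : ℂ) ≠ 0 :=
  Complex.ofReal_ne_zero.mpr (Real.exp_ne_zero x)

end ChainRule

/-- The coefficient `H_zz · conj H_z̄` of the Hopf differential of a lift `H`. -/
def hopfCoeff (H : ℂ → Fin 3 → ℂ) (z : ℂ) : ℂ := hdot (dZ (dZ H) z) (dZbar H z)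

namespace IsConformalLift

variable {f : ℂ → ℙ ℂ (Fin 3 → ℂ)} {u : ℂ → ℝ} {H : ℂ → Fin 3 → ℂ}

lemma differentiable (hH : IsConformalLift f u H) : Differentiable ℝ H :=
  differentiable_of_smooth hH.contDiff

lemma differentiable_u (hH : IsConformalLift f u H) : Differentiable ℝ u :=
  differentiable_of_smooth hH.contDiff_u

lemma differentiable_dZ (hH : IsConformalLift f u H) : Differentiable ℝ (dZ H) :=
  differentiable_of_smooth (contDiff_dZ hH.contDiff)

lemma differentiable_dZbar (hH : IsConformalLift f u H) : Differentiable ℝ (dZbar H) :=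
  differentiable_of_smooth (contDiff_dZbar hH.contDiff)

lemma differentiable_dZ_dZ (hH : IsConformalLift f u H) : Differentiable ℝ (dZ (dZ H)) :=
  differentiable_of_smooth (contDiff_dZ (contDiff_dZ hH.contDiff))

lemma hdot_dZ_self (hH : IsConformalLift f u H) (z : ℂ) : hdot (dZ H z) (H z) = 0 := by
  simp [dZ, hdot_smul_left, hdot_sub_left, (hH.lift.2 z).1, (hH.lift.2 z).2]

lemma hdot_dZbar_self (hH : IsConformalLift f u H) (z : ℂ) : hdot (dZbar H z) (H z) = 0 := by
  simp [dZbar, hdot_smul_left, hdot_add_left, (hH.lift.2 z).1, (hH.lift.2 z).2]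

lemma hdot_self_dZ (hH : IsConformalLift f u H) (z : ℂ) : hdot (H z) (dZ H z) = 0 :=
  hdot_eq_zero_comm (hH.hdot_dZ_self z)

lemma hdot_self_dZbar (hH : IsConformalLift f u H) (z : ℂ) : hdot (H z) (dZbar H z) = 0 :=
  hdot_eq_zero_comm (hH.hdot_dZbar_self z)

lemma hdot_dZ_dZ (hH : IsConformalLift f u H) (z : ℂ) :
    hdot (dZ H z) (dZ H z) = (Real.exp (u z) : ℂ) := by
  simp only [dZ, hdot_smul_left, hdot_sub_left, hdot_smul_right, hdot_sub_right, hH.xx, hH.xy,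
    hH.yy, hdot_eq_zero_comm (hH.xy z), Complex.conj_I, map_div₀, map_one, map_ofNat]
  linear_combination (-1 / 2 * (Real.exp (u z) : ℂ)) * Complex.I_mul_I

lemma hdot_dZbar_dZbar (hH : IsConformalLift f u H) (z : ℂ) :
    hdot (dZbar H z) (dZbar H z) = (Real.exp (u z) : ℂ) := by
  simp only [dZbar, hdot_smul_left, hdot_add_left, hdot_smul_right, hdot_add_right, hH.xx, hH.xy,
    hH.yy, hdot_eq_zero_comm (hH.xy z), Complex.conj_I, map_div₀, map_one, map_ofNat]
  linear_combination (-1 / 2 * (Real.exp (u z) : ℂ)) * Complex.I_mul_I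

lemma hdot_dZ_dZbar (hH : IsConformalLift f u H) (z : ℂ) : hdot (dZ H z) (dZbar H z) = 0 := by
  simp only [dZ, dZbar, hdot_smul_left, hdot_add_right, hdot_smul_right, hdot_sub_left, hH.xx,
    hH.xy, hH.yy, hdot_eq_zero_comm (hH.xy z), Complex.conj_I, map_div₀, map_one, map_ofNat]
  linear_combination (1 / 2 * (Real.exp (u z) : ℂ)) * Complex.I_mul_I

lemma hdot_dZbar_dZ (hH : IsConformalLift f u H) (z : ℂ) : hdot (dZbar H z) (dZ H z) = 0 :=
  hdot_eq_zero_comm (hH.hdot_dZ_dZbar z)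

lemma ext_hdot (hH : IsConformalLift f u H) {z : ℂ} {v w : Fin 3 → ℂ}
    (hz : hdot v (dZ H z) = hdot w (dZ H z)) (hzbar : hdot v (dZbar H z) = hdot w (dZbar H z))
    (hself : hdot v (H z) = hdot w (H z)) : v = w := by
  have hexp := ofReal_exp_ne_zero (u z)
  have hne {p : Fin 3 → ℂ} (h : hdot p p ≠ 0) : p ≠ 0 := fun h0 => h (by simp [h0, hdot])
  refine ext_of_orthogonal (b := ![dZ H z, dZbar H z, H z]) (fun j => ?_) (fun i j hij => ?_)
    fun j => ?_
  · fin_cases j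
    exacts [hne (hH.hdot_dZ_dZ z ▸ hexp), hne (hH.hdot_dZbar_dZbar z ▸ hexp),
      hne (hH.hdot_self z ▸ one_ne_zero)]
  · fin_cases i <;> fin_cases j <;> simp [hH.hdot_dZ_dZbar, hH.hdot_dZbar_dZ, hH.hdot_dZ_self,
      hH.hdot_self_dZ, hH.hdot_dZbar_self, hH.hdot_self_dZbar] at hij ⊢
  · fin_cases j
    exacts [hz, hzbar, hself]

lemma hdot_dZbar_dZ_self (hH : IsConformalLift f u H) (z : ℂ) :
    hdot (dZbar (dZ H) z) (H z) = -(Real.exp (u z) : ℂ) := by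
  have h := dZbar_hdot (hH.differentiable_dZ z) (hH.differentiable z)
  rw [funext hH.hdot_dZ_self, dZbar_const, hH.hdot_dZ_dZ] at h
  linear_combination -h

lemma hdot_dZbar_dZ_dZbar (hH : IsConformalLift f u H) (z : ℂ) :
    hdot (dZbar (dZ H) z) (dZbar H z) = -conj (hdot (dZbar (dZ H) z) (dZ H z)) := by
  have h := dZbar_hdot (hH.differentiable_dZ z) (hH.differentiable_dZbar z)
  rw [funext hH.hdot_dZ_dZbar, dZbar_const, dZ_dZbar hH.contDiff] at h
  rw [conj_hdot]
  linear_combination -h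

/-- The normal space at `H` consists of the vectors `I • V` with `V` tangent. -/
lemma im_hdot_dZbar_dZ_of_tangent (hH : IsConformalLift f u H) (hmin : HasZeroMeanCurvature f)
    {z : ℂ} {V : Fin 3 → ℂ} (hV : hdot V (H z) = 0) (hX : (hdot V (dX H z)).im = 0)
    (hY : (hdot V (dY H z)).im = 0) : (hdot (dZbar (dZ H) z) V).im = 0 := by
  have h := hmin H hH.lift z (I • V) (by rw [hdot_smul_left, hV, mul_zero])
    (by simp [hdot_smul_left, hX]) (by simp [hdot_smul_left, hY])
  rw [hdot_smul_right, Complex.conj_I] at h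
  rw [dZbar_dZ_eq_laplacian hH.contDiff, hdot_smul_left]
  simpa [Complex.mul_im] using h

lemma hdot_dZbar_dZ_dZ (hH : IsConformalLift f u H) (hmin : HasZeroMeanCurvature f) (z : ℂ) :
    hdot (dZbar (dZ H) z) (dZ H z) = 0 := by
  have hX := hH.im_hdot_dZbar_dZ_of_tangent hmin (hH.lift.2 z).1 (hdot_self_im _)
    (by rw [hH.xy, Complex.zero_im])
  have hY := hH.im_hdot_dZbar_dZ_of_tangent hmin (hH.lift.2 z).2
    (by rw [hdot_eq_zero_comm (hH.xy z), Complex.zero_im]) (hdot_self_im _)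
  rw [dX_eq_dZ_add_dZbar, hdot_add_right, hH.hdot_dZbar_dZ_dZbar] at hX
  rw [dY_eq_I_smul_dZ_sub_dZbar, hdot_smul_right, hdot_sub_right, hH.hdot_dZbar_dZ_dZbar] at hY
  simp only [Complex.add_im, Complex.add_re, Complex.neg_im, Complex.conj_im, Complex.conj_re,
    Complex.conj_I, Complex.mul_im, Complex.I_re, Complex.I_im, neg_neg, neg_mul, sub_neg_eq_add,
    mul_zero, one_mul, zero_add, add_neg_cancel, neg_add_rev, add_self_eq_zero, neg_eq_zero]
    at hX hY
  exact Complex.ext (by rw [Complex.zero_re]; linarith) (by rw [Complex.zero_im]; linarith)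

theorem dZbar_dZ (hH : IsConformalLift f u H) (hmin : HasZeroMeanCurvature f) (z : ℂ) :
    dZbar (dZ H) z = -(Real.exp (u z) : ℂ) • H z := by
  apply hH.ext_hdot
  · rw [hH.hdot_dZbar_dZ_dZ hmin, hdot_smul_left, hH.hdot_self_dZ, mul_zero]
  · rw [hH.hdot_dZbar_dZ_dZbar, hH.hdot_dZbar_dZ_dZ hmin, map_zero, neg_zero, hdot_smul_left,
      hH.hdot_self_dZbar, mul_zero]
  · rw [hH.hdot_dZbar_dZ_self, hdot_smul_left, hH.hdot_self, mul_one]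

lemma hdot_dZ_dZ_self (hH : IsConformalLift f u H) (z : ℂ) : hdot (dZ (dZ H) z) (H z) = 0 := by
  have h := dZ_hdot (hH.differentiable_dZ z) (hH.differentiable z)
  rw [funext hH.hdot_dZ_self, dZ_const, hH.hdot_dZ_dZbar, add_zero] at h
  exact h.symm

lemma hdot_dZbar_dZbar_self (hH : IsConformalLift f u H) (z : ℂ) :
    hdot (dZbar (dZbar H) z) (H z) = 0 := by
  have h := dZbar_hdot (hH.differentiable_dZbar z) (hH.differentiable z)
  rw [funext hH.hdot_dZbar_self, dZbar_const, hH.hdot_dZbar_dZ, add_zero] at h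
  exact h.symm

lemma hdot_dZ_dZ_dZ (hH : IsConformalLift f u H) (hmin : HasZeroMeanCurvature f) (z : ℂ) :
    hdot (dZ (dZ H) z) (dZ H z) = Real.exp (u z) * dZ (fun w => (u w : ℂ)) z := by
  have h := dZ_hdot (hH.differentiable_dZ z) (hH.differentiable_dZ z)
  rw [hH.dZbar_dZ hmin, hdot_smul_right, hH.hdot_dZ_self, mul_zero, add_zero,
    funext hH.hdot_dZ_dZ,
    dZ_ofReal_comp_of_hasDerivAt (Real.hasDerivAt_exp _) (hH.differentiable_u z)] at h
  exact h.symm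

lemma hdot_dZbar_dZbar_dZbar (hH : IsConformalLift f u H) (hmin : HasZeroMeanCurvature f) (z : ℂ) :
    hdot (dZbar (dZbar H) z) (dZbar H z) = Real.exp (u z) * dZbar (fun w => (u w : ℂ)) z := by
  have h := dZbar_hdot (hH.differentiable_dZbar z) (hH.differentiable_dZbar z)
  rw [dZ_dZbar hH.contDiff, hH.dZbar_dZ hmin, hdot_smul_right, hH.hdot_dZbar_self, mul_zero,
    add_zero, funext hH.hdot_dZbar_dZbar,
    dZbar_ofReal_comp_of_hasDerivAt (Real.hasDerivAt_exp _) (hH.differentiable_u z)] at h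
  exact h.symm

lemma hdot_dZbar_dZbar_dZ (hH : IsConformalLift f u H) (z : ℂ) :
    hdot (dZbar (dZbar H) z) (dZ H z) = -conj (hopfCoeff H z) := by
  have h := dZbar_hdot (hH.differentiable_dZbar z) (hH.differentiable_dZ z)
  rw [funext hH.hdot_dZbar_dZ, dZbar_const] at h
  rw [hopfCoeff, conj_hdot]
  linear_combination -h

theorem dZ_dZ (hH : IsConformalLift f u H) (hmin : HasZeroMeanCurvature f) (z : ℂ) :
    dZ (dZ H) z = dZ (fun w => (u w : ℂ)) z • dZ H z +
      (hopfCoeff H z * (Real.exp (u z) : ℂ)⁻¹) • dZbar H z := by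
  have hexp := ofReal_exp_ne_zero (u z)
  apply hH.ext_hdot
  · rw [hH.hdot_dZ_dZ_dZ hmin, hdot_add_left, hdot_smul_left, hdot_smul_left, hH.hdot_dZ_dZ,
      hH.hdot_dZbar_dZ]
    ring
  · rw [hdot_add_left, hdot_smul_left, hdot_smul_left, hH.hdot_dZbar_dZbar, hH.hdot_dZ_dZbar,
      mul_zero, zero_add, inv_mul_cancel_right₀ hexp, hopfCoeff]
  · rw [hH.hdot_dZ_dZ_self, hdot_add_left, hdot_smul_left, hdot_smul_left, hH.hdot_dZ_self,
      hH.hdot_dZbar_self]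
    ring

theorem dZbar_dZbar (hH : IsConformalLift f u H) (hmin : HasZeroMeanCurvature f) (z : ℂ) :
    dZbar (dZbar H) z = dZbar (fun w => (u w : ℂ)) z • dZbar H z -
      (conj (hopfCoeff H z) * (Real.exp (u z) : ℂ)⁻¹) • dZ H z := by
  have hexp := ofReal_exp_ne_zero (u z)
  apply hH.ext_hdot
  · rw [hH.hdot_dZbar_dZbar_dZ, hdot_sub_left, hdot_smul_left, hdot_smul_left, hH.hdot_dZ_dZ,
      hH.hdot_dZbar_dZ, inv_mul_cancel_right₀ hexp, mul_zero, zero_sub]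
  · rw [hH.hdot_dZbar_dZbar_dZbar hmin, hdot_sub_left, hdot_smul_left, hdot_smul_left,
      hH.hdot_dZbar_dZbar, hH.hdot_dZ_dZbar]
    ring
  · rw [hH.hdot_dZbar_dZbar_self, hdot_sub_left, hdot_smul_left, hdot_smul_left, hH.hdot_dZ_self,
      hH.hdot_dZbar_self]
    ring

lemma dZbar_dZ_dZ (hH : IsConformalLift f u H) (hmin : HasZeroMeanCurvature f) (z : ℂ) :
    dZbar (dZ (dZ H)) z = -((Real.exp (u z) : ℂ) * dZ (fun w => (u w : ℂ)) z) • H z -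
      (Real.exp (u z) : ℂ) • dZ H z := by
  have hneg (w : ℂ) : dZbar (dZ H) w = ((-Real.exp (u w) : ℝ) : ℂ) • H w := by
    rw [hH.dZbar_dZ hmin, Complex.ofReal_neg]
  have hexp : DifferentiableAt ℝ (fun w => ((-Real.exp (u w) : ℝ) : ℂ)) z :=
    Complex.ofRealCLM.differentiableAt.comp z (hH.differentiable_u z).exp.fun_neg
  rw [← dZ_dZbar (contDiff_dZ hH.contDiff), funext hneg, dZ_smul hexp (hH.differentiable z),
    dZ_ofReal_comp_of_hasDerivAt (φ := fun x => -Real.exp x) (Real.hasDerivAt_exp _).fun_neg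
      (hH.differentiable_u z), Complex.ofReal_neg]
  module

theorem dZbar_hopfCoeff (hH : IsConformalLift f u H) (hmin : HasZeroMeanCurvature f) (z : ℂ) :
    dZbar (hopfCoeff H) z = 0 := by
  have h := dZbar_hdot (hH.differentiable_dZ_dZ z) (hH.differentiable_dZbar z)
  rw [dZ_dZbar hH.contDiff, hH.dZbar_dZ hmin, hH.dZbar_dZ_dZ hmin, hdot_sub_left, hdot_smul_left,
    hdot_smul_left, hdot_smul_right, hH.hdot_dZ_dZ_self, hH.hdot_dZ_dZbar,
    hH.hdot_self_dZbar] at h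
  exact h.trans (by ring)

lemma hdot_dZ_dZ_dZ_dZ (hH : IsConformalLift f u H) (hmin : HasZeroMeanCurvature f) (z : ℂ) :
    hdot (dZ (dZ H) z) (dZ (dZ H) z) =
      Real.exp (u z) * dZ (fun w => (u w : ℂ)) z * dZbar (fun w => (u w : ℂ)) z +
        hopfCoeff H z * conj (hopfCoeff H z) * (Real.exp (u z) : ℂ)⁻¹ := by
  conv_lhs => rw [hH.dZ_dZ hmin z]
  simp only [hdot_add_left, hdot_add_right, hdot_smul_left, hdot_smul_right, hH.hdot_dZ_dZ,
    hH.hdot_dZbar_dZbar, hH.hdot_dZ_dZbar, hH.hdot_dZbar_dZ, map_mul, map_inv₀,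
    Complex.conj_ofReal, conj_dZ_ofReal_comp (hH.differentiable_u z)]
  field

theorem gauss_equation (hH : IsConformalLift f u H) (hmin : HasZeroMeanCurvature f) (z : ℂ) :
    dZbar (dZ (fun w => (u w : ℂ))) z = -(Real.exp (u z) : ℂ) +
      hopfCoeff H z * conj (hopfCoeff H z) * ((Real.exp (u z) : ℂ) ^ 2)⁻¹ := by
  have hexp := ofReal_exp_ne_zero (u z)
  have h := dZbar_hdot (hH.differentiable_dZ_dZ z) (hH.differentiable_dZ z)
  have huz := differentiable_of_smooth (contDiff_dZ (contDiff_ofReal_comp hH.contDiff_u)) z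
  have hexpu : DifferentiableAt ℝ (fun w => (Real.exp (u w) : ℂ)) z :=
    Complex.ofRealCLM.differentiableAt.comp z (hH.differentiable_u z).exp
  have hmul := dZbar_smul hexpu huz
  simp only [smul_eq_mul] at hmul
  rw [funext (hH.hdot_dZ_dZ_dZ hmin), hmul, hH.dZbar_dZ_dZ hmin,
    hH.hdot_dZ_dZ_dZ_dZ hmin, hdot_sub_left, hdot_smul_left, hdot_smul_left, hH.hdot_dZ_dZ,
    hH.hdot_self_dZ,
    dZbar_ofReal_comp_of_hasDerivAt (Real.hasDerivAt_exp _) (hH.differentiable_u z)] at h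
  refine mul_left_cancel₀ hexp ?_
  field_simp at h ⊢
  linear_combination h

end IsConformalLift

section ComplexLinear

variable {E E' : Type} [NormedAddCommGroup E] [NormedSpace ℂ E] [NormedAddCommGroup E']
  [NormedSpace ℂ E'] (L : E →L[ℂ] E') {g : ℂ → E} {z : ℂ}

lemma dZ_clm_comp (hg : DifferentiableAt ℝ g z) : dZ (fun w => L (g w)) z = L (dZ g z) := by
  have hX : dX (fun w => L (g w)) z = L (dX g z) := dX_clm_comp (L.restrictScalars ℝ) hg
  have hY : dY (fun w => L (g w)) z = L (dY g z) := dY_clm_comp (L.restrictScalars ℝ) hg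
  simp only [dZ, hX, hY, map_smul, map_sub]

lemma dZbar_clm_comp (hg : DifferentiableAt ℝ g z) :
    dZbar (fun w => L (g w)) z = L (dZbar g z) := by
  have hX : dX (fun w => L (g w)) z = L (dX g z) := dX_clm_comp (L.restrictScalars ℝ) hg
  have hY : dY (fun w => L (g w)) z = L (dY g z) := dY_clm_comp (L.restrictScalars ℝ) hg
  simp only [dZbar, hX, hY, map_smul, map_add]

end ComplexLinear

section MatrixAction

variable (A : Matrix (Fin 3) (Fin 3) ℂ) {g : ℂ → Fin 3 → ℂ} {z : ℂ}

lemma dX_mulVec (hg : DifferentiableAt ℝ g z) : dX (fun w => A *ᵥ g w) z = A *ᵥ dX g z :=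
  dX_clm_comp (A.mulVecLin.toContinuousLinearMap.restrictScalars ℝ) hg

lemma dY_mulVec (hg : DifferentiableAt ℝ g z) : dY (fun w => A *ᵥ g w) z = A *ᵥ dY g z :=
  dY_clm_comp (A.mulVecLin.toContinuousLinearMap.restrictScalars ℝ) hg

lemma dZ_mulVec (hg : DifferentiableAt ℝ g z) : dZ (fun w => A *ᵥ g w) z = A *ᵥ dZ g z :=
  dZ_clm_comp A.mulVecLin.toContinuousLinearMap hg

lemma dZbar_mulVec (hg : DifferentiableAt ℝ g z) :
    dZbar (fun w => A *ᵥ g w) z = A *ᵥ dZbar g z :=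
  dZbar_clm_comp A.mulVecLin.toContinuousLinearMap hg

lemma contDiff_mulVec (hg : ContDiff ℝ ∞ g) : ContDiff ℝ ∞ fun w => A *ᵥ g w :=
  (A.mulVecLin.toContinuousLinearMap.restrictScalars ℝ).contDiff.comp hg

lemma hdot_mulVec_left (v w : Fin 3 → ℂ) : hdot (A *ᵥ v) w = hdot v (Aᴴ *ᵥ w) := by
  rw [hdot_eq_dotProduct_star, hdot_eq_dotProduct_star, Matrix.star_mulVec,
    Matrix.conjTranspose_conjTranspose, dotProduct_comm, Matrix.dotProduct_mulVec,
    dotProduct_comm]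

variable {A}

lemma hdot_mulVec_mulVec (hA : Aᴴ * A = 1) (v w : Fin 3 → ℂ) :
    hdot (A *ᵥ v) (A *ᵥ w) = hdot v w := by
  rw [hdot_mulVec_left, Matrix.mulVec_mulVec, hA, Matrix.one_mulVec]

lemma dZ_apply (hg : DifferentiableAt ℝ g z) (i : Fin 3) : dZ (fun w => g w i) z = dZ g z i :=
  dZ_clm_comp (ContinuousLinearMap.proj i) hg

lemma dZbar_apply (hg : DifferentiableAt ℝ g z) (i : Fin 3) :
    dZbar (fun w => g w i) z = dZbar g z i :=
  dZbar_clm_comp (ContinuousLinearMap.proj i) hg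

end MatrixAction

section Equivariance

variable {f : ℂ → ℙ ℂ (Fin 3 → ℂ)} {u : ℂ → ℝ} {H : ℂ → Fin 3 → ℂ}

lemma conjTranspose_mulVec_mem_submodule {g : Matrix.SpecialLinearGroup (Fin 3) ℂ}
    (hg : (g : Matrix (Fin 3) (Fin 3) ℂ)ᴴ * (g : Matrix (Fin 3) (Fin 3) ℂ) = 1)
    {p : ℙ ℂ (Fin 3 → ℂ)} {v : Fin 3 → ℂ} (hv : v ∈ (g • p).submodule) :
    (g : Matrix (Fin 3) (Fin 3) ℂ)ᴴ *ᵥ v ∈ p.submodule := by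
  induction p using Projectivization.ind with
  | h q hq =>
    rw [Projectivization.smul_mk, Projectivization.submodule_mk,
      Submodule.mem_span_singleton] at hv
    obtain ⟨a, rfl⟩ := hv
    rw [Projectivization.submodule_mk, Submodule.mem_span_singleton]
    refine ⟨a, ?_⟩
    change a • q = _ *ᵥ (a • ((g : Matrix (Fin 3) (Fin 3) ℂ) *ᵥ q))
    rw [Matrix.mulVec_smul, Matrix.mulVec_mulVec, hg, Matrix.one_mulVec]

theorem IsHorizontalLift.exists_unitary_add_ofReal (hH : IsHorizontalLift f H)
    (hequiv : IsTranslationallyEquivariant f) (t : ℝ) :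
    ∃ U : Matrix (Fin 3) (Fin 3) ℂ, Uᴴ * U = 1 ∧ ∀ z, H (z + t) = U *ᵥ H z := by
  obtain ⟨R, hunitary, -, -, hR⟩ := hequiv
  set M : Matrix (Fin 3) (Fin 3) ℂ := (R t : Matrix (Fin 3) (Fin 3) ℂ)
  have hleft : Mᴴ * M = 1 := Matrix.mem_unitaryGroup_iff'.mp (hunitary t)
  have hright : M * Mᴴ = 1 := Matrix.mem_unitaryGroup_iff.mp (hunitary t)
  have hright' : Mᴴᴴ * Mᴴ = 1 := by rwa [Matrix.conjTranspose_conjTranspose]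
  have hsmooth : ContDiff ℝ ∞ fun z : ℂ => H (z + t) :=
    hH.1.1.comp (contDiff_id.add contDiff_const)
  have hdiff := differentiable_of_smooth hsmooth
  have hpullback : IsHorizontalLift f fun z => Mᴴ *ᵥ H (z + t) := by
    refine ⟨⟨contDiff_mulVec _ hsmooth, fun z => ⟨?_, ?_⟩⟩, fun z => ⟨?_, ?_⟩⟩
    · rw [hdot_mulVec_mulVec hright', (hH.1.2 _).1]
    · exact conjTranspose_mulVec_mem_submodule hleft (hR z t ▸ (hH.1.2 (z + t)).2)
    · rw [dX_mulVec _ (hdiff z), hdot_mulVec_mulVec hright', dX_comp_add_const, (hH.2 _).1]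
    · rw [dY_mulVec _ (hdiff z), hdot_mulVec_mulVec hright', dY_comp_add_const, (hH.2 _).2]
  obtain ⟨κ, hκ, hκH⟩ := hH.exists_eq_const_smul hpullback
  refine ⟨κ • M, ?_, fun z => ?_⟩
  · rw [Matrix.conjTranspose_smul, Matrix.smul_mul, Matrix.mul_smul, hleft, smul_smul,
      Complex.star_def, Complex.conj_mul', hκ]
    simp
  · rw [Matrix.smul_mulVec, ← Matrix.mulVec_smul, ← hκH, Matrix.mulVec_mulVec, hright,
      Matrix.one_mulVec]

namespace IsConformalLift

lemma u_add_ofReal (hH : IsConformalLift f u H) (hequiv : IsTranslationallyEquivariant f) (z : ℂ)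
    (t : ℝ) : u (z + t) = u z := by
  obtain ⟨U, hU, hUH⟩ := hH.lift.exists_unitary_add_ofReal hequiv t
  have h := hH.hdot_dZ_dZ (z + t)
  rw [← dZ_comp_add_const, funext hUH, dZ_mulVec U (hH.differentiable z), hdot_mulVec_mulVec hU,
    hH.hdot_dZ_dZ] at h
  exact Real.exp_injective (by exact_mod_cast h.symm)

lemma hopfCoeff_add_ofReal (hH : IsConformalLift f u H) (hequiv : IsTranslationallyEquivariant f)
    (z : ℂ) (t : ℝ) : hopfCoeff H (z + t) = hopfCoeff H z := by
  obtain ⟨U, hU, hUH⟩ := hH.lift.exists_unitary_add_ofReal hequiv t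
  have hdZ (w : ℂ) : dZ H (w + t) = U *ᵥ dZ H w := by
    rw [← dZ_comp_add_const, funext hUH, dZ_mulVec U (hH.differentiable w)]
  have hdZbar : dZbar H (z + t) = U *ᵥ dZbar H z := by
    rw [← dZbar_comp_add_const, funext hUH, dZbar_mulVec U (hH.differentiable z)]
  rw [hopfCoeff, ← dZ_comp_add_const, funext hdZ, dZ_mulVec U (hH.differentiable_dZ z), hdZbar,
    hdot_mulVec_mulVec hU, hopfCoeff]

lemma dX_u (hH : IsConformalLift f u H) (hequiv : IsTranslationallyEquivariant f) (z : ℂ) :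
    dX u z = 0 :=
  dX_eq_zero_of_translation_invariant hH.differentiable_u (hH.u_add_ofReal hequiv) z

/-- The Hopf coefficient is holomorphic and invariant under real translations. -/
theorem hopfCoeff_eq (hH : IsConformalLift f u H) (hmin : HasZeroMeanCurvature f)
    (hequiv : IsTranslationallyEquivariant f) (z z' : ℂ) : hopfCoeff H z = hopfCoeff H z' := by
  have hdiff : Differentiable ℝ (hopfCoeff H) := differentiable_of_smooth <|
    contDiff_hdot (contDiff_dZ (contDiff_dZ hH.contDiff)) (contDiff_dZbar hH.contDiff)
  have hX := dX_eq_zero_of_translation_invariant hdiff (hH.hopfCoeff_add_ofReal hequiv)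
  refine eq_of_dX_eq_zero_of_dY_eq_zero hdiff hX (fun w => ?_) z z'
  simpa [dZbar, hX] using hH.dZbar_hopfCoeff hmin w

end IsConformalLift

end Equivariance

section Jacobi

variable {n : Type*} [Fintype n] [DecidableEq n]

lemma sum_det_updateRow_mul {R : Type*} [CommRing R] (A B : Matrix n n R) :
    ∑ i, (A.updateRow i ((A * B) i)).det = A.det * B.trace := by
  have hrow (i : n) : (A.updateRow i ((A * B) i)).det = (A * B * A.adjugate) i i := by
    rw [← Matrix.cramer_transpose_apply, Matrix.cramer_eq_adjugate_mulVec,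
      ← Matrix.adjugate_transpose, Matrix.mulVec_transpose]
    rfl
  have htrace : (A * B * A.adjugate).trace = A.det * B.trace := by
    rw [Matrix.trace_mul_comm, ← Matrix.mul_assoc, Matrix.adjugate_mul, Matrix.smul_mul,
      Matrix.one_mul, Matrix.trace_smul, smul_eq_mul]
  simp only [hrow]
  exact htrace

lemma fderiv_det_eq_det_mul_trace {K : ℂ → Matrix n n ℂ} {B : Matrix n n ℂ} {z v : ℂ}
    (hK : ∀ i j, DifferentiableAt ℝ (fun w => K w i j) z)
    (hB : ∀ i j, fderiv ℝ (fun w => K w i j) z v = (K z * B) i j) :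
    fderiv ℝ (fun w => (K w).det) z v = (K z).det * B.trace := by
  let D : ContinuousMultilinearMap ℝ (fun _ : n => n → ℂ) ℂ :=
    ⟨(Matrix.detRowAlternating (R := ℂ)).toMultilinearMap.restrictScalars ℝ,
      Continuous.matrix_det continuous_id⟩
  have hrows : HasFDerivAt (fun w i j => K w i j) _ z :=
    hasFDerivAt_pi.mpr fun i => hasFDerivAt_pi.mpr fun j => (hK i j).hasFDerivAt
  have hderiv := DFunLike.congr_fun ((D.hasFDerivAt _).comp z hrows).fderiv v
  refine hderiv.trans (Eq.trans ?_ (sum_det_updateRow_mul (K z) B))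
  simp only [ContinuousLinearMap.comp_apply, ContinuousMultilinearMap.linearDeriv_apply]
  refine Finset.sum_congr rfl fun i _ => congrArg Matrix.det (congrArg _ ?_)
  exact funext fun j => hB i j

end Jacobi

section AdaptedFrame

lemma ofReal_exp_half (x : ℝ) : (Real.exp (x / 2) : ℂ) = (Real.exp (-(x / 2)) : ℂ)⁻¹ := by
  rw [Real.exp_neg, Complex.ofReal_inv, inv_inv]

lemma ofReal_exp_neg (x : ℝ) : (Real.exp (-x) : ℂ) = (Real.exp (-(x / 2)) : ℂ) ^ 2 := by
  rw [← Complex.ofReal_pow, ← Real.exp_nat_mul]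
  ring_nf

lemma ofReal_exp_eq_inv_sq (x : ℝ) : (Real.exp x : ℂ) = ((Real.exp (-(x / 2)) : ℂ) ^ 2)⁻¹ := by
  rw [← ofReal_exp_neg, ← Complex.ofReal_inv, ← Real.exp_neg, neg_neg]

lemma hasDerivAt_exp_neg_half (x : ℝ) :
    HasDerivAt (fun t => Real.exp (-(t / 2))) (-(Real.exp (-(x / 2)) / 2)) x := by
  refine (((hasDerivAt_id' x).div_const 2).fun_neg.exp).congr_deriv ?_
  ring

variable {u : ℂ → ℝ} {z : ℂ} {g : ℂ → Fin 3 → ℂ}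

lemma differentiableAt_ofReal_exp_neg_half (hu : DifferentiableAt ℝ u z) :
    DifferentiableAt ℝ (fun w => (Real.exp (-(u w / 2)) : ℂ)) z :=
  Complex.ofRealCLM.differentiableAt.comp z
    (f := fun w => Real.exp (-(u w / 2))) ((hasDerivAt_exp_neg_half _).differentiableAt.comp z hu)

lemma dZ_exp_neg_half_smul (hu : DifferentiableAt ℝ u z) (hg : DifferentiableAt ℝ g z) (a : ℂ) :
    dZ (fun w => (a * (Real.exp (-(u w / 2)) : ℂ)) • g w) z =
      (a * Real.exp (-(u z / 2))) • (dZ g z - (dZ (fun w => (u w : ℂ)) z / 2) • g z) := by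
  have hexp := differentiableAt_ofReal_exp_neg_half hu
  rw [dZ_smul (hexp.const_mul a) hg,
    show dZ (fun w => a * (Real.exp (-(u w / 2)) : ℂ)) z = _ from dZ_const_smul a hexp,
    dZ_ofReal_comp_of_hasDerivAt (hasDerivAt_exp_neg_half (u z)) hu]
  push_cast
  match_scalars
  · ring
  · ring

lemma dZbar_exp_neg_half_smul (hu : DifferentiableAt ℝ u z) (hg : DifferentiableAt ℝ g z)
    (a : ℂ) :
    dZbar (fun w => (a * (Real.exp (-(u w / 2)) : ℂ)) • g w) z =
      (a * Real.exp (-(u z / 2))) • (dZbar g z - (dZbar (fun w => (u w : ℂ)) z / 2) • g z) := by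
  have hexp := differentiableAt_ofReal_exp_neg_half hu
  rw [dZbar_smul (hexp.const_mul a) hg,
    show dZbar (fun w => a * (Real.exp (-(u w / 2)) : ℂ)) z = _ from dZbar_const_smul a hexp,
    dZbar_ofReal_comp_of_hasDerivAt (hasDerivAt_exp_neg_half (u z)) hu]
  push_cast
  match_scalars
  · ring
  · ring

/-- The coefficient matrix `Fr⁻¹ Fr_z` in the frame equations. -/
def frameFormZ (lam : ℂ) (u : ℂ → ℝ) (ψ : ℂ → ℂ) (z : ℂ) : Matrix (Fin 3) (Fin 3) ℂ :=
  matU lam (Real.exp (u z / 2)) (ψ z * Real.exp (-u z)) (dZ (fun w => (u w : ℂ)) z)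

/-- The coefficient matrix `Fr⁻¹ Fr_z̄` in the frame equations. -/
def frameFormZbar (lam : ℂ) (u : ℂ → ℝ) (ψ : ℂ → ℂ) (z : ℂ) : Matrix (Fin 3) (Fin 3) ℂ :=
  matV lam (Real.exp (u z / 2)) (conj (ψ z) * Real.exp (-u z)) (dZbar (fun w => (u w : ℂ)) z)

/-- The columns of the frame adapted to a horizontal lift `H` with metric `2 e^u dz dz̄`:
the normalized vectors `H_z`, `H_z̄` and `H` itself. -/
def adaptedCol (lam : ℂ) (u : ℂ → ℝ) (H : ℂ → Fin 3 → ℂ) : Fin 3 → ℂ → Fin 3 → ℂ :=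
  ![fun z => (-I * lam * Real.exp (-(u z / 2))) • dZ H z,
    fun z => (-I * lam⁻¹ * Real.exp (-(u z / 2))) • dZbar H z, H]

/-- The matrix with columns `adaptedCol`. It is unitary, with constant determinant, and satisfies
the frame equations. -/
def adaptedFrame (lam : ℂ) (u : ℂ → ℝ) (H : ℂ → Fin 3 → ℂ) (z : ℂ) : Matrix (Fin 3) (Fin 3) ℂ :=
  Matrix.of fun i j => adaptedCol lam u H j z i

variable {f : ℂ → ℙ ℂ (Fin 3 → ℂ)} {H : ℂ → Fin 3 → ℂ} {lam : ℂ} {ψ : ℂ → ℂ}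

lemma contDiff_adaptedCol (hH : IsConformalLift f u H) (j : Fin 3) :
    ContDiff ℝ ∞ (adaptedCol lam u H j) := by
  have hexp : ContDiff ℝ ∞ (fun z => (Real.exp (-(u z / 2)) : ℂ)) :=
    contDiff_ofReal_comp (hH.contDiff_u.div_const 2).neg.exp
  fin_cases j
  · exact (contDiff_const.mul hexp).smul (contDiff_dZ hH.contDiff)
  · exact (contDiff_const.mul hexp).smul (contDiff_dZbar hH.contDiff)
  · exact hH.contDiff

lemma hdot_adaptedCol (hH : IsConformalLift f u H) (hlam : ‖lam‖ = 1) (z : ℂ) (i j : Fin 3) :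
    hdot (adaptedCol lam u H j z) (adaptedCol lam u H i z) = if i = j then 1 else 0 := by
  have hlam0 : lam ≠ 0 := norm_ne_zero_iff.mp (by simp [hlam])
  have hs := ofReal_exp_ne_zero (-(u z / 2))
  have hlen : (Real.exp (u z) : ℂ) * (Real.exp (-(u z / 2)) : ℂ) ^ 2 = 1 := by
    rw [ofReal_exp_eq_inv_sq, inv_mul_cancel₀ (pow_ne_zero 2 hs)]
  fin_cases i <;> fin_cases j <;>
    simp [adaptedCol, hdot_neg_left, hdot_neg_right, hdot_smul_left, hdot_smul_right,
      hH.hdot_dZ_dZ, hH.hdot_dZbar_dZbar, hH.hdot_self, hH.hdot_dZ_dZbar, hH.hdot_dZbar_dZ,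
      hH.hdot_dZ_self, hH.hdot_dZbar_self, hH.hdot_self_dZ, hH.hdot_self_dZbar,
      ← Complex.inv_eq_conj hlam, -Complex.ofReal_exp]
  all_goals
    field_simp
    linear_combination hlen - (Real.exp (u z) : ℂ) * (Real.exp (-(u z / 2)) : ℂ) ^ 2 * Complex.I_sq

lemma conjTranspose_mul_adaptedFrame (hH : IsConformalLift f u H) (hlam : ‖lam‖ = 1) (z : ℂ) :
    (adaptedFrame lam u H z)ᴴ * adaptedFrame lam u H z = 1 := by
  ext i j
  rw [Matrix.one_apply, ← hdot_adaptedCol hH hlam z i j, Matrix.mul_apply]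
  exact Finset.sum_congr rfl fun k _ => mul_comm _ _

lemma sum_matU_smul (lam e p a : ℂ) (v : Fin 3 → Fin 3 → ℂ) (j : Fin 3) :
    ∑ k, matU lam e p a k j • v k =
      ![(a / 2) • v 0 - (lam⁻¹ * (I * p)) • v 1, (lam⁻¹ * (I * e)) • v 2 - (a / 2) • v 1,
        (lam⁻¹ * (I * e)) • v 0] j := by
  rw [Fin.sum_univ_three]
  fin_cases j <;> simp [matU] <;> module

lemma sum_matV_smul (lam e p a : ℂ) (v : Fin 3 → Fin 3 → ℂ) (j : Fin 3) :
    ∑ k, matV lam e p a k j • v k =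
      ![(lam * (I * e)) • v 2 - (a / 2) • v 0, (a / 2) • v 1 - (lam * (I * p)) • v 0,
        (lam * (I * e)) • v 1] j := by
  rw [Fin.sum_univ_three]
  fin_cases j <;> simp [matV] <;> module

lemma dZ_adaptedCol (hH : IsConformalLift f u H) (hmin : HasZeroMeanCurvature f)
    (hHopf : HasHopfDifferential f (fun z => -I * (lam ^ 3)⁻¹ * ψ z)) (hlam : ‖lam‖ = 1)
    (z : ℂ) (j : Fin 3) :
    dZ (adaptedCol lam u H j) z = ∑ k, frameFormZ lam u ψ z k j • adaptedCol lam u H k z := by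
  have hlam0 : lam ≠ 0 := norm_ne_zero_iff.mp (by simp [hlam])
  have := ofReal_exp_ne_zero (-(u z / 2))
  have hφ : hopfCoeff H z = -I * (lam ^ 3)⁻¹ * ψ z := hHopf H hH.lift z
  rw [frameFormZ, sum_matU_smul, ofReal_exp_half, ofReal_exp_neg (u z)]
  fin_cases j
  · have hcol := dZ_exp_neg_half_smul (hH.differentiable_u z) (hH.differentiable_dZ z) (-I * lam)
    rw [hH.dZ_dZ hmin, hφ, ofReal_exp_eq_inv_sq (u z)] at hcol
    refine hcol.trans ?_
    simp only [adaptedCol, Fin.zero_eta, Matrix.cons_val]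
    match_scalars
    · ring
    · field_simp
  · have hcol := dZ_exp_neg_half_smul (hH.differentiable_u z) (hH.differentiable_dZbar z)
      (-I * lam⁻¹)
    rw [dZ_dZbar hH.contDiff, hH.dZbar_dZ hmin, ofReal_exp_eq_inv_sq (u z)] at hcol
    refine hcol.trans ?_
    simp only [adaptedCol, Fin.mk_one, Matrix.cons_val]
    match_scalars
    · field_simp
    · ring
  · change dZ H z = _
    simp only [adaptedCol, Fin.reduceFinMk, Matrix.cons_val]
    rw [smul_smul]
    match_scalars
    field_simp
    linear_combination Complex.I_sq

lemma dZbar_adaptedCol (hH : IsConformalLift f u H) (hmin : HasZeroMeanCurvature f)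
    (hHopf : HasHopfDifferential f (fun z => -I * (lam ^ 3)⁻¹ * ψ z)) (hlam : ‖lam‖ = 1)
    (z : ℂ) (j : Fin 3) :
    dZbar (adaptedCol lam u H j) z =
      ∑ k, frameFormZbar lam u ψ z k j • adaptedCol lam u H k z := by
  have hlam0 : lam ≠ 0 := norm_ne_zero_iff.mp (by simp [hlam])
  have := ofReal_exp_ne_zero (-(u z / 2))
  have hφ : hopfCoeff H z = -I * (lam ^ 3)⁻¹ * ψ z := hHopf H hH.lift z
  rw [frameFormZbar, sum_matV_smul, ofReal_exp_half, ofReal_exp_neg (u z)]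
  fin_cases j
  · have hcol := dZbar_exp_neg_half_smul (hH.differentiable_u z) (hH.differentiable_dZ z)
      (-I * lam)
    rw [hH.dZbar_dZ hmin, ofReal_exp_eq_inv_sq (u z)] at hcol
    refine hcol.trans ?_
    simp only [adaptedCol, Fin.zero_eta, Matrix.cons_val]
    match_scalars
    · field_simp
    · ring
  · have hcol := dZbar_exp_neg_half_smul (hH.differentiable_u z) (hH.differentiable_dZbar z)
      (-I * lam⁻¹)
    rw [hH.dZbar_dZbar hmin, hφ, ofReal_exp_eq_inv_sq (u z)] at hcol
    refine hcol.trans ?_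
    simp only [adaptedCol, Fin.mk_one, Matrix.cons_val, map_mul, map_neg, map_inv₀, map_pow,
      Complex.conj_I, ← Complex.inv_eq_conj hlam]
    match_scalars
    · ring
    · field_simp
  · change dZbar H z = _
    simp only [adaptedCol, Fin.reduceFinMk, Matrix.cons_val]
    rw [smul_smul]
    match_scalars
    field_simp
    linear_combination Complex.I_sq

lemma trace_frameFormZ (lam : ℂ) (u : ℂ → ℝ) (ψ : ℂ → ℂ) (z : ℂ) :
    (frameFormZ lam u ψ z).trace = 0 := by
  simp [frameFormZ, matU, Matrix.trace_fin_three]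

lemma trace_frameFormZbar (lam : ℂ) (u : ℂ → ℝ) (ψ : ℂ → ℂ) (z : ℂ) :
    (frameFormZbar lam u ψ z).trace = 0 := by
  simp [frameFormZbar, matV, Matrix.trace_fin_three]

lemma contDiff_adaptedFrame (hH : IsConformalLift f u H) (i j : Fin 3) :
    ContDiff ℝ ∞ (fun z => adaptedFrame lam u H z i j) :=
  contDiff_pi.mp (contDiff_adaptedCol hH j) i

lemma dZ_adaptedFrame (hH : IsConformalLift f u H) (hmin : HasZeroMeanCurvature f)
    (hHopf : HasHopfDifferential f (fun z => -I * (lam ^ 3)⁻¹ * ψ z)) (hlam : ‖lam‖ = 1)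
    (z : ℂ) (i j : Fin 3) :
    dZ (fun w => adaptedFrame lam u H w i j) z =
      (adaptedFrame lam u H z * frameFormZ lam u ψ z) i j := by
  have hcol := congrFun (dZ_adaptedCol hH hmin hHopf hlam z j) i
  rw [← dZ_apply (differentiable_of_smooth (contDiff_adaptedCol hH j) z), Finset.sum_apply] at hcol
  exact hcol.trans (Finset.sum_congr rfl fun k _ => mul_comm _ _)

lemma dZbar_adaptedFrame (hH : IsConformalLift f u H) (hmin : HasZeroMeanCurvature f)
    (hHopf : HasHopfDifferential f (fun z => -I * (lam ^ 3)⁻¹ * ψ z)) (hlam : ‖lam‖ = 1)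
    (z : ℂ) (i j : Fin 3) :
    dZbar (fun w => adaptedFrame lam u H w i j) z =
      (adaptedFrame lam u H z * frameFormZbar lam u ψ z) i j := by
  have hcol := congrFun (dZbar_adaptedCol hH hmin hHopf hlam z j) i
  rw [← dZbar_apply (differentiable_of_smooth (contDiff_adaptedCol hH j) z),
    Finset.sum_apply] at hcol
  exact hcol.trans (Finset.sum_congr rfl fun k _ => mul_comm _ _)

lemma det_adaptedFrame (hH : IsConformalLift f u H) (hmin : HasZeroMeanCurvature f)
    (hHopf : HasHopfDifferential f (fun z => -I * (lam ^ 3)⁻¹ * ψ z)) (hlam : ‖lam‖ = 1)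
    (z z' : ℂ) : (adaptedFrame lam u H z).det = (adaptedFrame lam u H z').det := by
  have hd (i j : Fin 3) : Differentiable ℝ (fun z => adaptedFrame lam u H z i j) :=
    differentiable_of_smooth (contDiff_adaptedFrame hH i j)
  refine eq_of_dX_eq_zero_of_dY_eq_zero (g := fun z => (adaptedFrame lam u H z).det)
    ?_ (fun z => ?_) (fun z => ?_) z z'
  · simp only [Matrix.det_fin_three]
    fun_prop
  · refine (fderiv_det_eq_det_mul_trace (B := frameFormZ lam u ψ z + frameFormZbar lam u ψ z)
      (fun i j => hd i j z) fun i j => (dX_eq_dZ_add_dZbar _ z).trans ?_).trans ?_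
    · rw [dZ_adaptedFrame hH hmin hHopf hlam, dZbar_adaptedFrame hH hmin hHopf hlam,
        Matrix.mul_add, Matrix.add_apply]
    · rw [Matrix.trace_add, trace_frameFormZ, trace_frameFormZbar, add_zero, mul_zero]
  · refine (fderiv_det_eq_det_mul_trace
      (B := I • (frameFormZ lam u ψ z - frameFormZbar lam u ψ z))
      (fun i j => hd i j z) fun i j => (dY_eq_I_smul_dZ_sub_dZbar _ z).trans ?_).trans ?_
    · rw [dZ_adaptedFrame hH hmin hHopf hlam, dZbar_adaptedFrame hH hmin hHopf hlam,
        Matrix.mul_smul, Matrix.mul_sub, Matrix.smul_apply, Matrix.sub_apply]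
    · rw [Matrix.trace_smul, Matrix.trace_sub, trace_frameFormZ, trace_frameFormZbar, sub_zero,
        smul_zero, mul_zero]

lemma adaptedFrame_const_smul (hH : IsConformalLift f u H) (κ z : ℂ) :
    adaptedFrame lam u (fun w => κ • H w) z = κ • adaptedFrame lam u H z := by
  ext i j
  fin_cases j <;>
    simp [adaptedFrame, adaptedCol, dZ_const_smul κ (hH.differentiable z),
      dZbar_const_smul κ (hH.differentiable z), mul_left_comm]

theorem exists_isFrame (hf : IsMinimalLagrangian f u)
    (hHopf : HasHopfDifferential f (fun z => -I * (lam ^ 3)⁻¹ * ψ z)) (hlam : ‖lam‖ = 1) :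
    ∃ Fr, IsFrame f u ψ lam Fr := by
  obtain ⟨H, hH⟩ := exists_isConformalLift hf.1
  set δ := (adaptedFrame lam u H 0).det
  have hδ : conj δ * δ = 1 := by
    have h := congrArg Matrix.det (conjTranspose_mul_adaptedFrame hH hlam 0)
    rwa [Matrix.det_mul, Matrix.det_conjTranspose, Matrix.det_one] at h
  obtain ⟨κ, hκ⟩ := IsAlgClosed.exists_pow_nat_eq (conj δ) (n := 3) (by norm_num)
  have hκ1 : ‖κ‖ = 1 := by
    have hδ1 : ‖δ‖ ^ 2 = 1 := by simpa [sq] using congrArg norm hδ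
    have hκ3 : ‖κ‖ ^ 3 = 1 := by
      rw [← norm_pow, hκ, RCLike.norm_conj,
        (pow_eq_one_iff_of_nonneg (norm_nonneg δ) two_ne_zero).mp hδ1]
    exact (pow_eq_one_iff_of_nonneg (norm_nonneg κ) three_ne_zero).mp hκ3
  have hK := hH.const_smul hκ1
  refine ⟨adaptedFrame lam u (fun z => κ • H z), contDiff_adaptedFrame hK, fun z => ?_,
    dZ_adaptedFrame hK hf.2 hHopf hlam, dZbar_adaptedFrame hK hf.2 hHopf hlam,
    fun z => (hK.lift.1.2 z).2⟩
  rw [Matrix.mem_specialUnitaryGroup_iff, Matrix.mem_unitaryGroup_iff']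
  refine ⟨conjTranspose_mul_adaptedFrame hK hlam z, ?_⟩
  rw [adaptedFrame_const_smul hH, Matrix.det_smul, det_adaptedFrame hH hf.2 hHopf hlam z 0,
    Fintype.card_fin, hκ, hδ]

end AdaptedFrame

section MetricEquation

variable {f : ℂ → ℙ ℂ (Fin 3 → ℂ)} {u : ℂ → ℝ} {H : ℂ → Fin 3 → ℂ}

lemma IsConformalLift.dY_dY_u (hH : IsConformalLift f u H) (hmin : HasZeroMeanCurvature f)
    (hequiv : IsTranslationallyEquivariant f) (z : ℂ) :
    dY (dY u) z = -4 * Real.exp (u z) + 4 * ‖hopfCoeff H z‖ ^ 2 / Real.exp (u z) ^ 2 := by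
  have hX : dX (fun w => (u w : ℂ)) = fun _ => 0 := by
    ext w
    rw [dX_ofReal_comp (hH.differentiable_u w), hH.dX_u hequiv, Complex.ofReal_zero]
  have hY : dY (fun w => (u w : ℂ)) = fun w => ((dY u w : ℝ) : ℂ) :=
    funext fun w => dY_ofReal_comp (hH.differentiable_u w)
  have hgauss := hH.gauss_equation hmin z
  rw [dZbar_dZ_eq_laplacian (contDiff_ofReal_comp hH.contDiff_u), hX, dX_const, hY,
    dY_ofReal_comp (differentiable_of_smooth (contDiff_dY hH.contDiff_u) z), zero_add,
    Complex.mul_conj', smul_eq_mul] at hgauss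
  have : dY (dY u) z / 4 = -Real.exp (u z) + ‖hopfCoeff H z‖ ^ 2 * (Real.exp (u z) ^ 2)⁻¹ := by
    rw [← Complex.ofReal_inj]
    push_cast
    push_cast at hgauss
    linear_combination hgauss
  linear_combination 4 * this

lemma hasDerivAt_exp_comp_mul_I (hu : Differentiable ℝ u) (y : ℝ) :
    HasDerivAt (fun t : ℝ => Real.exp (u (t * I)))
      (Real.exp (u (y * I)) * dY u (y * I)) y :=
  (hasDerivAt_ofReal_mul_I (hu _)).exp

lemma IsConformalLift.hasDerivAt_exp_mul_dY_u (hH : IsConformalLift f u H)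
    (hmin : HasZeroMeanCurvature f) (hequiv : IsTranslationallyEquivariant f) (y : ℝ) :
    HasDerivAt (fun t : ℝ => Real.exp (u (t * I)) * dY u (t * I))
      (-4 * Real.exp (u (y * I)) ^ 2 +
        (Real.exp (u (y * I)) * dY u (y * I)) ^ 2 / Real.exp (u (y * I)) +
        4 * ‖hopfCoeff H (y * I)‖ ^ 2 / Real.exp (u (y * I))) y := by
  have hdY := hasDerivAt_ofReal_mul_I (y := y)
    (differentiable_of_smooth (contDiff_dY hH.contDiff_u) _)
  refine ((hasDerivAt_exp_comp_mul_I hH.differentiable_u y).mul hdY).congr_deriv ?_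
  rw [hH.dY_dY_u hmin hequiv]
  field_simp
  ring

variable {w w₁ : ℝ → ℝ} {m : ℝ}

/-- The first integral comes from the constancy of `(w₁² + 8 w³ + 4 m²) / w²`. -/
theorem sq_deriv_eq_of_gauss (hpos : ∀ y, 0 < w y) (hw : ∀ y, HasDerivAt w (w₁ y) y)
    (hw₁ : ∀ y, HasDerivAt w₁ (-4 * w y ^ 2 + w₁ y ^ 2 / w y + 4 * m ^ 2 / w y) y)
    (h0 : w₁ 0 = 0) (y : ℝ) :
    w₁ y ^ 2 = 4 * betaConst (w 0) m * w y ^ 2 - 8 * w y ^ 3 - 4 * m ^ 2 := by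
  have hderiv (y : ℝ) :
      HasDerivAt (fun y => (w₁ y ^ 2 + 8 * w y ^ 3 + 4 * m ^ 2) / w y ^ 2) 0 y := by
    have := (hpos y).ne'
    refine (((((hw₁ y).fun_pow 2).fun_add (((hw y).fun_pow 3).const_mul 8)).add_const
      (4 * m ^ 2)).fun_div ((hw y).fun_pow 2) (by positivity)).congr_deriv ?_
    push_cast
    field_simp
    ring
  have hconst := is_const_of_deriv_eq_zero (fun y => (hderiv y).differentiableAt)
    (fun y => (hderiv y).deriv) y 0
  have := (hpos y).ne'
  have := (hpos 0).ne'
  simp only [h0] at hconst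
  rw [betaConst]
  field_simp at hconst ⊢
  linear_combination hconst

lemma hasDerivAt_deriv_of_gauss (hpos : ∀ y, 0 < w y) (hw : ∀ y, HasDerivAt w (w₁ y) y)
    (hw₁ : ∀ y, HasDerivAt w₁ (-4 * w y ^ 2 + w₁ y ^ 2 / w y + 4 * m ^ 2 / w y) y)
    (h0 : w₁ 0 = 0) (y : ℝ) :
    HasDerivAt w₁ (4 * betaConst (w 0) m * w y - 12 * w y ^ 2) y := by
  refine (hw₁ y).congr_deriv ?_
  rw [sq_deriv_eq_of_gauss hpos hw hw₁ h0 y]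
  have := (hpos y).ne'
  field_simp
  ring

end MetricEquation

/-- The real numbers `d 0, d 1, d 2` are the roots of `X³ - β X + 2 ρ`, where `ρ ≠ 0` and the
discriminant is positive. With `ρ = Re (λ⁻³ ψ)`, these are the `d_j` for which the
`i d_j` are the eigenvalues of the generating matrix. -/
structure IsSpectrum (d : Fin 3 → ℝ) (β ρ : ℝ) : Prop where
  sum : d 0 + d 1 + d 2 = 0
  pair : d 0 * d 1 + d 0 * d 2 + d 1 * d 2 = -β
  prod : d 0 * d 1 * d 2 = -2 * ρ
  disc : 27 * ρ ^ 2 < β ^ 3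
  ne_zero : ρ ≠ 0

namespace IsSpectrum

variable {d : Fin 3 → ℝ} {β ρ : ℝ}

lemma cubic (h : IsSpectrum d β ρ) (j : Fin 3) : d j ^ 3 - β * d j + 2 * ρ = 0 := by
  have hroot : (d j - d 0) * (d j - d 1) * (d j - d 2) = 0 := by fin_cases j <;> simp
  linear_combination hroot + d j ^ 2 * h.sum - d j * h.pair + h.prod

lemma apply_ne_zero (h : IsSpectrum d β ρ) (j : Fin 3) : d j ≠ 0 := by
  intro h0
  have hcubic := h.cubic j
  rw [h0] at hcubic
  exact h.ne_zero (by linarith)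

lemma cube_sub_ne_zero (h : IsSpectrum d β ρ) (j : Fin 3) : d j ^ 3 - ρ ≠ 0 := by
  intro h0
  have hlin : β * d j = 3 * ρ := by linear_combination h0 - h.cubic j
  have hdisc : β ^ 3 * ρ = 27 * ρ ^ 2 * ρ := by
    calc β ^ 3 * ρ = (β * d j) ^ 3 := by rw [mul_pow, sub_eq_zero.mp h0]
      _ = 27 * ρ ^ 2 * ρ := by rw [hlin]; ring
  exact h.disc.ne' (mul_right_cancel₀ h.ne_zero hdisc)

lemma mul_derivative_eq (h : IsSpectrum d β ρ) (j : Fin 3) :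
    d j * (3 * d j ^ 2 - β) = 2 * (d j ^ 3 - ρ) := by
  linear_combination h.cubic j

lemma injective (h : IsSpectrum d β ρ) : Function.Injective d := by
  have hdisc : (d 0 - d 1) ^ 2 * (d 0 - d 2) ^ 2 * (d 1 - d 2) ^ 2 =
      4 * (β ^ 3 - 27 * ρ ^ 2) := by
    have hd : d 2 = -d 0 - d 1 := by linear_combination h.sum
    have hβ : β = -(d 0 * d 1 + d 0 * d 2 + d 1 * d 2) := by linear_combination h.pair
    have hρ : ρ = -(d 0 * d 1 * d 2) / 2 := by linear_combination h.prod / 2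
    rw [hρ, hβ, hd]
    ring
  have hne : (d 0 - d 1) ^ 2 * (d 0 - d 2) ^ 2 * (d 1 - d 2) ^ 2 ≠ 0 := by
    rw [hdisc]
    linarith [h.disc]
  simp only [ne_eq, mul_eq_zero, pow_eq_zero_iff two_ne_zero, sub_eq_zero, not_or] at hne
  obtain ⟨⟨h01, h02⟩, h12⟩ := hne
  intro i j hij
  fin_cases i <;> fin_cases j <;> simp_all [eq_comm]

lemma vandermonde_solution (h : IsSpectrum d β ρ) {X : Fin 3 → ℂ} {s₀ s₁ s₂ : ℂ}
    (h0 : ∑ j, X j = s₀) (h1 : ∑ j, (d j : ℂ) * X j = s₁) (h2 : ∑ j, (d j : ℂ) ^ 2 * X j = s₂)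
    (j : Fin 3) :
    X j * (3 * d j ^ 2 - β) = s₂ + d j * s₁ + (d j ^ 2 - β) * s₀ := by
  have hsum : (d 0 : ℂ) + d 1 + d 2 = 0 := by exact_mod_cast h.sum
  have hpair : (d 0 : ℂ) * d 1 + d 0 * d 2 + d 1 * d 2 = -β := by exact_mod_cast h.pair
  have hd : (d 2 : ℂ) = -d 0 - d 1 := by linear_combination hsum
  have hβ : (β : ℂ) = -((d 0 : ℂ) * d 1 + d 0 * d 2 + d 1 * d 2) := by linear_combination hpair
  rw [← h0, ← h1, ← h2, hβ]
  simp only [Fin.sum_univ_three]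
  fin_cases j <;> simp only [Fin.zero_eta, Fin.mk_one, Fin.reduceFinMk] <;> rw [hd] <;> ring

/-- If `d j * w = ρ`, then the first integral becomes `w₁² + 4 b² = 0`. -/
lemma mul_sub_ne_zero (h : IsSpectrum d β ρ) {w w₁ b : ℝ} (hb : b ≠ 0)
    (hw : w₁ ^ 2 = 4 * β * w ^ 2 - 8 * w ^ 3 - 4 * (ρ ^ 2 + b ^ 2)) (j : Fin 3) :
    d j * w - ρ ≠ 0 := by
  intro h0
  have hzero : d j * (w₁ ^ 2 + 4 * b ^ 2) = 0 := by
    linear_combination d j * hw - 4 * w ^ 2 * h.cubic j +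
      (4 * d j * (d j * w + ρ) - 8 * w ^ 2) * h0
  have hpos : 0 < w₁ ^ 2 + 4 * b ^ 2 := by positivity
  exact hpos.ne' ((mul_eq_zero.mp hzero).resolve_left (h.apply_ne_zero j))

end IsSpectrum

section GeneratingMatrix

variable {lam : ℂ} {u₀ : ℝ} {ψ₀ c : ℂ} {d : Fin 3 → ℝ}

lemma conjTranspose_matD (hlam : ‖lam‖ = 1) (u₀ : ℝ) (ψ₀ : ℂ) :
    (matD lam u₀ ψ₀)ᴴ = -matD lam u₀ ψ₀ := by
  ext i j
  fin_cases i <;> fin_cases j <;>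
    simp [matD, ← Complex.inv_eq_conj hlam, -Complex.ofReal_exp]

lemma det_scalar_sub_matD (hlam : ‖lam‖ = 1) (hc : c = (lam ^ 3)⁻¹ * ψ₀) (t : ℂ) :
    (Matrix.scalar (Fin 3) t - matD lam u₀ ψ₀).det =
      t ^ 3 + betaConst (Real.exp u₀) ‖ψ₀‖ * t - 2 * I * c.re := by
  have hlam0 : lam ≠ 0 := norm_ne_zero_iff.mp (by simp [hlam])
  have hβ : (betaConst (Real.exp u₀) ‖ψ₀‖ : ℂ) =
      2 * Real.exp u₀ + ψ₀ * conj ψ₀ / (Real.exp u₀ : ℂ) ^ 2 := by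
    rw [Complex.mul_conj', betaConst]
    push_cast
    ring
  have hre : (2 * c.re : ℂ) = (lam ^ 3)⁻¹ * ψ₀ + lam ^ 3 * conj ψ₀ := by
    have h := Complex.add_conj c
    push_cast at h
    rw [← h, hc, map_mul, map_inv₀, map_pow, ← Complex.inv_eq_conj hlam, inv_pow, inv_inv]
  have hs := ofReal_exp_ne_zero (-(u₀ / 2))
  rw [hβ, mul_right_comm, hre, ofReal_exp_eq_inv_sq u₀, Matrix.det_fin_three]
  simp only [matD, ofReal_exp_half, ofReal_exp_neg u₀, Matrix.sub_apply, Matrix.scalar_apply,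
    Matrix.diagonal_apply, Matrix.of_apply, Matrix.cons_val, Fin.isValue, Fin.reduceEq, if_true,
    if_false]
  field_simp
  linear_combination (I * (Real.exp (-(u₀ / 2)) : ℂ) ^ 2 * (ψ₀ + lam ^ 6 * conj ψ₀) -
    t * lam ^ 3 * (2 + (Real.exp (-(u₀ / 2)) : ℂ) ^ 6 * conj ψ₀ * ψ₀)) * Complex.I_sq

/-- By AM-GM, `betaConst a m` is at least `3 m ^ (2 / 3)`. -/
lemma sq_lt_betaConst_cube {a m ρ : ℝ} (ha : 0 < a) (hρ : ρ ^ 2 < m ^ 2) :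
    27 * ρ ^ 2 < betaConst a m ^ 3 := by
  rw [betaConst]
  have hm : m ^ 2 = a ^ 2 * (m ^ 2 / a ^ 2) := by field_simp
  have hb : 0 ≤ m ^ 2 / a ^ 2 := by positivity
  generalize m ^ 2 / a ^ 2 = b at hm hb
  have amgm : 0 ≤ (a - b) ^ 2 * (8 * a + b) := by positivity
  nlinarith

lemma sq_norm_eq_of_eq_inv_pow_mul (hlam : ‖lam‖ = 1) (hc : c = (lam ^ 3)⁻¹ * ψ₀) :
    ‖ψ₀‖ ^ 2 = c.re ^ 2 + c.im ^ 2 := by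
  have hnorm : ‖ψ₀‖ = ‖c‖ := by simp [hc, hlam]
  rw [hnorm, Complex.sq_norm, Complex.normSq_apply, sq, sq]

theorem isSpectrum_of_charpoly (hlam : ‖lam‖ = 1) (hc : c = (lam ^ 3)⁻¹ * ψ₀) (him : c.im ≠ 0)
    (hre : c.re ≠ 0)
    (hd : (matD lam u₀ ψ₀).charpoly = ∏ j, (Polynomial.X - Polynomial.C (I * (d j : ℂ)))) :
    IsSpectrum d (betaConst (Real.exp u₀) ‖ψ₀‖) c.re := by
  set β := betaConst (Real.exp u₀) ‖ψ₀‖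
  have hfactor (t : ℂ) : t ^ 3 + β * t - 2 * I * c.re =
      (t - I * d 0) * (t - I * d 1) * (t - I * d 2) := by
    rw [← det_scalar_sub_matD hlam hc, ← Matrix.eval_charpoly, hd, Polynomial.eval_prod,
      Fin.prod_univ_three]
    simp only [Polynomial.eval_sub, Polynomial.eval_X, Polynomial.eval_C]
  have h0 := hfactor 0
  have h1 := hfactor 1
  have h2 := hfactor (-1)
  refine ⟨?_, ?_, ?_, sq_lt_betaConst_cube (Real.exp_pos u₀) ?_, hre⟩
  · have : I * ((d 0 : ℂ) + d 1 + d 2) = 0 := by linear_combination (h1 + h2) / 2 - h0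
    exact_mod_cast (mul_eq_zero.mp this).resolve_left Complex.I_ne_zero
  · have : (d 0 : ℂ) * d 1 + d 0 * d 2 + d 1 * d 2 = -β := by
      linear_combination (h1 - h2) / 2 + (d 0 * d 1 + d 0 * d 2 + d 1 * d 2 : ℂ) * Complex.I_sq
    exact_mod_cast this
  · have : I * ((d 0 : ℂ) * d 1 * d 2) = I * (-2 * c.re) := by
      linear_combination -h0 + (I * d 0 * d 1 * d 2) * Complex.I_sq
    exact_mod_cast mul_left_cancel₀ Complex.I_ne_zero this
  · have : 0 < c.im ^ 2 := by positivity
    linarith [sq_norm_eq_of_eq_inv_pow_mul hlam hc]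

end GeneratingMatrix

section Frames

variable {f : ℂ → ℙ ℂ (Fin 3 → ℂ)} {u : ℂ → ℝ} {H : ℂ → Fin 3 → ℂ} {lam : ℂ} {ψ : ℂ → ℂ}

lemma adaptedFrame_add_const {A : Matrix (Fin 3) (Fin 3) ℂ} {t z : ℂ} (hdiff : Differentiable ℝ H)
    (hH : ∀ w, H (w + t) = A *ᵥ H w) (hu : u (z + t) = u z) :
    adaptedFrame lam u H (z + t) = A * adaptedFrame lam u H z := by
  have hZ : dZ H (z + t) = A *ᵥ dZ H z := by
    rw [← dZ_comp_add_const, funext hH, dZ_mulVec A (hdiff z)]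
  have hZbar : dZbar H (z + t) = A *ᵥ dZbar H z := by
    rw [← dZbar_comp_add_const, funext hH, dZbar_mulVec A (hdiff z)]
  have hcol (j : Fin 3) : adaptedCol lam u H j (z + t) = A *ᵥ adaptedCol lam u H j z := by
    fin_cases j
    · simp only [adaptedCol, Fin.zero_eta, Matrix.cons_val, hu, hZ, Matrix.mulVec_smul]
    · simp only [adaptedCol, Fin.mk_one, Matrix.cons_val, hu, hZbar, Matrix.mulVec_smul]
    · exact hH z
  ext i j
  exact congrFun (hcol j) i

lemma frameFormZ_zero_add_frameFormZbar_zero (hu : DifferentiableAt ℝ u 0) (hX : dX u 0 = 0)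
    (hY : dY u 0 = 0) : frameFormZ lam u ψ 0 + frameFormZbar lam u ψ 0 = matD lam (u 0) (ψ 0) := by
  rw [frameFormZ, frameFormZbar, dZ_ofReal_comp hu, dZbar_ofReal_comp hu, hX, hY]
  ext i j
  fin_cases i <;> fin_cases j <;> simp [matU, matV, matD] <;> ring

namespace IsFrame

variable {Fr : ℂ → Matrix (Fin 3) (Fin 3) ℂ}

lemma conjTranspose_mul (hFr : IsFrame f u ψ lam Fr) (z : ℂ) : (Fr z)ᴴ * Fr z = 1 :=
  Matrix.mem_unitaryGroup_iff'.mp (Matrix.mem_specialUnitaryGroup_iff.mp (hFr.special_unitary z)).1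

lemma hdot_col (hFr : IsFrame f u ψ lam Fr) (z : ℂ) (i j : Fin 3) :
    hdot (fun k => Fr z k j) (fun k => Fr z k i) = if i = j then 1 else 0 := by
  rw [← Matrix.one_apply, ← hFr.conjTranspose_mul z, Matrix.mul_apply]
  exact Finset.sum_congr rfl fun k _ => mul_comm _ _

lemma contDiff_canonicalLift (hFr : IsFrame f u ψ lam Fr) : ContDiff ℝ ∞ (canonicalLift Fr) :=
  contDiff_pi.mpr fun i => hFr.smooth i 2

lemma dZ_canonicalLift (hFr : IsFrame f u ψ lam Fr) (z : ℂ) :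
    dZ (canonicalLift Fr) z = (lam⁻¹ * (I * Real.exp (u z / 2))) • fun i => Fr z i 0 := by
  ext i
  rw [← dZ_apply (differentiable_of_smooth hFr.contDiff_canonicalLift z) i]
  refine (hFr.deriv_z z i 2).trans ?_
  simp [Matrix.mul_apply, Fin.sum_univ_three, matU, mul_comm]

lemma dZbar_canonicalLift (hFr : IsFrame f u ψ lam Fr) (z : ℂ) :
    dZbar (canonicalLift Fr) z = (lam * (I * Real.exp (u z / 2))) • fun i => Fr z i 1 := by
  ext i
  rw [← dZbar_apply (differentiable_of_smooth hFr.contDiff_canonicalLift z) i]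
  refine (hFr.deriv_zbar z i 2).trans ?_
  simp [Matrix.mul_apply, Fin.sum_univ_three, matV, mul_comm]

lemma isHorizontalLift (hFr : IsFrame f u ψ lam Fr) : IsHorizontalLift f (canonicalLift Fr) := by
  have hZ (z : ℂ) : hdot (dZ (canonicalLift Fr) z) (canonicalLift Fr z) = 0 := by
    rw [hFr.dZ_canonicalLift, hdot_smul_left]
    exact mul_eq_zero_of_right _ (hFr.hdot_col z 2 0)
  have hZbar (z : ℂ) : hdot (dZbar (canonicalLift Fr) z) (canonicalLift Fr z) = 0 := by
    rw [hFr.dZbar_canonicalLift, hdot_smul_left]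
    exact mul_eq_zero_of_right _ (hFr.hdot_col z 2 1)
  refine ⟨⟨hFr.contDiff_canonicalLift, fun z => ⟨hFr.hdot_col z 2 2, hFr.lifts z⟩⟩,
    fun z => ⟨?_, ?_⟩⟩
  · rw [dX_eq_dZ_add_dZbar, hdot_add_left, hZ, hZbar, add_zero]
  · rw [dY_eq_I_smul_dZ_sub_dZbar, hdot_smul_left, hdot_sub_left, hZ, hZbar, sub_zero, mul_zero]

lemma isConformalLift (hFr : IsFrame f u ψ lam Fr) (hlam : ‖lam‖ = 1) :
    IsConformalLift f u (canonicalLift Fr) := by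
  have hlam0 : lam ≠ 0 := norm_ne_zero_iff.mp (by simp [hlam])
  have hexp (z : ℂ) : (Real.exp (u z / 2) : ℂ) ^ 2 = Real.exp (u z) := by
    rw [ofReal_exp_half, inv_pow, ← ofReal_exp_eq_inv_sq]
  refine ⟨hFr.isHorizontalLift, fun z => ?_, fun z => ?_, fun z => ?_⟩ <;>
    simp only [dX_eq_dZ_add_dZbar, dY_eq_I_smul_dZ_sub_dZbar, hFr.dZ_canonicalLift,
      hFr.dZbar_canonicalLift, hdot_add_left, hdot_sub_left, hdot_smul_left, hdot_add_right,
      hdot_sub_right, hdot_smul_right, hFr.hdot_col, zero_ne_one, one_ne_zero, if_true, if_false,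
      map_mul, Complex.conj_I, Complex.conj_ofReal, map_inv₀,
      ← Complex.inv_eq_conj hlam, ← hexp] <;>
    field_simp
  · linear_combination -2 * lam ^ 2 * Complex.I_sq
  · linear_combination 2 * lam ^ 2 * (I ^ 2 - 1) * Complex.I_sq
  · ring

lemma eq_adaptedFrame (hFr : IsFrame f u ψ lam Fr) (hlam : ‖lam‖ = 1) (z : ℂ) :
    Fr z = adaptedFrame lam u (canonicalLift Fr) z := by
  have hlam0 : lam ≠ 0 := norm_ne_zero_iff.mp (by simp [hlam])
  have := ofReal_exp_ne_zero (-(u z / 2))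
  have hcol (j : Fin 3) :
      (fun i => Fr z i j) = adaptedCol lam u (canonicalLift Fr) j z := by
    fin_cases j
    · simp only [adaptedCol, Fin.zero_eta, Matrix.cons_val, hFr.dZ_canonicalLift,
        ofReal_exp_half]
      match_scalars
      field_simp
      rw [Complex.I_sq, neg_neg]
    · simp only [adaptedCol, Fin.mk_one, Matrix.cons_val, hFr.dZbar_canonicalLift,
        ofReal_exp_half]
      match_scalars
      field_simp
      rw [Complex.I_sq, neg_neg]
    · rfl
  ext i j
  exact congrFun (hcol j) i

lemma dX_apply_zero (hFr : IsFrame f u ψ lam Fr) (hu : DifferentiableAt ℝ u 0)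
    (hX : dX u 0 = 0) (hY : dY u 0 = 0) (i j : Fin 3) :
    dX (fun w => Fr w i j) 0 = (Fr 0 * matD lam (u 0) (ψ 0)) i j := by
  rw [dX_eq_dZ_add_dZbar, ← frameFormZ_zero_add_frameFormZbar_zero hu hX hY, Matrix.mul_add]
  exact congrArg₂ (· + ·) (hFr.deriv_z 0 i j) (hFr.deriv_zbar 0 i j)

lemma canonicalLift_add_ofReal (hFr : IsFrame f u ψ lam Fr) (hlam : ‖lam‖ = 1)
    (hequiv : IsTranslationallyEquivariant f) (z : ℂ) (t : ℝ) :
    canonicalLift Fr (z + t) = Fr t *ᵥ ((Fr 0)ᴴ *ᵥ canonicalLift Fr z) := by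
  obtain ⟨U, -, hU⟩ := hFr.isHorizontalLift.exists_unitary_add_ofReal hequiv t
  have hFrU : Fr t = U * Fr 0 := by
    have h := adaptedFrame_add_const (lam := lam)
      (differentiable_of_smooth hFr.contDiff_canonicalLift) hU
      ((hFr.isConformalLift hlam).u_add_ofReal hequiv 0 t)
    rwa [← hFr.eq_adaptedFrame hlam, ← hFr.eq_adaptedFrame hlam, zero_add] at h
  rw [hU, hFrU, ← Matrix.mulVec_mulVec, Matrix.mulVec_mulVec _ (Fr 0),
    mul_eq_one_comm.mp (hFr.conjTranspose_mul 0), Matrix.one_mulVec]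

lemma dX_canonicalLift (hFr : IsFrame f u ψ lam Fr) (hlam : ‖lam‖ = 1)
    (hequiv : IsTranslationallyEquivariant f) (hY : dY u 0 = 0) (z : ℂ) :
    dX (canonicalLift Fr) z =
      Fr 0 *ᵥ (matD lam (u 0) (ψ 0) *ᵥ ((Fr 0)ᴴ *ᵥ canonicalLift Fr z)) := by
  have hlift : HasDerivAt (fun t : ℝ => canonicalLift Fr (z + t)) (dX (canonicalLift Fr) z) 0 := by
    simpa using hasDerivAt_add_ofReal (z := z) (x := 0)
      (differentiable_of_smooth hFr.contDiff_canonicalLift _)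
  refine hlift.unique (hasDerivAt_pi.mpr fun i => ?_)
  simp only [hFr.canonicalLift_add_ofReal hlam hequiv]
  rw [Matrix.mulVec_mulVec]
  change HasDerivAt (fun t : ℝ => ∑ j, Fr t i j * _) (∑ j, (Fr 0 * matD lam (u 0) (ψ 0)) i j * _) 0
  refine HasDerivAt.fun_sum fun j _ => HasDerivAt.mul_const ?_ _
  have hH := hFr.isConformalLift hlam
  rw [← hFr.dX_apply_zero (hH.differentiable_u 0) (hH.dX_u hequiv 0) hY]
  simpa using hasDerivAt_add_ofReal (z := 0) (x := 0)
    (differentiable_of_smooth (hFr.smooth i j) _)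

lemma hdot_dX_canonicalLift_of_eigenvector (hFr : IsFrame f u ψ lam Fr) (hlam : ‖lam‖ = 1)
    (hequiv : IsTranslationallyEquivariant f) (hY : dY u 0 = 0) {s : ℝ} {v : Fin 3 → ℂ}
    (hv : matD lam (u 0) (ψ 0) *ᵥ v = (I * s) • v) (z : ℂ) :
    hdot (dX (canonicalLift Fr) z) (Fr 0 *ᵥ v) = I * s * hdot (canonicalLift Fr z) (Fr 0 *ᵥ v) := by
  rw [hFr.dX_canonicalLift hlam hequiv hY,
    hdot_mulVec_mulVec (hFr.conjTranspose_mul 0), hdot_mulVec_left, conjTranspose_matD hlam,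
    Matrix.neg_mulVec, hv, hdot_mulVec_left, Matrix.conjTranspose_conjTranspose,
    Matrix.mulVec_neg, Matrix.mulVec_smul, hdot_neg_right, hdot_smul_right]
  simp

end IsFrame

end Frames

section OrthonormalBasis

variable {m : Fin 3 → Fin 3 → ℂ}

lemma eq_sum_of_orthonormal (hm : ∀ j k, hdot (m j) (m k) = if j = k then 1 else 0)
    (v : Fin 3 → ℂ) : v = ∑ j, hdot v (m j) • m j := by
  refine ext_of_orthogonal (b := m) (fun j h0 => ?_) (fun i j hij => by rw [hm, if_neg hij])
    fun k => ?_
  · simpa [h0, hdot] using hm j j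
  · rw [hdot_sum_left]
    simp_rw [hdot_smul_left, hm]
    simp

lemma hdot_eq_sum_of_orthonormal (hm : ∀ j k, hdot (m j) (m k) = if j = k then 1 else 0)
    (v w : Fin 3 → ℂ) : hdot v w = ∑ j, hdot v (m j) * conj (hdot w (m j)) := by
  conv_lhs => rw [eq_sum_of_orthonormal hm v, hdot_sum_left]
  exact Finset.sum_congr rfl fun j _ => by rw [hdot_smul_left, conj_hdot]

variable {D : Matrix (Fin 3) (Fin 3) ℂ}

lemma exists_unit_eigenvector {s : ℂ} (hs : D.charpoly.IsRoot s) :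
    ∃ v, hdot v v = 1 ∧ D *ᵥ v = s • v := by
  have hdet : (Matrix.scalar (Fin 3) s - D).det = 0 := by rwa [← Matrix.eval_charpoly]
  obtain ⟨v, hv, hDv⟩ := Matrix.exists_mulVec_eq_zero_iff.mpr hdet
  rw [Matrix.sub_mulVec, sub_eq_zero, Matrix.scalar_apply, ← Matrix.smul_one_eq_diagonal,
    Matrix.smul_mulVec, Matrix.one_mulVec] at hDv
  have hvv : hdot v v = ((hdot v v).re : ℂ) := Complex.ext rfl (hdot_self_im v)
  have hpos : 0 < (hdot v v).re := by
    refine (hdot_self_re_nonneg v).lt_of_ne' fun h => hv (hdot_self_eq_zero ?_)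
    rw [hvv, h, Complex.ofReal_zero]
  refine ⟨((√(hdot v v).re)⁻¹ : ℝ) • v, ?_, ?_⟩
  · rw [← Complex.coe_smul, hdot_smul_left, hdot_smul_right, Complex.conj_ofReal]
    conv_lhs => rw [hvv]
    norm_cast
    have := (Real.sqrt_pos.mpr hpos).ne'
    field_simp
    rw [Real.sq_sqrt hpos.le]
  · rw [Matrix.mulVec_smul, ← hDv, smul_comm]

lemma hdot_eq_zero_of_eigenvectors (hD : Dᴴ = -D) {s t : ℝ} {v w : Fin 3 → ℂ} (hst : s ≠ t)
    (hv : D *ᵥ v = (I * s) • v) (hw : D *ᵥ w = (I * t) • w) : hdot v w = 0 := by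
  have h := hdot_mulVec_left D v w
  rw [hD, Matrix.neg_mulVec, hv, hw, hdot_neg_right, hdot_smul_left, hdot_smul_right, map_mul,
    Complex.conj_I, Complex.conj_ofReal] at h
  have hzero : I * (s - t) * hdot v w = 0 := by linear_combination h
  refine (mul_eq_zero.mp hzero).resolve_left (mul_ne_zero Complex.I_ne_zero ?_)
  exact_mod_cast sub_ne_zero.mpr hst

lemma exists_orthonormal_eigenvectors (hD : Dᴴ = -D) {d : Fin 3 → ℝ} (hinj : Function.Injective d)
    (hd : D.charpoly = ∏ j, (Polynomial.X - Polynomial.C (I * (d j : ℂ)))) :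
    ∃ l : Fin 3 → Fin 3 → ℂ, (∀ j k, hdot (l j) (l k) = if j = k then 1 else 0) ∧
      ∀ j, D *ᵥ l j = (I * (d j : ℂ)) • l j := by
  have hroot (j : Fin 3) : D.charpoly.IsRoot (I * (d j : ℂ)) := by
    rw [hd, Polynomial.IsRoot, Polynomial.eval_prod]
    exact Finset.prod_eq_zero (Finset.mem_univ j) (by simp)
  choose l hunit heigen using fun j => exists_unit_eigenvector (hroot j)
  refine ⟨l, fun j k => ?_, heigen⟩
  split_ifs with hjk
  · exact hjk ▸ hunit j
  · exact hdot_eq_zero_of_eigenvectors hD (hinj.ne hjk) (heigen j) (heigen k)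

end OrthonormalBasis

section Coordinates

variable {f : ℂ → ℙ ℂ (Fin 3 → ℂ)} {u : ℂ → ℝ} {F : ℂ → Fin 3 → ℂ} {c : ℂ} {d : Fin 3 → ℝ}
  {β : ℝ} {m : Fin 3 → Fin 3 → ℂ} {z : ℂ}

lemma hdot_dY_dX_dX (hH : IsConformalLift f u F) (hmin : HasZeroMeanCurvature f)
    (hφ : hopfCoeff F z = -I * c) (hx : dX u z = 0) :
    hdot (dY F z) (dX (dX F) z) = -((Real.exp (u z) * dY u z : ℝ) + 2 * I * c.im : ℂ) := by
  have hXX : dX (dX F) z = dZ (dZ F) z + (2 : ℂ) • dZbar (dZ F) z + dZbar (dZbar F) z := by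
    rw [funext (dX_eq_dZ_add_dZbar F), dX, fderiv_fun_add (hH.differentiable_dZ z)
      (hH.differentiable_dZbar z), add_apply, ← dX, ← dX, dX_eq_dZ_add_dZbar,
      dX_eq_dZ_add_dZbar, dZ_dZbar hH.contDiff]
    module
  have hsub : c - conj c = 2 * I * c.im := by rw [Complex.sub_conj]; push_cast; ring
  have := ofReal_exp_ne_zero (u z)
  rw [hXX, hH.dZbar_dZ hmin, hH.dZ_dZ hmin, hH.dZbar_dZbar hmin, hφ, dY_eq_I_smul_dZ_sub_dZbar,
    dZ_ofReal_comp (hH.differentiable_u z), dZbar_ofReal_comp (hH.differentiable_u z), hx]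
  simp only [hdot_smul_left, hdot_sub_left, hdot_add_right, hdot_sub_right, hdot_smul_right,
    hH.hdot_dZ_dZ, hH.hdot_dZ_dZbar, hH.hdot_dZbar_dZ, hH.hdot_dZbar_dZbar,
    hH.hdot_dZ_self, hH.hdot_dZbar_self, map_mul, map_neg, map_div₀, map_sub, map_add, map_inv₀,
    Complex.conj_I, Complex.conj_ofReal, Complex.conj_conj, Complex.conj_ofNat,
    Complex.ofReal_zero, Complex.ofReal_mul]
  rw [← hsub]
  field_simp
  ring_nf
  simp only [Complex.I_sq]
  ring

lemma hdot_dX_dX_of_hdot_dX (hF : ContDiff ℝ ∞ F) {s : ℂ} {v : Fin 3 → ℂ}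
    (hX : ∀ z, hdot (dX F z) v = s * hdot (F z) v) (z : ℂ) :
    hdot (dX (dX F) z) v = s ^ 2 * hdot (F z) v := by
  have hdX (G : ℂ → Fin 3 → ℂ) (hG : ContDiff ℝ ∞ G) :
      dX (fun w => hdot (G w) v) z = hdot (dX G z) v := by
    rw [dX_hdot (differentiable_of_smooth hG z) (differentiableAt_const v), dX_const]
    simp [hdot]
  rw [← hdX _ (contDiff_dX hF), funext hX]
  refine (dX_const_smul s (differentiable_of_smooth (contDiff_hdot hF contDiff_const) z)).trans ?_
  rw [hdX F hF, hX, smul_eq_mul]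
  ring

variable (hH : IsConformalLift f u F) (hm : ∀ j k, hdot (m j) (m k) = if j = k then 1 else 0)
  (hX : ∀ z j, hdot (dX F z) (m j) = I * d j * hdot (F z) (m j)) (hsp : IsSpectrum d β c.re)

include hH hm hX hsp

/-- Solves the Vandermonde system that expresses `F · F̄ = 1`, `F_x · F̄ = 0` and
`F_x · F̄_x = 2 e^u` in the squared moduli of the coordinates of `F`. -/
lemma coord_mul_conj (z : ℂ) (j : Fin 3) :
    hdot (F z) (m j) * conj (hdot (F z) (m j)) * (d j ^ 3 - c.re) =
      d j * (Real.exp (u z) : ℂ) - c.re := by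
  have h0 : ∑ j, hdot (F z) (m j) * conj (hdot (F z) (m j)) = 1 := by
    rw [← hdot_eq_sum_of_orthonormal hm, hH.hdot_self]
  have h1 : ∑ j, (d j : ℂ) * (hdot (F z) (m j) * conj (hdot (F z) (m j))) = 0 := by
    refine (mul_eq_zero.mp ?_).resolve_left Complex.I_ne_zero
    rw [← (hH.lift.2 z).1, hdot_eq_sum_of_orthonormal hm, Finset.mul_sum]
    exact Finset.sum_congr rfl fun j _ => by rw [hX]; ring
  have h2 : ∑ j, (d j : ℂ) ^ 2 * (hdot (F z) (m j) * conj (hdot (F z) (m j))) =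
      2 * (Real.exp (u z) : ℂ) := by
    rw [← hH.xx, hdot_eq_sum_of_orthonormal hm]
    refine Finset.sum_congr rfl fun j _ => ?_
    rw [hX, map_mul, map_mul, Complex.conj_I, Complex.conj_ofReal]
    linear_combination
      ((d j : ℂ) ^ 2 * (hdot (F z) (m j) * conj (hdot (F z) (m j)))) * Complex.I_sq
  have hq : (d j : ℂ) * (3 * d j ^ 2 - β) = 2 * (d j ^ 3 - c.re) := by
    exact_mod_cast hsp.mul_derivative_eq j
  have hcubic : (d j : ℂ) ^ 3 - β * d j + 2 * c.re = 0 := by exact_mod_cast hsp.cubic j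
  linear_combination (d j / 2 : ℂ) * hsp.vandermonde_solution h0 h1 h2 j
    - (hdot (F z) (m j) * conj (hdot (F z) (m j)) / 2) * hq + hcubic / 2

lemma dY_coord_mul_conj (hmin : HasZeroMeanCurvature f) (hφ : hopfCoeff F z = -I * c)
    (hx : dX u z = 0) (j : Fin 3) :
    hdot (dY F z) (m j) * conj (hdot (F z) (m j)) * (2 * (d j ^ 3 - c.re)) =
      d j * ((Real.exp (u z) * dY u z : ℝ) + 2 * I * c.im) := by
  have hXX (j : Fin 3) := hdot_dX_dX_of_hdot_dX hH.contDiff (fun z => hX z j) z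
  have h0 : ∑ j, hdot (dY F z) (m j) * conj (hdot (F z) (m j)) = 0 := by
    rw [← hdot_eq_sum_of_orthonormal hm, (hH.lift.2 z).2]
  have h1 : ∑ j, (d j : ℂ) * (hdot (dY F z) (m j) * conj (hdot (F z) (m j))) = 0 := by
    refine (mul_eq_zero.mp ?_).resolve_left (neg_ne_zero.mpr Complex.I_ne_zero)
    rw [← hdot_eq_zero_comm (hH.xy z), hdot_eq_sum_of_orthonormal hm, Finset.mul_sum]
    refine Finset.sum_congr rfl fun j _ => ?_
    rw [hX, map_mul, map_mul, Complex.conj_I, Complex.conj_ofReal]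
    ring
  have h2 : ∑ j, (d j : ℂ) ^ 2 * (hdot (dY F z) (m j) * conj (hdot (F z) (m j))) =
      (Real.exp (u z) * dY u z : ℝ) + 2 * I * c.im := by
    rw [← neg_inj, ← hdot_dY_dX_dX hH hmin hφ hx, hdot_eq_sum_of_orthonormal hm,
      ← Finset.sum_neg_distrib]
    refine Finset.sum_congr rfl fun j _ => ?_
    rw [hXX, mul_pow, Complex.I_sq, map_mul, map_mul, map_neg, map_one, map_pow,
      Complex.conj_ofReal]
    ring
  have hq : (d j : ℂ) * (3 * d j ^ 2 - β) = 2 * (d j ^ 3 - c.re) := by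
    exact_mod_cast hsp.mul_derivative_eq j
  linear_combination (d j : ℂ) * hsp.vandermonde_solution h0 h1 h2 j
    - (hdot (dY F z) (m j) * conj (hdot (F z) (m j))) * hq

lemma dY_coord (hmin : HasZeroMeanCurvature f) (hφ : hopfCoeff F z = -I * c) (hx : dX u z = 0)
    {j : Fin 3} (hne : d j * Real.exp (u z) - c.re ≠ 0) :
    hdot (dY F z) (m j) = hdot (F z) (m j) *
      (d j * ((Real.exp (u z) * dY u z : ℝ) + 2 * I * c.im) /
        (2 * (d j * Real.exp (u z) - c.re : ℝ))) := by
  have hcoord := coord_mul_conj hH hm hX hsp z j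
  have hdY := dY_coord_mul_conj hH hm hX hsp hmin hφ hx j
  have hne' : (d j * (Real.exp (u z) : ℂ) - c.re) ≠ 0 := by exact_mod_cast hne
  have hden : ((d j * Real.exp (u z) - c.re : ℝ) : ℂ) = d j * (Real.exp (u z) : ℂ) - c.re := by
    push_cast; rfl
  rw [hden, mul_div_assoc', eq_div_iff (mul_ne_zero two_ne_zero hne'), ← hcoord]
  linear_combination hdot (F z) (m j) * hdY

end Coordinates

section PolarForm

variable {w : ℝ → ℝ} {c : ℂ} {d w' y : ℝ}

lemma hasDerivAt_gFun (hw : Continuous w) (hne : ∀ y, d * w y - c.re ≠ 0) (y : ℝ) :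
    HasDerivAt (gFun w c d) (d * c.im / (d * w y - c.re)) y :=
  ((continuous_const.div ((continuous_const.mul hw).sub continuous_const)
    hne).integral_hasStrictDerivAt 0 y).hasDerivAt

lemma hasDerivAt_hFun (hw : HasDerivAt w w' y) (hpos : 0 < (d * w y - c.re) / (d ^ 3 - c.re)) :
    HasDerivAt (hFun w c d) (hFun w c d y * (d * w' / (2 * (d * w y - c.re)))) y := by
  have hsqrt := (((hw.const_mul d).sub_const c.re).div_const (d ^ 3 - c.re)).sqrt hpos.ne'
  refine hsqrt.congr_deriv ?_
  obtain ⟨hnum, hden⟩ := not_or.mp (mt div_eq_zero_iff.mpr hpos.ne')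
  have hsq := Real.mul_self_sqrt hpos.le
  have := (Real.sqrt_pos.mpr hpos).ne'
  rw [eq_div_iff hden] at hsq
  rw [hFun]
  field_simp
  linear_combination -(d * w') * hsq

/-- The function `h e^{iG}`: up to a constant phase, the coordinate of the canonical lift along an
eigenvector of the generating matrix with eigenvalue `i d`, restricted to the imaginary axis. -/
def hgFun (w : ℝ → ℝ) (c : ℂ) (d y : ℝ) : ℂ :=
  (hFun w c d y : ℂ) * Complex.exp (I * gFun w c d y)

lemma hgFun_ne_zero (hpos : 0 < (d * w y - c.re) / (d ^ 3 - c.re)) : hgFun w c d y ≠ 0 :=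
  mul_ne_zero (by exact_mod_cast (Real.sqrt_pos.mpr hpos).ne') (Complex.exp_ne_zero _)

lemma norm_hgFun : ‖hgFun w c d y‖ = √((d * w y - c.re) / (d ^ 3 - c.re)) := by
  rw [hgFun, norm_mul, Complex.norm_real, mul_comm I, Complex.norm_exp_ofReal_mul_I, mul_one, hFun,
    Real.norm_of_nonneg (Real.sqrt_nonneg _)]

lemma hasDerivAt_hgFun {w₁ : ℝ → ℝ} (hw : ∀ y, HasDerivAt w (w₁ y) y)
    (hpos : ∀ y, 0 < (d * w y - c.re) / (d ^ 3 - c.re)) (y : ℝ) :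
    HasDerivAt (hgFun w c d) (hgFun w c d y *
      (d * ((w₁ y : ℝ) + 2 * I * c.im) / (2 * (d * w y - c.re : ℝ)))) y := by
  have hcont : Continuous w := continuous_iff_continuousAt.mpr fun y => (hw y).continuousAt
  have hne (y : ℝ) : d * w y - c.re ≠ 0 := fun h0 => by simpa [h0] using hpos y
  have hh := (hasDerivAt_hFun (hw y) (hpos y)).ofReal_comp
  have hg := ((hasDerivAt_gFun hcont hne y).ofReal_comp.const_mul I).cexp
  refine (hh.mul hg).congr_deriv ?_
  have hden : ((d * w y - c.re : ℝ) : ℂ) ≠ 0 := by exact_mod_cast hne y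
  rw [hgFun]
  push_cast at hden ⊢
  field_simp

lemma eq_div_mul_of_hasDerivAt_mul {p q r : ℝ → ℂ} (hp : ∀ y, HasDerivAt p (p y * r y) y)
    (hq : ∀ y, HasDerivAt q (q y * r y) y) (hne : ∀ y, q y ≠ 0) (y : ℝ) :
    p y = p 0 / q 0 * q y := by
  have hquot (y : ℝ) : HasDerivAt (fun y => p y / q y) 0 y :=
    ((hp y).div (hq y) (hne y)).congr_deriv (by ring)
  rw [← div_eq_iff (hne y)]
  exact is_const_of_deriv_eq_zero (fun y => (hquot y).differentiableAt) (fun y => (hquot y).deriv)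
    y 0

lemma apply_add_ofReal_of_dX_eq_mul {P : ℂ → ℂ} (hP : Differentiable ℝ P) {a : ℂ}
    (hX : ∀ z, dX P z = a * P z) (z : ℂ) (x : ℝ) : P (z + x) = P z * Complex.exp (a * x) := by
  have hexp (x : ℝ) : HasDerivAt (fun x : ℝ => Complex.exp (a * x)) (Complex.exp (a * x) * a) x :=
    ((hasDerivAt_id x).ofReal_comp.const_mul a).cexp.congr_deriv (by simp)
  have h := eq_div_mul_of_hasDerivAt_mul (r := fun _ => a)
    (fun x => (hasDerivAt_add_ofReal (hP (z + x))).congr_deriv (by rw [hX, mul_comm]))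
    hexp (fun _ => Complex.exp_ne_zero _) x
  simpa using h

end PolarForm

/-- The conformal factor `e^u` along the imaginary axis, which determines the metric of a
translationally equivariant surface. -/
def profile (u : ℂ → ℝ) (y : ℝ) : ℝ := Real.exp (u (y * I))

lemma profile_zero (u : ℂ → ℝ) : profile u 0 = Real.exp (u 0) := by simp [profile]

lemma IsConformalLift.hopfCoeff_eq_of_hasHopfDifferential {f : ℂ → ℙ ℂ (Fin 3 → ℂ)} {u : ℂ → ℝ}
    {H : ℂ → Fin 3 → ℂ} {φ : ℂ → ℂ} (hH : IsConformalLift f u H) (hmin : HasZeroMeanCurvature f)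
    (hequiv : IsTranslationallyEquivariant f) (hHopf : HasHopfDifferential f φ) (z : ℂ) :
    hopfCoeff H z = φ 0 :=
  (hH.hopfCoeff_eq hmin hequiv z 0).trans (hHopf H hH.lift 0)

section CanonicalLiftFormula

variable {f : ℂ → ℙ ℂ (Fin 3 → ℂ)} {u : ℂ → ℝ} {F : ℂ → Fin 3 → ℂ} {c : ℂ} {d : Fin 3 → ℝ}
  {β : ℝ} {m : Fin 3 → Fin 3 → ℂ}

lemma dX_hdot_const (hF : Differentiable ℝ F) (v : Fin 3 → ℂ) (z : ℂ) :
    dX (fun z => hdot (F z) v) z = hdot (dX F z) v := by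
  rw [dX_hdot (hF z) (differentiableAt_const v), dX_const]
  simp [hdot]

lemma dY_hdot_const (hF : Differentiable ℝ F) (v : Fin 3 → ℂ) (z : ℂ) :
    dY (fun z => hdot (F z) v) z = hdot (dY F z) v := by
  rw [dY_hdot (hF z) (differentiableAt_const v), dY_const]
  simp [hdot]

section Coordinates

variable (hH : IsConformalLift f u F) (hm : ∀ j k, hdot (m j) (m k) = if j = k then 1 else 0)
  (hX : ∀ z j, hdot (dX F z) (m j) = I * d j * hdot (F z) (m j)) (hsp : IsSpectrum d β c.re)

include hH hm hX hsp

lemma radicand_eq_norm_coord_sq (j : Fin 3) (y : ℝ) :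
    (d j * profile u y - c.re) / (d j ^ 3 - c.re) = ‖hdot (F (y * I)) (m j)‖ ^ 2 := by
  rw [div_eq_iff (hsp.cube_sub_ne_zero j)]
  have h := coord_mul_conj hH hm hX hsp (y * I) j
  rw [Complex.mul_conj, Complex.normSq_eq_norm_sq] at h
  exact_mod_cast h.symm

variable (hne : ∀ j y, d j * profile u y - c.re ≠ 0)

include hne

lemma radicand_pos (j : Fin 3) (y : ℝ) : 0 < (d j * profile u y - c.re) / (d j ^ 3 - c.re) := by
  refine lt_of_le_of_ne' ?_ (div_ne_zero (hne j y) (hsp.cube_sub_ne_zero j))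
  rw [radicand_eq_norm_coord_sq hH hm hX hsp]
  positivity

lemma norm_coord_zero_div_hgFun (j : Fin 3) :
    ‖hdot (F 0) (m j) / hgFun (profile u) c (d j) 0‖ = 1 := by
  have hpos := radicand_pos hH hm hX hsp hne j 0
  have hsq := radicand_eq_norm_coord_sq hH hm hX hsp j 0
  rw [Complex.ofReal_zero, zero_mul] at hsq
  rw [norm_div, div_eq_one_iff_eq (norm_ne_zero_iff.mpr (hgFun_ne_zero hpos)), norm_hgFun, hsq,
    Real.sqrt_sq (norm_nonneg _)]

lemma coord_eq_mul_hgFun_mul_exp (hmin : HasZeroMeanCurvature f)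
    (hφ : ∀ z, hopfCoeff F z = -I * c) (hx : ∀ z, dX u z = 0) (j : Fin 3) (x y : ℝ) :
    hdot (F (x + y * I)) (m j) = hdot (F 0) (m j) / hgFun (profile u) c (d j) 0 *
      hgFun (profile u) c (d j) y * Complex.exp (I * d j * x) := by
  have hpos := radicand_pos hH hm hX hsp hne j
  have hP : Differentiable ℝ fun z => hdot (F z) (m j) :=
    differentiable_of_smooth (contDiff_hdot hH.contDiff contDiff_const)
  have hdY (y : ℝ) : HasDerivAt (fun y : ℝ => hdot (F (y * I)) (m j)) (hdot (F (y * I)) (m j) *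
      (d j * ((profile u y * dY u (y * I) : ℝ) + 2 * I * c.im) /
        (2 * (d j * profile u y - c.re : ℝ)))) y := by
    refine (hasDerivAt_ofReal_mul_I (hP (y * I))).congr_deriv ?_
    rw [dY_hdot_const hH.differentiable]
    exact dY_coord hH hm hX hsp hmin (hφ _) (hx _) (hne j y)
  have haxis := eq_div_mul_of_hasDerivAt_mul hdY
    (hasDerivAt_hgFun (hasDerivAt_exp_comp_mul_I hH.differentiable_u) hpos)
    (fun y => hgFun_ne_zero (hpos y)) y
  rw [Complex.ofReal_zero, zero_mul] at haxis
  rw [← haxis, add_comm]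
  exact apply_add_ofReal_of_dX_eq_mul hP
    (fun z => (dX_hdot_const hH.differentiable (m j) z).trans (hX z j)) (y * I) x

end Coordinates

variable {ψ : ℂ → ℂ} {lam : ℂ} {Fr : ℂ → Matrix (Fin 3) (Fin 3) ℂ}

lemma orthonormal_mulVec {A : Matrix (Fin 3) (Fin 3) ℂ} (hA : Aᴴ * A = 1)
    (hm : ∀ j k, hdot (m j) (m k) = if j = k then 1 else 0) (j k : Fin 3) :
    hdot (A *ᵥ m j) (A *ᵥ m k) = if j = k then 1 else 0 := by
  rw [hdot_mulVec_mulVec hA, hm]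

lemma orthonormal_smul {κ : Fin 3 → ℂ} (hκ : ∀ j, ‖κ j‖ = 1)
    (hm : ∀ j k, hdot (m j) (m k) = if j = k then 1 else 0) (j k : Fin 3) :
    hdot (κ j • m j) (κ k • m k) = if j = k then 1 else 0 := by
  split_ifs with hjk
  · rw [← hjk, hdot_smul_smul (hκ j), hm, if_pos rfl]
  · rw [hdot_smul_left, hdot_smul_right, hm, if_neg hjk, mul_zero, mul_zero]

namespace IsFrame

variable (hFr : IsFrame f u ψ lam Fr) (hlam : ‖lam‖ = 1) (hequiv : IsTranslationallyEquivariant f)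
  (hY : dY u 0 = 0) (hsp : IsSpectrum d β c.re)
  (hd : (matD lam (u 0) (ψ 0)).charpoly = ∏ j, (Polynomial.X - Polynomial.C (I * (d j : ℂ))))
  (hne : ∀ j y, d j * profile u y - c.re ≠ 0)

include hFr hlam hequiv hY hsp hd hne

theorem radicand_pos (j : Fin 3) (y : ℝ) :
    0 < (d j * profile u y - c.re) / (d j ^ 3 - c.re) := by
  obtain ⟨l, hl, heigen⟩ :=
    exists_orthonormal_eigenvectors (conjTranspose_matD hlam _ _) hsp.injective hd
  exact MinLag.radicand_pos (hFr.isConformalLift hlam)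
    (orthonormal_mulVec (hFr.conjTranspose_mul 0) hl)
    (fun z j => hFr.hdot_dX_canonicalLift_of_eigenvector hlam hequiv hY (heigen j) z) hsp hne j y

theorem exists_eigenbasis_canonicalLift_eq (hmin : HasZeroMeanCurvature f)
    (hφ : ∀ z, hopfCoeff (canonicalLift Fr) z = -I * c) :
    ∃ l : Fin 3 → Fin 3 → ℂ, (∀ j k, hdot (l j) (l k) = if j = k then 1 else 0) ∧
      (∀ j, matD lam (u 0) (ψ 0) *ᵥ l j = (I * (d j : ℂ)) • l j) ∧
      ∀ x y : ℝ, canonicalLift Fr (x + y * I) =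
        Fr 0 *ᵥ ∑ j, ((hFun (profile u) c (d j) y : ℂ) *
          Complex.exp (I * (d j * x) + I * gFun (profile u) c (d j) y)) • l j := by
  have hH := hFr.isConformalLift hlam
  obtain ⟨l, hl, heigen⟩ :=
    exists_orthonormal_eigenvectors (conjTranspose_matD hlam _ _) hsp.injective hd
  have hm := orthonormal_mulVec (hFr.conjTranspose_mul 0) hl
  have hX (z : ℂ) (j : Fin 3) :=
    hFr.hdot_dX_canonicalLift_of_eigenvector hlam hequiv hY (heigen j) z
  refine ⟨fun j => (hdot (canonicalLift Fr 0) (Fr 0 *ᵥ l j) / hgFun (profile u) c (d j) 0) • l j,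
    orthonormal_smul (norm_coord_zero_div_hgFun hH hm hX hsp hne) hl,
    fun j => by rw [Matrix.mulVec_smul, heigen, smul_comm], fun x y => ?_⟩
  rw [eq_sum_of_orthonormal hm (canonicalLift Fr (x + y * I)), Matrix.mulVec_sum]
  refine Finset.sum_congr rfl fun j _ => ?_
  rw [coord_eq_mul_hgFun_mul_exp hH hm hX hsp hne hmin hφ (hH.dX_u hequiv), hgFun.eq_def _ _ _ y,
    Matrix.mulVec_smul, Matrix.mulVec_smul, smul_smul, Complex.exp_add, mul_assoc I]
  congr 1
  ring

end IsFrame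

end CanonicalLiftFormula

lemma lipschitzWith_linear_second_order (k : ℝ) :
    LipschitzWith (max 1 ‖k‖₊) fun x : ℝ × ℝ => (x.2, k * x.1) :=
  (LipschitzWith.prod_snd.prodMk ((lipschitzWith_smul k).comp LipschitzWith.prod_fst)).weaken
    (by rw [mul_one])

lemma eq_zero_of_linear_second_order {e e₁ k : ℝ → ℝ} (hk : Continuous k)
    (he : ∀ t, HasDerivAt e (e₁ t) t) (he₁ : ∀ t, HasDerivAt e₁ (k t * e t) t) (h0 : e 0 = 0)
    (h0' : e₁ 0 = 0) (t : ℝ) : e t = 0 := by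
  obtain ⟨M, hM⟩ := (isCompact_Icc (a := -(|t| + 1)) (b := |t| + 1)).exists_bound_of_continuousOn
    hk.continuousOn
  have hlip (s : ℝ) (hs : s ∈ Set.Ioo (-(|t| + 1)) (|t| + 1)) :
      LipschitzOnWith (max 1 M.toNNReal) (fun x : ℝ × ℝ => (x.2, k s * x.1)) Set.univ :=
    ((lipschitzWith_linear_second_order (k s)).weaken <| max_le_max le_rfl <| by
      rw [← norm_toNNReal]
      exact Real.toNNReal_mono (hM s (Set.Ioo_subset_Icc_self hs))).lipschitzOnWith
  have hzero (s : ℝ) : HasDerivAt (fun _ => ((0, 0) : ℝ × ℝ)) (0, k s * 0) s := by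
    rw [mul_zero]
    exact hasDerivAt_const s _
  have heq := ODE_solution_unique_of_mem_Ioo (v := fun s x => (x.2, k s * x.1))
    (f := fun s => (e s, e₁ s)) (g := fun _ => (0, 0)) (t₀ := 0) hlip
    (by constructor <;> linarith [abs_nonneg t]) (fun s _ => ⟨(he s).prodMk (he₁ s), trivial⟩)
    (fun s _ => ⟨hzero s, trivial⟩) (by rw [h0, h0'])
  exact congrArg Prod.fst <| heq <| by constructor <;> linarith [neg_abs_le t, le_abs_self t]

lemma apply_add_int_mul_of_periodic_hasDerivAt {g g' : ℝ → ℝ} {p : ℝ}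
    (hg : ∀ y, HasDerivAt g (g' y) y) (hp : Function.Periodic g' p) (h0 : g 0 = 0) (y : ℝ) (n : ℤ) :
    g (y + n * p) = g y + n * g p := by
  have hadd (y : ℝ) : g (y + p) = g y + g p := by
    have hd (y : ℝ) : HasDerivAt (fun y => g (y + p) - g y) 0 y :=
      (((hg (y + p)).comp_add_const y p).sub (hg y)).congr_deriv (by rw [hp, sub_self])
    have h := is_const_of_deriv_eq_zero (fun y => (hd y).differentiableAt)
      (fun y => (hd y).deriv) y 0
    simp only [zero_add, h0, sub_zero] at h
    linarith
  have h := AddConstMapClass.map_add_zsmul (⟨g, hadd⟩ : AddConstMap ℝ ℝ p (g p)) y n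
  rwa [zsmul_eq_mul, zsmul_eq_mul] at h

section Elliptic

/-- The incomplete elliptic integral of the first kind, as a function of `q = k²` and of the
amplitude `θ`. -/
def ellipticF (q θ : ℝ) : ℝ := ∫ s in (0 : ℝ)..θ, 1 / √(1 - q * Real.sin s ^ 2)

variable {q : ℝ}

lemma ellipticF_zero (q : ℝ) : ellipticF q 0 = 0 := intervalIntegral.integral_same

variable (hq : q < 1)

include hq

lemma one_sub_mul_sin_sq_pos (θ : ℝ) : 0 < 1 - q * Real.sin θ ^ 2 := by
  rcases le_total q 0 with h | h <;> nlinarith [Real.sin_sq_le_one θ, sq_nonneg (Real.sin θ)]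

lemma hasDerivAt_ellipticF (θ : ℝ) :
    HasDerivAt (ellipticF q) (1 / √(1 - q * Real.sin θ ^ 2)) θ := by
  have hcont : Continuous fun s : ℝ => 1 / √(1 - q * Real.sin s ^ 2) :=
    continuous_const.div (by fun_prop) fun s =>
      (Real.sqrt_pos.mpr (one_sub_mul_sin_sq_pos hq s)).ne'
  exact (hcont.integral_hasStrictDerivAt 0 θ).hasDerivAt

lemma continuous_ellipticF : Continuous (ellipticF q) :=
  continuous_iff_continuousAt.mpr fun θ => (hasDerivAt_ellipticF hq θ).continuousAt

lemma strictMono_ellipticF : StrictMono (ellipticF q) := strictMono_of_deriv_pos fun θ => by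
  rw [(hasDerivAt_ellipticF hq θ).deriv]
  exact one_div_pos.mpr (Real.sqrt_pos.mpr (one_sub_mul_sin_sq_pos hq θ))

lemma ellipticK_pos : 0 < ellipticK q := by
  have h := strictMono_ellipticF hq Real.pi_div_two_pos
  rwa [ellipticF_zero] at h

lemma ellipticF_pi : ellipticF q Real.pi = 2 * ellipticK q := by
  have hd (θ : ℝ) : HasDerivAt (fun θ => ellipticF q (Real.pi - θ) + ellipticF q θ) 0 θ := by
    refine (((hasDerivAt_ellipticF hq (Real.pi - θ)).comp_const_sub Real.pi θ).add
      (hasDerivAt_ellipticF hq θ)).congr_deriv ?_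
    rw [Real.sin_pi_sub, neg_add_cancel]
  have h := is_const_of_deriv_eq_zero (fun y => (hd y).differentiableAt) (fun y => (hd y).deriv)
    0 (Real.pi / 2)
  simp only [ellipticF_zero, sub_zero, sub_half, add_zero] at h
  rw [h, ← two_mul]
  rfl

lemma ellipticF_add_int_mul_pi (θ : ℝ) (n : ℤ) :
    ellipticF q (θ + n * Real.pi) = ellipticF q θ + n * (2 * ellipticK q) := by
  rw [← ellipticF_pi hq]
  exact apply_add_int_mul_of_periodic_hasDerivAt (hasDerivAt_ellipticF hq)
    (fun θ => by simp only [Real.sin_add_pi, neg_sq]) (ellipticF_zero q) θ n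

lemma ellipticF_int_mul_pi (n : ℤ) : ellipticF q (n * Real.pi) = n * (2 * ellipticK q) := by
  rw [← zero_add (n * Real.pi), ellipticF_add_int_mul_pi hq, ellipticF_zero, zero_add]

lemma surjective_ellipticF : Function.Surjective (ellipticF q) := fun y => by
  have hK : 0 < 2 * ellipticK q := mul_pos two_pos (ellipticK_pos hq)
  refine mem_range_of_exists_le_of_exists_ge (continuous_ellipticF hq)
    ⟨⌊y / (2 * ellipticK q)⌋ * Real.pi, ?_⟩ ⟨⌈y / (2 * ellipticK q)⌉ * Real.pi, ?_⟩
  · rw [ellipticF_int_mul_pi hq, ← le_div_iff₀ hK]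
    exact Int.floor_le _
  · rw [ellipticF_int_mul_pi hq, ← div_le_iff₀ hK]
    exact Int.le_ceil _

lemma exists_amplitude (r : ℝ) : ∃ θ : ℝ → ℝ, (∀ y, ellipticF q (θ y) = r * y) ∧
    ∀ y, HasDerivAt θ (r * √(1 - q * Real.sin (θ y) ^ 2)) y := by
  set F := (strictMono_ellipticF hq).orderIsoOfSurjective _ (surjective_ellipticF hq)
  have hF (y : ℝ) : ellipticF q (F.symm y) = y := F.apply_symm_apply y
  refine ⟨fun y => F.symm (r * y), fun y => hF _, fun y => ?_⟩
  have hsymm : HasDerivAt F.symm (1 / √(1 - q * Real.sin (F.symm (r * y)) ^ 2))⁻¹ (r * y) :=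
    (hasDerivAt_ellipticF hq _).of_local_left_inverse F.symm.continuous.continuousAt
      (one_div_pos.mpr (Real.sqrt_pos.mpr (one_sub_mul_sin_sq_pos hq _))).ne'
      (Filter.Eventually.of_forall hF)
  refine (hsymm.comp y ((hasDerivAt_id y).const_mul r)).congr_deriv ?_
  rw [one_div, inv_inv, mul_one, mul_comm]

end Elliptic

section Amplitude

variable {q r : ℝ} {θ : ℝ → ℝ} {y : ℝ}
  (hθ : HasDerivAt θ (r * √(1 - q * Real.sin (θ y) ^ 2)) y)

include hθ

lemma hasDerivAt_sin_amplitude_sq :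
    HasDerivAt (fun y => Real.sin (θ y) ^ 2) (2 * r *
      (Real.sin (θ y) * Real.cos (θ y) * √(1 - q * Real.sin (θ y) ^ 2))) y :=
  (hθ.sin.pow 2).congr_deriv (by push_cast; ring)

lemma hasDerivAt_delta_amplitude (hq : q < 1) :
    HasDerivAt (fun y => √(1 - q * Real.sin (θ y) ^ 2))
      (-(r * q * (Real.sin (θ y) * Real.cos (θ y)))) y := by
  have hpos := one_sub_mul_sin_sq_pos hq (θ y)
  have := (Real.sqrt_pos.mpr hpos).ne'
  refine ((((hasDerivAt_sin_amplitude_sq hθ).const_mul q).const_sub 1).sqrt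
    hpos.ne').congr_deriv ?_
  field_simp

lemma hasDerivAt_deriv_sin_amplitude_sq (hq : q < 1) :
    HasDerivAt (fun y => 2 * r *
      (Real.sin (θ y) * Real.cos (θ y) * √(1 - q * Real.sin (θ y) ^ 2)))
      (2 * r ^ 2 *
        (1 - 2 * (1 + q) * Real.sin (θ y) ^ 2 + 3 * q * (Real.sin (θ y) ^ 2) ^ 2)) y := by
  have hsq := Real.sq_sqrt (one_sub_mul_sin_sq_pos hq (θ y)).le
  refine (((hθ.sin.mul hθ.cos).mul (hasDerivAt_delta_amplitude hθ hq)).const_mul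
    (2 * r)).congr_deriv ?_
  simp only [Pi.mul_apply]
  linear_combination 2 * r ^ 2 * (Real.cos (θ y) ^ 2 - Real.sin (θ y) ^ 2) * hsq +
    2 * r ^ 2 * (1 - 2 * q * Real.sin (θ y) ^ 2) * Real.cos_sq' (θ y)

end Amplitude

section HalfPeriod

variable {a m : ℝ}

lemma a2Const_sub_a3Const (a m : ℝ) : a2Const a m - a3Const a m = betaConst a m / 2 - a := by
  rw [a2Const, a3Const]
  ring

section

variable (ha : 0 < a) (hm : m ≠ 0)

include ha hm

lemma betaConst_half_sub_pos : 0 < betaConst a m / 2 - a := by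
  have : 0 < m ^ 2 / a ^ 2 := by positivity
  rw [betaConst]
  linarith

lemma a2Const_mul_a3Const :
    a2Const a m * a3Const a m = a * (a2Const a m - a3Const a m) := by
  have hs := betaConst_half_sub_pos ha hm
  rw [a2Const_sub_a3Const, a2Const, a3Const]
  generalize betaConst a m / 2 - a = s at hs
  linear_combination Real.mul_self_sqrt (show 0 ≤ s ^ 2 + 4 * a * s by positivity) / 4

lemma a3Const_pos : 0 < a3Const a m := by
  have hs := betaConst_half_sub_pos ha hm
  rw [a3Const]
  generalize betaConst a m / 2 - a = s at hs
  have : s < √(s ^ 2 + 4 * a * s) :=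
    Real.lt_sqrt_of_sq_lt (lt_add_of_pos_right _ (by positivity))
  linarith

lemma modulusSq_lt_one : modulusSq a m < 1 := by
  have hs := betaConst_half_sub_pos ha hm
  have h3 := a3Const_pos ha hm
  rw [modulusSq, div_lt_one (by linarith)]
  linarith [a2Const_sub_a3Const a m]

lemma sqrt_mul_halfPeriod :
    √(2 * (a + a3Const a m)) * halfPeriod a m = ellipticK (modulusSq a m) := by
  have h3 := a3Const_pos ha hm
  exact mul_div_cancel₀ _ (Real.sqrt_pos.mpr (by positivity)).ne'

lemma halfPeriod_pos : 0 < halfPeriod a m := by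
  have h3 := a3Const_pos ha hm
  exact div_pos (ellipticK_pos (modulusSq_lt_one ha hm)) (Real.sqrt_pos.mpr (by positivity))

variable {w w₁ : ℝ → ℝ} (hw0 : w 0 = a) (hw0' : w₁ 0 = 0) (hw : ∀ y, HasDerivAt w (w₁ y) y)
  (hw₁ : ∀ y, HasDerivAt w₁ (4 * betaConst a m * w y - 12 * w y ^ 2) y)

include hw0 hw0' hw hw₁

/-- `w = a₁ - (a₁ - a₂) sn²(r y, k)`. -/
lemma exists_amplitude_of_second_order : ∃ θ : ℝ → ℝ,
    (∀ y, ellipticF (modulusSq a m) (θ y) = √(2 * (a + a3Const a m)) * y) ∧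
      ∀ y, w y = a - (a - a2Const a m) * Real.sin (θ y) ^ 2 := by
  have h3 := a3Const_pos ha hm
  have hq := modulusSq_lt_one ha hm
  have hr := Real.sq_sqrt (show 0 ≤ 2 * (a + a3Const a m) by positivity)
  have hqa : modulusSq a m * (a + a3Const a m) = a - a2Const a m :=
    div_mul_cancel₀ _ (by positivity)
  obtain ⟨θ, hθF, hθ⟩ := exists_amplitude hq √(2 * (a + a3Const a m))
  have hθ0 : θ 0 = 0 := (strictMono_ellipticF hq).injective <| by
    rw [hθF, mul_zero, ellipticF_zero]
  have hv (y : ℝ) := ((hasDerivAt_sin_amplitude_sq (hθ y)).const_mul (a - a2Const a m)).const_sub a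
  have hv₁ (y : ℝ) :=
    ((hasDerivAt_deriv_sin_amplitude_sq (hθ y) hq).const_mul (a - a2Const a m)).neg
  have hvc : Continuous fun y => a - (a - a2Const a m) * Real.sin (θ y) ^ 2 :=
    continuous_iff_continuousAt.mpr fun y => (hv y).continuousAt
  have hwc : Continuous w := continuous_iff_continuousAt.mpr fun y => (hw y).continuousAt
  refine ⟨θ, hθF, fun y => sub_eq_zero.mp ?_⟩
  refine eq_zero_of_linear_second_order
    (k := fun y => 4 * betaConst a m - 12 * (w y + (a - (a - a2Const a m) * Real.sin (θ y) ^ 2)))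
    (continuous_const.sub (continuous_const.mul (hwc.add hvc))) (fun y => (hw y).sub (hv y))
    (fun y => ((hw₁ y).sub (hv₁ y)).congr_deriv ?_) (by simp [hw0, hθ0]) (by simp [hw0', hθ0]) y
  have hβ : betaConst a m = 2 * (a2Const a m - a3Const a m + a) := by
    linarith [a2Const_sub_a3Const a m]
  rw [hr, hβ]
  simp only [Pi.sub_apply]
  linear_combination 4 * (a - a2Const a m) * (3 * (Real.sin (θ y) ^ 2) ^ 2 -
    2 * Real.sin (θ y) ^ 2) * hqa - 4 * a2Const_mul_a3Const ha hm

theorem periodic_two_mul_halfPeriod : Function.Periodic w (2 * halfPeriod a m) := fun y => by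
  obtain ⟨θ, hθF, hwθ⟩ := exists_amplitude_of_second_order ha hm hw0 hw0' hw hw₁
  have hq := modulusSq_lt_one ha hm
  have hθ : θ (y + 2 * halfPeriod a m) = θ y + Real.pi := by
    have hF := ellipticF_add_int_mul_pi hq (θ y) 1
    rw [Int.cast_one, one_mul] at hF
    apply (strictMono_ellipticF hq).injective
    rw [hθF, hF, hθF]
    linear_combination 2 * sqrt_mul_halfPeriod ha hm
  rw [hwθ, hwθ, hθ, Real.sin_add_pi, neg_sq]

theorem exists_int_mul_of_apply_eq_apply_zero (ha₂ : a2Const a m ≠ a) {b : ℝ} (hb : w b = a) :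
    ∃ n : ℤ, b = n * (2 * halfPeriod a m) := by
  obtain ⟨θ, hθF, hwθ⟩ := exists_amplitude_of_second_order ha hm hw0 hw0' hw hw₁
  have hsin : Real.sin (θ b) = 0 := by
    rw [hwθ, sub_eq_self, mul_eq_zero, sq_eq_zero_iff] at hb
    exact hb.resolve_left (sub_ne_zero.mpr ha₂.symm)
  obtain ⟨n, hn⟩ := Real.sin_eq_zero_iff.mp hsin
  have h3 := a3Const_pos ha hm
  have h := hθF b
  rw [← hn, ellipticF_int_mul_pi (modulusSq_lt_one ha hm), ← sqrt_mul_halfPeriod ha hm] at h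
  have hr : √(2 * (a + a3Const a m)) ≠ 0 := (Real.sqrt_pos.mpr (by positivity)).ne'
  refine ⟨n, mul_left_cancel₀ hr ?_⟩
  linear_combination -h

end

end HalfPeriod

lemma gFun_zero (w : ℝ → ℝ) (c : ℂ) (s : ℝ) : gFun w c s 0 = 0 := by
  rw [gFun, intervalIntegral.integral_same]

section PhaseFunctions

variable {w : ℝ → ℝ} {c : ℂ}

lemma gFun_add_int_mul {s p : ℝ} (hw : Continuous w) (hne : ∀ y, s * w y - c.re ≠ 0)
    (hp : Function.Periodic w p) (y : ℝ) (n : ℤ) :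
    gFun w c s (y + n * p) = gFun w c s y + n * gFun w c s p :=
  apply_add_int_mul_of_periodic_hasDerivAt (hasDerivAt_gFun hw hne)
    (hp.comp fun v => s * c.im / (s * v - c.re)) (gFun_zero w c s) y n

lemma IsSpectrum.sum_div_mul_sub {d : Fin 3 → ℝ} {β ρ w w₁ b : ℝ} (h : IsSpectrum d β ρ)
    (hb : b ≠ 0) (hw : w₁ ^ 2 = 4 * β * w ^ 2 - 8 * w ^ 3 - 4 * (ρ ^ 2 + b ^ 2)) :
    ∑ j, d j / (d j * w - ρ) = (8 * β * w - 24 * w ^ 2) / (w₁ ^ 2 + 4 * b ^ 2) := by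
  have hne := h.mul_sub_ne_zero hb hw
  have hprod : (d 0 * w - ρ) * (d 1 * w - ρ) * (d 2 * w - ρ) = ρ * (w₁ ^ 2 + 4 * b ^ 2) / 4 := by
    rw [hw]
    linear_combination w ^ 3 * h.prod - w ^ 2 * ρ * h.pair + w * ρ ^ 2 * h.sum
  have hnum : d 0 * (d 1 * w - ρ) * (d 2 * w - ρ) + d 1 * (d 0 * w - ρ) * (d 2 * w - ρ) +
      d 2 * (d 0 * w - ρ) * (d 1 * w - ρ) = ρ * (8 * β * w - 24 * w ^ 2) / 4 := by
    linear_combination 3 * w ^ 2 * h.prod - 2 * w * ρ * h.pair + ρ ^ 2 * h.sum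
  have hpos : w₁ ^ 2 + 4 * b ^ 2 ≠ 0 := by positivity
  have hρ := h.ne_zero
  rw [Fin.sum_univ_three, div_add_div _ _ (hne 0) (hne 1),
    div_add_div _ _ (mul_ne_zero (hne 0) (hne 1)) (hne 2), hprod,
    div_eq_div_iff (div_ne_zero (mul_ne_zero hρ hpos) four_ne_zero) hpos]
  linear_combination (w₁ ^ 2 + 4 * b ^ 2) * hnum

lemma hasDerivAt_arctan_div {w₁ : ℝ → ℝ} {w₂ b y : ℝ} (hb : b ≠ 0) (hw₁ : HasDerivAt w₁ w₂ y) :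
    HasDerivAt (fun y => Real.arctan (w₁ y / b)) (b * w₂ / (w₁ y ^ 2 + b ^ 2)) y := by
  refine (hw₁.div_const b).arctan.congr_deriv ?_
  have : w₁ y ^ 2 + b ^ 2 ≠ 0 := by positivity
  have : 1 + (w₁ y / b) ^ 2 ≠ 0 := by positivity
  field_simp
  ring

section SumOfPhases

variable {w₁ : ℝ → ℝ} {d : Fin 3 → ℝ} {β : ℝ} (hsp : IsSpectrum d β c.re) (him : c.im ≠ 0)
  (hcont : Continuous w) (hw₁ : ∀ y, HasDerivAt w₁ (4 * β * w y - 12 * w y ^ 2) y)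
  (hw : ∀ y, w₁ y ^ 2 = 4 * β * w y ^ 2 - 8 * w y ^ 3 - 4 * (c.re ^ 2 + c.im ^ 2))
  (h0 : w₁ 0 = 0)

include hsp him hcont hw₁ hw h0

theorem sum_gFun (y : ℝ) : ∑ j, gFun w c (d j) y = Real.arctan (w₁ y / (2 * c.im)) := by
  have hne (j : Fin 3) (y : ℝ) := hsp.mul_sub_ne_zero him (hw y) j
  have hderiv (y : ℝ) : HasDerivAt
      (fun y => ∑ j, gFun w c (d j) y - Real.arctan (w₁ y / (2 * c.im))) 0 y := by
    refine ((HasDerivAt.fun_sum fun j _ => hasDerivAt_gFun hcont (hne j) y).sub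
      (hasDerivAt_arctan_div (mul_ne_zero two_ne_zero him) (hw₁ y))).congr_deriv ?_
    simp only [mul_div_right_comm _ c.im]
    rw [← Finset.sum_mul, hsp.sum_div_mul_sub him (hw y)]
    ring
  have hconst := is_const_of_deriv_eq_zero (fun y => (hderiv y).differentiableAt)
    (fun y => (hderiv y).deriv) y 0
  simp only [gFun_zero, h0, zero_div, Real.arctan_zero, Finset.sum_const_zero, sub_zero] at hconst
  exact sub_eq_zero.mp hconst

lemma sum_gFun_eq_zero {p : ℝ} (hp : w p = w 0) : ∑ j, gFun w c (d j) p = 0 := by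
  have hsq : w₁ p ^ 2 = 0 := by rw [hw, hp, ← hw, h0, sq, mul_zero]
  rw [sum_gFun hsp him hcont hw₁ hw h0, sq_eq_zero_iff.mp hsq, zero_div, Real.arctan_zero]

end SumOfPhases

end PhaseFunctions

lemma linearIndependent_pair_iff_det {a b : ℂ} :
    LinearIndependent ℝ ![a, b] ↔ a.re * b.im - a.im * b.re ≠ 0 := by
  have hcoord : LinearIndependent ℝ ![a, b] ↔
      LinearIndependent ℝ (!![a.re, a.im; b.re, b.im] : Matrix (Fin 2) (Fin 2) ℝ).row := by
    have hrow : ⇑(Complex.basisOneI.equivFun : ℂ →ₗ[ℝ] Fin 2 → ℝ) ∘ ![a, b] =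
        (!![a.re, a.im; b.re, b.im] : Matrix (Fin 2) (Fin 2) ℝ).row := by
      ext i j
      fin_cases i <;> fin_cases j <;> simp
    rw [← hrow]
    exact (LinearMap.linearIndependent_iff_of_injOn _
      Complex.basisOneI.equivFun.injective.injOn).symm
  rw [hcoord, Matrix.linearIndependent_rows_iff_isUnit, Matrix.isUnit_iff_isUnit_det,
    Matrix.det_fin_two_of, isUnit_iff_ne_zero]

section CommensurablePhases

variable {d g : Fin 3 → ℝ} {θ a a' : ℝ} {n n' : ℤ} {k k' : Fin 3 → ℤ}

lemma exists_rat_div_eq_of_phases (hθ : θ ≠ 0) (hdet : a * n' - a' * n ≠ 0)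
    (hk : ∀ j, d j * a + n * g j = θ * k j) (hk' : ∀ j, d j * a' + n' * g j = θ * k' j)
    (i j : Fin 3) : ∃ q : ℚ, d i / d j = q := by
  have hd (j : Fin 3) : d j = θ * (k j * n' - k' j * n : ℤ) / (a * n' - a' * n) := by
    rw [eq_div_iff hdet]
    push_cast
    linear_combination n' * hk j - n * hk' j
  refine ⟨(k i * n' - k' i * n : ℤ) / (k j * n' - k' j * n : ℤ), ?_⟩
  rw [hd i, hd j, div_div_div_cancel_right₀ hdet, mul_div_mul_left _ _ hθ]
  push_cast
  rfl

lemma exists_rat_phase_eq_of_phases {i j : Fin 3} (hθ : θ ≠ 0) (hi : d i ≠ 0) (hn : n ≠ 0)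
    (hk : ∀ j, d j * a + n * g j = θ * k j) {q : ℚ} (hq : d j / d i = q) :
    ∃ r : ℚ, 1 / θ * (d j / d i * g i - g j) = r := by
  have hn' : (n : ℝ) ≠ 0 := by exact_mod_cast hn
  refine ⟨(q * k i - k j) / n, ?_⟩
  push_cast
  rw [← hq, one_div_mul_eq_div, div_eq_div_iff hθ hn']
  have hd : d j / d i * d i = d j := div_mul_cancel₀ _ hi
  linear_combination (d j / d i) * hk i - hk j - a * hd

end CommensurablePhases

/-- `F` is a lift of `f` to the unit sphere whose coordinates in the orthonormal basis `m` are
`h j y * exp (i (d j * x + G j y))`, where the amplitudes `h` have the smallest common period `p`,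
the phases `G` increase by `G j p` over each period, and the frequencies `d` and the increments
`G j p` both sum to zero. These are the properties of the canonical lift that determine the periods
of `f`. -/
structure IsQuasiperiodicLift (f : ℂ → ℙ ℂ (Fin 3 → ℂ)) (F : ℂ → Fin 3 → ℂ)
    (m : Fin 3 → Fin 3 → ℂ) (d : Fin 3 → ℝ) (h G : Fin 3 → ℝ → ℝ) (p : ℝ) : Prop where
  hdot_self : ∀ z, hdot (F z) (F z) = 1
  mem_submodule : ∀ z, F z ∈ (f z).submodule
  orthonormal : ∀ j k, hdot (m j) (m k) = if j = k then 1 else 0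
  hdot_eq : ∀ z j, hdot (F z) (m j) =
    h j z.im * Complex.exp ((d j * z.re + G j z.im : ℝ) * I)
  period_pos : 0 < p
  amplitude_pos : ∀ j y, 0 < h j y
  amplitude_periodic : ∀ j, Function.Periodic (h j) p
  exists_int_mul_eq : ∀ y, (∀ j, h j y = h j 0) → ∃ n : ℤ, y = n * p
  phase_zero : ∀ j, G j 0 = 0
  phase_add_int_mul : ∀ j y (n : ℤ), G j (y + n * p) = G j y + n * G j p
  sum_frequency : ∑ j, d j = 0
  sum_phase : ∑ j, G j p = 0

namespace IsQuasiperiodicLift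

variable {f : ℂ → ℙ ℂ (Fin 3 → ℂ)} {F : ℂ → Fin 3 → ℂ} {m : Fin 3 → Fin 3 → ℂ}
  {d : Fin 3 → ℝ} {h G : Fin 3 → ℝ → ℝ} {p : ℝ} (hF : IsQuasiperiodicLift f F m d h G p)

include hF

lemma exists_unit_mul_amplitude_eq {o : ℂ} (ho : f o = f 0) : ∃ χ : ℂ, ‖χ‖ = 1 ∧
    ∀ j, h j o.im * Complex.exp ((d j * o.re + G j o.im : ℝ) * I) = χ * h j 0 := by
  have hFo : F o = hdot (F o) (F 0) • F 0 :=
    eq_hdot_smul_of_mem_submodule (ho ▸ hF.mem_submodule o) (hF.mem_submodule 0) (hF.hdot_self 0)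
  have hnorm : ‖hdot (F o) (F 0)‖ ^ 2 = 1 := by
    have hself := hF.hdot_self o
    rw [hFo, hdot_smul_left, hdot_smul_right, hF.hdot_self, mul_one, Complex.mul_conj'] at hself
    exact_mod_cast hself
  refine ⟨_, (pow_eq_one_iff_of_nonneg (norm_nonneg _) two_ne_zero).mp hnorm, fun j => ?_⟩
  have h0 : hdot (F 0) (m j) = h j 0 := by simp [hF.hdot_eq, hF.phase_zero]
  rw [← hF.hdot_eq, ← h0, ← hdot_smul_left, ← hFo]

lemma exists_int_exp_phase_eq {o : ℂ} (ho : f o = f 0) : ∃ (n : ℤ) (χ : ℂ), o.im = n * p ∧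
    ∀ j, Complex.exp ((d j * o.re + n * G j p : ℝ) * I) = χ := by
  obtain ⟨χ, hχ, hcoord⟩ := hF.exists_unit_mul_amplitude_eq ho
  have hamp (j : Fin 3) : h j o.im = h j 0 := by
    have hnorm := congrArg norm (hcoord j)
    rwa [norm_mul, norm_mul, Complex.norm_exp_ofReal_mul_I, hχ, mul_one, one_mul,
      Complex.norm_of_nonneg (hF.amplitude_pos _ _).le,
      Complex.norm_of_nonneg (hF.amplitude_pos _ _).le] at hnorm
  obtain ⟨n, hn⟩ := hF.exists_int_mul_eq o.im hamp
  refine ⟨n, χ, hn, fun j => ?_⟩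
  have hG : G j o.im = n * G j p := by
    rw [hn, ← zero_add (n * p), hF.phase_add_int_mul, hF.phase_zero, zero_add]
  have hne : (h j 0 : ℂ) ≠ 0 := by exact_mod_cast (hF.amplitude_pos j 0).ne'
  have hj := hcoord j
  rw [hamp, mul_comm, hG] at hj
  exact mul_right_cancel₀ hne hj

lemma sum_mul_add_mul_phase (a : ℝ) (n : ℤ) : ∑ j, (d j * a + n * G j p) = 0 := by
  rw [Finset.sum_add_distrib, ← Finset.sum_mul, ← Finset.mul_sum, hF.sum_frequency, hF.sum_phase,
    zero_mul, mul_zero, add_zero]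

/-- The phases of a period agree, and they sum to zero, so their common exponential is a cube root
of unity. -/
lemma exists_int_phases_of_apply_eq {o : ℂ} (ho : f o = f 0) : ∃ (n : ℤ) (k : Fin 3 → ℤ),
    o.im = n * p ∧ ∀ j, d j * o.re + n * G j p = 2 * Real.pi / 3 * k j := by
  obtain ⟨n, χ, hn, hχ⟩ := hF.exists_int_exp_phase_eq ho
  have hcube : χ ^ 3 = 1 := by
    calc χ ^ 3 = ∏ j, Complex.exp ((d j * o.re + n * G j p : ℝ) * I) := by
          simp only [hχ, Finset.prod_const, Finset.card_univ, Fintype.card_fin]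
      _ = Complex.exp ((∑ j, (d j * o.re + n * G j p) : ℝ) * I) := by
        rw [← Complex.exp_sum, ← Finset.sum_mul, Complex.ofReal_sum]
      _ = 1 := by rw [hF.sum_mul_add_mul_phase]; simp
  have hk (j : Fin 3) : ∃ k : ℤ, d j * o.re + n * G j p = 2 * Real.pi / 3 * k := by
    rw [← hχ j, ← Complex.exp_nat_mul, Complex.exp_eq_one_iff] at hcube
    obtain ⟨k, hk⟩ := hcube
    refine ⟨k, ?_⟩
    have hI : (3 * (d j * o.re + n * G j p) : ℝ) * I = (2 * Real.pi * k : ℝ) * I := by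
      push_cast at hk ⊢
      linear_combination hk
    have := Complex.ofReal_injective (mul_right_cancel₀ Complex.I_ne_zero hI)
    linarith
  choose k hk using hk
  exact ⟨n, k, hn, hk⟩

lemma apply_add_eq_of_phases {a : ℝ} {n : ℤ}
    (hk : ∀ j, ∃ k : ℤ, d j * a + n * G j p = 2 * Real.pi * k) (z : ℂ) :
    f (z + (a + n * p * I)) = f z := by
  have hre : (z + (a + n * p * I)).re = z.re + a := by simp
  have him : (z + (a + n * p * I)).im = z.im + n * p := by simp
  have hFz : F (z + (a + n * p * I)) = F z := by
    rw [eq_sum_of_orthonormal hF.orthonormal (F (z + _)),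
      eq_sum_of_orthonormal hF.orthonormal (F z)]
    refine Finset.sum_congr rfl fun j _ => ?_
    obtain ⟨k, hk⟩ := hk j
    have hphase : d j * (z.re + a) + (G j z.im + n * G j p) =
        d j * z.re + G j z.im + k * (2 * Real.pi) := by linear_combination hk
    have hexp : Complex.exp ((k * (2 * Real.pi) : ℝ) * I) = 1 :=
      Complex.exp_eq_one_iff.mpr ⟨k, by push_cast; ring⟩
    rw [hF.hdot_eq, hF.hdot_eq, hre, him, (hF.amplitude_periodic j).int_mul n,
      hF.phase_add_int_mul, hphase, Complex.ofReal_add _ (k * _), add_mul, Complex.exp_add,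
      hexp, mul_one]
  have hne : F z ≠ 0 := fun h0 => by simpa [h0, hdot] using hF.hdot_self z
  exact eq_of_mem_submodule hne (hFz ▸ hF.mem_submodule _) (hF.mem_submodule z)

lemma exists_rat_of_descendsToTorus (hd : d 0 ≠ 0) (hf : DescendsToTorus f) :
    (∃ q : ℚ, d 0 / d 1 = q) ∧
      ∃ q : ℚ, 1 / (2 * Real.pi) * (d 1 / d 0 * G 0 p - G 1 p) = q := by
  obtain ⟨o, o', hli, ho, ho'⟩ := hf
  obtain ⟨n, k, hn, hk⟩ := hF.exists_int_phases_of_apply_eq (o := o) (by simpa using ho 0)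
  obtain ⟨n', k', hn', hk'⟩ := hF.exists_int_phases_of_apply_eq (o := o') (by simpa using ho' 0)
  have hθ : 2 * Real.pi / 3 ≠ 0 := by positivity
  have hdet : o.re * n' - o'.re * n ≠ 0 := fun h0 => by
    rw [linearIndependent_pair_iff_det, hn, hn'] at hli
    exact hli (by linear_combination p * h0)
  refine ⟨exists_rat_div_eq_of_phases hθ hdet hk hk' 0 1, ?_⟩
  obtain ⟨q, hq⟩ := exists_rat_div_eq_of_phases hθ hdet hk hk' 1 0
  suffices ∃ r : ℚ, 1 / (2 * Real.pi / 3) * (d 1 / d 0 * G 0 p - G 1 p) = r by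
    obtain ⟨r, hr⟩ := this
    refine ⟨r / 3, ?_⟩
    push_cast
    rw [← hr]
    ring
  by_cases h0 : n = 0
  · exact exists_rat_phase_eq_of_phases hθ hd (fun h0' => hdet (by simp [h0, h0'])) hk' hq
  · exact exists_rat_phase_eq_of_phases hθ hd h0 hk hq

lemma descendsToTorus_of_rat (hd₀ : d 0 ≠ 0) (hd₁ : d 1 ≠ 0) {q r : ℚ}
    (hq : d 0 / d 1 = q)
    (hr : 1 / (2 * Real.pi) * (d 1 / d 0 * G 0 p - G 1 p) = r) : DescendsToTorus f := by
  have hperiod (a : ℝ) (n k₀ k₁ : ℤ) (h0 : d 0 * a + n * G 0 p = 2 * Real.pi * k₀)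
      (h1 : d 1 * a + n * G 1 p = 2 * Real.pi * k₁) (z : ℂ) : f (z + (a + n * p * I)) = f z := by
    have hsum := hF.sum_mul_add_mul_phase a n
    rw [Fin.sum_univ_three] at hsum
    refine hF.apply_add_eq_of_phases (fun j => ?_) z
    fin_cases j
    · exact ⟨k₀, h0⟩
    · exact ⟨k₁, h1⟩
    · refine ⟨-k₀ - k₁, ?_⟩
      push_cast
      linear_combination hsum - h0 - h1
  have hqd : (q.den : ℝ) ≠ 0 := by exact_mod_cast q.den_nz
  have hrd : (r.den : ℝ) ≠ 0 := by exact_mod_cast r.den_nz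
  rw [Rat.cast_def, div_eq_div_iff hd₁ hqd] at hq
  rw [Rat.cast_def, one_div_mul_eq_div, div_eq_div_iff (by positivity) hrd] at hr
  refine ⟨_, _, ?_, hperiod (2 * Real.pi * q.den / d 1) 0 q.num q.den ?_ ?_,
    hperiod (-(r.den * G 0 p / d 0)) r.den 0 (-r.num) ?_ ?_⟩
  · rw [linearIndependent_pair_iff_det]
    simp [hd₁, hF.period_pos.ne']
  all_goals push_cast
  · field_simp
    linear_combination 2 * Real.pi * hq
  · field_simp
    ring
  · field_simp
    ring
  · have hcancel : d 1 * -(r.den * G 0 p / d 0) = -(r.den * (d 1 / d 0 * G 0 p)) := by ring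
    rw [hcancel]
    linear_combination -hr

theorem descendsToTorus_iff (hd₀ : d 0 ≠ 0) (hd₁ : d 1 ≠ 0) :
    DescendsToTorus f ↔ (∃ q : ℚ, d 0 / d 1 = q) ∧
      ∃ q : ℚ, 1 / (2 * Real.pi) * (d 1 / d 0 * G 0 p - G 1 p) = q :=
  ⟨hF.exists_rat_of_descendsToTorus hd₀,
    fun ⟨⟨_, hq⟩, _, hr⟩ => hF.descendsToTorus_of_rat hd₀ hd₁ hq hr⟩

end IsQuasiperiodicLift

lemma eq_of_hFun_eq {w : ℝ → ℝ} {c : ℂ} {s y y' : ℝ} (hs : s ≠ 0)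
    (hpos : ∀ y, 0 < (s * w y - c.re) / (s ^ 3 - c.re)) (h : hFun w c s y = hFun w c s y') :
    w y = w y' := by
  have hden : s ^ 3 - c.re ≠ 0 := fun h0 => by simpa [h0] using hpos y
  rwa [hFun, hFun, Real.sqrt_inj (hpos y).le (hpos y').le, div_left_inj' hden, sub_left_inj,
    mul_right_inj' hs] at h

section Profile

variable {f : ℂ → ℙ ℂ (Fin 3 → ℂ)} {u : ℂ → ℝ} {H : ℂ → Fin 3 → ℂ} {m : ℝ}
  (hH : IsConformalLift f u H) (hmin : HasZeroMeanCurvature f)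
  (hequiv : IsTranslationallyEquivariant f) (hY : dY u 0 = 0) (hm : ∀ z, ‖hopfCoeff H z‖ = m)

include hH hmin hequiv hY hm

lemma IsConformalLift.sq_profile_mul_dY_u (y : ℝ) :
    (profile u y * dY u (y * I)) ^ 2 =
      4 * betaConst (Real.exp (u 0)) m * profile u y ^ 2 - 8 * profile u y ^ 3 - 4 * m ^ 2 := by
  rw [← profile_zero]
  exact sq_deriv_eq_of_gauss (w₁ := fun y => profile u y * dY u (y * I))
    (fun _ => Real.exp_pos _) (hasDerivAt_exp_comp_mul_I hH.differentiable_u)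
    (fun y => hm (y * I) ▸ hH.hasDerivAt_exp_mul_dY_u hmin hequiv y) (by simp [hY]) y

lemma IsConformalLift.hasDerivAt_profile_mul_dY_u (y : ℝ) :
    HasDerivAt (fun y : ℝ => profile u y * dY u (y * I))
      (4 * betaConst (Real.exp (u 0)) m * profile u y - 12 * profile u y ^ 2) y := by
  rw [← profile_zero]
  exact hasDerivAt_deriv_of_gauss (fun _ => Real.exp_pos _)
    (hasDerivAt_exp_comp_mul_I hH.differentiable_u)
    (fun y => hm (y * I) ▸ hH.hasDerivAt_exp_mul_dY_u hmin hequiv y) (by simp [hY]) y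

end Profile

section Assembly

variable {f : ℂ → ℙ ℂ (Fin 3 → ℂ)} {u : ℂ → ℝ} {F : ℂ → Fin 3 → ℂ} {c : ℂ} {d : Fin 3 → ℝ}
  {l : Fin 3 → Fin 3 → ℂ} {A : Matrix (Fin 3) (Fin 3) ℂ}

lemma hdot_eq_of_eq_mulVec_sum (hA : Aᴴ * A = 1)
    (hl : ∀ j k, hdot (l j) (l k) = if j = k then 1 else 0) {w : ℝ → ℝ}
    (hF : ∀ x y : ℝ, F (x + y * I) = A *ᵥ ∑ j, ((hFun w c (d j) y : ℂ) *
      Complex.exp (I * (d j * x) + I * gFun w c (d j) y)) • l j) (z : ℂ) (j : Fin 3) :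
    hdot (F z) (A *ᵥ l j) = hFun w c (d j) z.im *
      Complex.exp ((d j * z.re + gFun w c (d j) z.im : ℝ) * I) := by
  have hexp : I * (d j * z.re) + I * gFun w c (d j) z.im =
      (d j * z.re + gFun w c (d j) z.im : ℝ) * I := by
    push_cast
    ring
  rw [← Complex.re_add_im z, hF, hdot_mulVec_mulVec hA, hdot_sum_left]
  simp only [hdot_smul_left, hl, mul_ite, mul_one, mul_zero, Finset.sum_ite_eq', Finset.mem_univ,
    if_true, Complex.re_add_im, hexp]

theorem IsConformalLift.isQuasiperiodicLift {m : ℝ} (hH : IsConformalLift f u F)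
    (hmin : HasZeroMeanCurvature f) (hequiv : IsTranslationallyEquivariant f) (hY : dY u 0 = 0)
    (hm : ∀ z, ‖hopfCoeff F z‖ = m) (hmc : m ^ 2 = c.re ^ 2 + c.im ^ 2) (him : c.im ≠ 0)
    (hsp : IsSpectrum d (betaConst (Real.exp (u 0)) m) c.re)
    (ha : a2Const (Real.exp (u 0)) m ≠ Real.exp (u 0))
    (hpos : ∀ j y, 0 < (d j * profile u y - c.re) / (d j ^ 3 - c.re)) (hA : Aᴴ * A = 1)
    (hl : ∀ j k, hdot (l j) (l k) = if j = k then 1 else 0)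
    (hF : ∀ x y : ℝ, F (x + y * I) = A *ᵥ ∑ j, ((hFun (profile u) c (d j) y : ℂ) *
      Complex.exp (I * (d j * x) + I * gFun (profile u) c (d j) y)) • l j) :
    IsQuasiperiodicLift f F (fun j => A *ᵥ l j) d (fun j => hFun (profile u) c (d j))
      (fun j => gFun (profile u) c (d j)) (2 * halfPeriod (Real.exp (u 0)) m) := by
  have hw := hasDerivAt_exp_comp_mul_I hH.differentiable_u
  have hw₁ := hH.hasDerivAt_profile_mul_dY_u hmin hequiv hY hm
  have hsq := hH.sq_profile_mul_dY_u hmin hequiv hY hm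
  have hw0' : profile u 0 * dY u ((0 : ℝ) * I) = 0 := by simp [hY]
  have hm0 : m ≠ 0 := fun h0 => by
    have : 0 < c.im ^ 2 := by positivity
    nlinarith
  have hcont : Continuous (profile u) :=
    continuous_iff_continuousAt.mpr fun y => (hw y).continuousAt
  have hne (j : Fin 3) (y : ℝ) : d j * profile u y - c.re ≠ 0 := fun h0 => by
    simpa [h0] using hpos j y
  have hper := periodic_two_mul_halfPeriod (Real.exp_pos (u 0)) hm0 (profile_zero u) hw0' hw hw₁
  exact {
    hdot_self := fun z => (hH.lift.1.2 z).1
    mem_submodule := fun z => (hH.lift.1.2 z).2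
    orthonormal := orthonormal_mulVec hA hl
    hdot_eq := hdot_eq_of_eq_mulVec_sum hA hl hF
    period_pos := mul_pos two_pos (halfPeriod_pos (Real.exp_pos _) hm0)
    amplitude_pos := fun j y => Real.sqrt_pos.mpr (hpos j y)
    amplitude_periodic := fun j => hper.comp fun v => √((d j * v - c.re) / (d j ^ 3 - c.re))
    exists_int_mul_eq := fun y h => exists_int_mul_of_apply_eq_apply_zero (Real.exp_pos (u 0)) hm0
      (profile_zero u) hw0' hw hw₁ ha
      ((eq_of_hFun_eq (hsp.apply_ne_zero 0) (hpos 0) (h 0)).trans (profile_zero u))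
    phase_zero := fun j => gFun_zero _ _ _
    phase_add_int_mul := fun j => gFun_add_int_mul hcont (hne j) hper
    sum_frequency := (Fin.sum_univ_three d).trans hsp.sum
    sum_phase := sum_gFun_eq_zero hsp him hcont hw₁ (fun y => hmc ▸ hsq y) hw0'
      (by simpa using hper 0) }

end Assembly

end MinLag

end

theorem mainTheorem8_general
    (f : ℂ → ℙ ℂ (Fin 3 → ℂ)) (u : ℂ → ℝ) (ψ : ℂ → ℂ) (lam : ℂ) (hlam : ‖lam‖ = 1)
    (hf : MinLag.IsMinimalLagrangian f u)
    (hHopf : MinLag.HasHopfDifferential f (fun z => -Complex.I * (lam ^ 3)⁻¹ * ψ z))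
    (hequiv : MinLag.IsTranslationallyEquivariant f)
    (hu : MinLag.dY u 0 = 0)
    (ha : MinLag.a2Const (Real.exp (u 0)) ‖ψ 0‖ ≠ Real.exp (u 0))
    (c : ℂ) (hc : c = (lam ^ 3)⁻¹ * ψ 0) (him : c.im ≠ 0) (hre : c.re ≠ 0)
    (T : ℝ) (hT : T = MinLag.halfPeriod (Real.exp (u 0)) ‖ψ 0‖)
    (w : ℝ → ℝ) (hw : ∀ y : ℝ, w y = Real.exp (u (y * Complex.I)))
    (d : Fin 3 → ℝ)
    (hd : (MinLag.matD lam (u 0) (ψ 0)).charpoly =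
      ∏ j, (Polynomial.X - Polynomial.C (Complex.I * (d j : ℂ)))) :
    (∃ Fr, MinLag.IsFrame f u ψ lam Fr) ∧
    (∀ j y, d j * w y - c.re ≠ 0 ∧ 0 < (d j * w y - c.re) / (d j ^ 3 - c.re)) ∧
    (∀ Fr, MinLag.IsFrame f u ψ lam Fr →
      ∃ l : Fin 3 → Fin 3 → ℂ,
        (∀ j k, MinLag.hdot (l j) (l k) = if j = k then 1 else 0) ∧
        (∀ j, (MinLag.matD lam (u 0) (ψ 0)).mulVec (l j) = (Complex.I * (d j : ℂ)) • l j) ∧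
        ∀ x y : ℝ, MinLag.canonicalLift Fr (x + y * Complex.I) =
          (Fr 0).mulVec (∑ j, ((MinLag.hFun w c (d j) y : ℂ) *
            Complex.exp (Complex.I * (d j * x) + Complex.I * MinLag.gFun w c (d j) y)) • l j)) ∧
    (MinLag.DescendsToTorus f ↔
      (∃ q : ℚ, d 0 / d 1 = (q : ℝ)) ∧
      (∃ q : ℚ, 1 / (2 * Real.pi) *
        (d 1 / d 0 * MinLag.gFun w c (d 0) (2 * T) - MinLag.gFun w c (d 1) (2 * T)) =
          (q : ℝ))) := by
  obtain rfl : w = MinLag.profile u := funext hw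
  obtain ⟨Fr, hFr⟩ := MinLag.exists_isFrame hf hHopf hlam
  have hsp := MinLag.isSpectrum_of_charpoly hlam hc him hre hd
  have hψ := MinLag.sq_norm_eq_of_eq_inv_pow_mul hlam hc
  have hφ {H : ℂ → Fin 3 → ℂ} (hH : MinLag.IsConformalLift f u H) (z : ℂ) :
      MinLag.hopfCoeff H z = -Complex.I * c := by
    rw [hH.hopfCoeff_eq_of_hasHopfDifferential hf.2 hequiv hHopf, hc, ← mul_assoc]
  have hH := hFr.isConformalLift hlam
  have hm (z : ℂ) : ‖MinLag.hopfCoeff (MinLag.canonicalLift Fr) z‖ = ‖ψ 0‖ := by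
    simp [hφ hH, hc, hlam]
  have hne (j : Fin 3) (y : ℝ) : d j * MinLag.profile u y - c.re ≠ 0 :=
    hsp.mul_sub_ne_zero him (hψ ▸ hH.sq_profile_mul_dY_u hf.2 hequiv hu hm y) j
  have hpos := hFr.radicand_pos hlam hequiv hu hsp hd hne
  have hlift {Fr' : ℂ → Matrix (Fin 3) (Fin 3) ℂ} (hFr' : MinLag.IsFrame f u ψ lam Fr') :=
    hFr'.exists_eigenbasis_canonicalLift_eq hlam hequiv hu hsp hd hne hf.2
      (hφ (hFr'.isConformalLift hlam))
  obtain ⟨l, hl, -, hF⟩ := hlift hFr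
  have hquasi := hH.isQuasiperiodicLift hf.2 hequiv hu hm hψ him hsp ha hpos
    (hFr.conjTranspose_mul 0) hl hF
  exact ⟨⟨Fr, hFr⟩, fun j y => ⟨hne j y, hpos j y⟩, fun _ => hlift,
    hT ▸ hquasi.descendsToTorus_iff (hsp.apply_ne_zero 0) (hsp.apply_ne_zero 1)⟩

/-- `f` is a translationally equivariant minimal Lagrangian surface with metric `2 e^u dz dz̄` and
Hopf differential `-i λ⁻³ ψ dz³`, i.e. with cubic form `c = λ⁻³ ψ` (evaluated at `0`). The origin
is chosen as usual, with `u'(0) = 0` and `a₂ < a₁ = e^{u(0)}`, so that `f` is not flat and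
`u` has its maximum over `y` at `0`. The `i d_j` are the eigenvalues of `D(λ)`, in any order. -/
theorem mainTheorem8
    (f : ℂ → ℙ ℂ (Fin 3 → ℂ)) (u : ℂ → ℝ) (ψ : ℂ → ℂ) (lam : ℂ) (hlam : ‖lam‖ = 1)
    (hf : MinLag.IsMinimalLagrangian f u)
    (hHopf : MinLag.HasHopfDifferential f (fun z => -Complex.I * (lam ^ 3)⁻¹ * ψ z))
    (hequiv : MinLag.IsTranslationallyEquivariant f)
    (hu : MinLag.dY u 0 = 0)
    (ha : MinLag.a2Const (Real.exp (u 0)) ‖ψ 0‖ < Real.exp (u 0))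
    (c : ℂ) (hc : c = (lam ^ 3)⁻¹ * ψ 0) (him : c.im ≠ 0) (hre : c.re ≠ 0)
    (T : ℝ) (hT : T = MinLag.halfPeriod (Real.exp (u 0)) ‖ψ 0‖)
    (w : ℝ → ℝ) (hw : ∀ y : ℝ, w y = Real.exp (u (y * Complex.I)))
    (d : Fin 3 → ℝ)
    (hd : (MinLag.matD lam (u 0) (ψ 0)).charpoly =
      ∏ j, (Polynomial.X - Polynomial.C (Complex.I * (d j : ℂ)))) :
    (∃ Fr, MinLag.IsFrame f u ψ lam Fr) ∧
    (∀ j y, d j * w y - c.re ≠ 0 ∧ 0 < (d j * w y - c.re) / (d j ^ 3 - c.re)) ∧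
    (∀ Fr, MinLag.IsFrame f u ψ lam Fr →
      ∃ l : Fin 3 → Fin 3 → ℂ,
        (∀ j k, MinLag.hdot (l j) (l k) = if j = k then 1 else 0) ∧
        (∀ j, (MinLag.matD lam (u 0) (ψ 0)).mulVec (l j) = (Complex.I * (d j : ℂ)) • l j) ∧
        ∀ x y : ℝ, MinLag.canonicalLift Fr (x + y * Complex.I) =
          (Fr 0).mulVec (∑ j, ((MinLag.hFun w c (d j) y : ℂ) *
            Complex.exp (Complex.I * (d j * x) + Complex.I * MinLag.gFun w c (d j) y)) • l j)) ∧
    (MinLag.DescendsToTorus f ↔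
      (∃ q : ℚ, d 0 / d 1 = (q : ℝ)) ∧
      (∃ q : ℚ, 1 / (2 * Real.pi) *
        (d 1 / d 0 * MinLag.gFun w c (d 0) (2 * T) - MinLag.gFun w c (d 1) (2 * T)) =
          (q : ℝ))) :=
  mainTheorem8_general f u ψ lam hlam hf hHopf hequiv hu ha.ne c hc him hre T hT w hw d hd
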